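/- **Notation.** Let $|q|<1$, $(q)_n=\prod_{k=1}^n(1-q^k)$, $(q)_\infty=\prod_{k\ge 1}(1-q^k)$, and for an integer $b\ge 1$ $$h_b(q)=\sum_{n\in\mathbb Z}\epsilon_b(n)\,q^{\frac{bn(n+1)}2-n},\qquad \epsilon_b(n)=(-1)^n\ (b\text{ odd}),\quad \epsilon_b(n)=1\ (b\text{ even},\,n\ge 0),\quad \epsilon_b(n)=-1\ (b\text{ even},\,n<0).$$ **The multisum.** Let $D$ be an alternating diagram of a knot with $c$ crossings, regarded as a 4-valent plane graph with edge set $E(D)$ (the arcs), set of faces $R$ and exterior face $X$. The faces are checkerboard coloured: a face is of colour $A$ if it is swept out by rotating the overpassing strands counterclockwise at its corners, and of colour $B$ otherwise; $R=R_A\sqcup R_B$. Let $e(F)$ be the number of edges of a face $F$, and $cv(F,G)$, $ce(F,G)$ the numbers of common vertices and common edges of $F$ and $G$. Put $L(F)=1$ for $F\in R_B$ and $L(F)=\frac{e(F)}2-1$ for $F\in R_A$; put $Q(F,F)=0$ for $F\in R_B$, $Q(F,F)=e(F)$ for $F\in R_A$, and for $F\ne G$ put $Q(F,G)=0$ if both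 are in $R_A$, $Q(F,G)=cv(F,G)$ if both are in $R_B$, $Q(F,G)=ce(F,G)$ if they have different colours. For $s:R\to\mathbb Z$ let $L'(s)=\sum_F L(F)s(F)$, $Q'(s)=\frac12\sum_{F,G}Q(F,G)s(F)s(G)$, and for $e\in E(D)$ let $s(e)$ be the sum of the values of $s$ on the two faces adjacent to $e$. Let $F^*$ be a face of the colour opposite to that of $X$ which shares an edge with the maximal number of faces of the colour of $X$ and, among those, with the maximal number of such faces different from $X$; any such face may be chosen. With $\Lambda=\{s: s(X)=0,\ s(F^*)=0,\ s(e)\ge 0\ \forall e\in E(D)\}$ set $$\Phi_D(q)=(q)_\infty^{\,c}\sum_{s\in\Lambda}(-1)^{2L'(s)}\frac{q^{Q'(s)+L'(s)}}{\prod_{e\in E(D)}(q)_{s(e)}} .$$ For a knot $K$ with one of the diagrams $D$ below, all of which have $X\in R_A$, let $\Phi_K=\Phi_D$ and $\Phi_{-K}=\Phi_{-D}$, where $-D$ is $D$ with over and under exchanged at all crossings (so that the colours $A$ and $B$ are exchanged and $X$ is kept). **The diagrams.** $T(2,2p+1)$, $p>0$, is the left-handed torus knot with its standard diagram: $2p+1$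 crossings on a circle, consecutive ones bounding a bigon of colour $B$; the exterior and the central face have colour $A$. The twist knot $K_p$ is given by the diagram obtained from such a circular chain of $m+1$ crossings ($m=2p-1$ for $p>0$, $m=2|p|$ for $p<0$) by replacing one crossing by a clasp, that is, by two crossings on the same radius which bound a bigon of colour $A$. The knots $3_1,5_1,7_1$ are $T(2,3),T(2,5),T(2,7)$, and $4_1,5_2,6_1,7_2,8_1$ are $K_{-1},K_2,K_{-2},K_3,K_{-3}$, with these diagrams. The other knots have the following diagrams, where the arcs are numbered along the knot from $0$ and $X[i,j,k,l]$ lists the arcs at a crossing counterclockwise from the incoming underpassing arc: - $6_2$: $X[0,3,1,4],\ X[2,8,3,7],\ X[4,9,5,10],\ X[6,11,7,0],\ X[8,2,9,1],\ X[10,5,11,6]$; the exterior face is bounded by the arcs $2,5,7,9,11$. - $6_3$: $X[0,4,1,3],\ X[2,8,3,7],\ X[4,9,5,10],\ X[6,2,7,1],\ X[8,11,9,0],\ X[10,5,11,6]$; the exterior face is bounded by the arcs $1,4,6,10$. - $7_3$: $X[0,5,1,6],\ X[2,9,3,10],\ X[4,11,5,12],\ X[6,13,7,0],\ X[8,1,9,2],\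 X[10,3,11,4],\ X[12,7,13,8]$; the exterior face is bounded by the arcs $1,3,5,9,11$. - $7_4$: $X[0,6,1,5],\ X[2,10,3,9],\ X[4,12,5,11],\ X[6,0,7,13],\ X[8,4,9,3],\ X[10,2,11,1],\ X[12,8,13,7]$; the exterior face is bounded by the arcs $1,3,6,8,10,13$. - $7_5$: $X[0,7,1,8],\ X[2,11,3,12],\ X[4,13,5,0],\ X[6,9,7,10],\ X[8,1,9,2],\ X[10,5,11,6],\ X[12,3,13,4]$; the exterior face is bounded by the arcs $0,2,4,8,12$. - $7_6$: $X[0,3,1,4],\ X[2,11,3,12],\ X[4,10,5,9],\ X[6,13,7,0],\ X[8,6,9,5],\ X[10,1,11,2],\ X[12,7,13,8]$; the exterior face is bounded by the arcs $2,5,8,10,12$. - $7_7$: $X[0,3,1,4],\ X[2,10,3,9],\ X[4,7,5,8],\ X[6,12,7,11],\ X[8,13,9,0],\ X[10,2,11,1],\ X[12,6,13,5]$; the exterior face is bounded by the arcs $2,6,9,11,13$. - $8_2$: $X[0,3,1,4],\ X[2,10,3,9],\ X[4,11,5,12],\ X[6,13,7,14],\ X[8,15,9,0],\ X[10,2,11,1],\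 X[12,5,13,6],\ X[14,7,15,8]$; the exterior face is bounded by the arcs $2,5,7,9,11,13,15$. - $8_3$: $X[0,6,1,5],\ X[2,11,3,12],\ X[4,9,5,10],\ X[6,0,7,15],\ X[8,14,9,13],\ X[10,3,11,4],\ X[12,1,13,2],\ X[14,8,15,7]$; the exterior face is bounded by the arcs $1,6,8,13,15$. - $8_4$: $X[0,5,1,6],\ X[2,12,3,11],\ X[4,10,5,9],\ X[6,15,7,0],\ X[8,13,9,14],\ X[10,2,11,1],\ X[12,4,13,3],\ X[14,7,15,8]$; the exterior face is bounded by the arcs $1,5,10$. - $8_5$: $X[0,5,1,6],\ X[2,10,3,9],\ X[4,15,5,0],\ X[6,11,7,12],\ X[8,13,9,14],\ X[10,2,11,1],\ X[12,7,13,8],\ X[14,3,15,4]$; the exterior face is bounded by the arcs $0,4,6,8,12,14$. **Theorem.** For every choice of $F^*$ and every complex $q$ with $|q|<1$ the multisums converge absolutely and | $K$ | $\Phi_K(q)$ | $\Phi_{-K}(q)$ | |---|---|---| | $3_1$ | $h_3$ | $1$ | | $4_1$ | $h_3$ | $h_3$ | | $5_1$ | $h_5$ | $1$ | | $5_2$ |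 $h_4$ | $h_3$ | | $6_1$ | $h_5$ | $h_3$ | | $6_2$ | $h_3h_4$ | $h_3$ | | $6_3$ | $h_3^2$ | $h_3^2$ | | $7_1$ | $h_7$ | $1$ | | $7_2$ | $h_6$ | $h_3$ | | $7_3$ | $h_5$ | $h_4$ | | $7_4$ | $h_4^2$ | $h_3$ | | $7_5$ | $h_3h_4$ | $h_4$ | | $7_6$ | $h_3h_4$ | $h_3^2$ | | $7_7$ | $h_3^3$ | $h_3^2$ | | $8_1$ | $h_7$ | $h_3$ | | $8_2$ | $h_3h_6$ | $h_3$ | | $8_3$ | $h_5$ | $h_5$ | | $8_4$ | $h_3$ | $h_4h_5$ | | $8_5$ | (no claim) | $h_3$ | | $K_p$, $p>0$ | $h_{2p}$ | $h_3$ | | $K_p$, $p<0$ | $h_{2\lvert p\rvert+1}$ | $h_3$ | | $T(2,2p+1)$, $p>0$ | $h_{2p+1}$ | $1$ | -/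

import Mathlib

noncomputable section

/-! ### Alternating knot diagrams -/

/-- At a crossing the four arc ends are numbered `0, 1, 2, 3` counterclockwise and the corner `k`
lies between the ends `k` and `k + 1`.  Keeping a face on the right, one leaves the corner `(x, k)`
along the arc at the end `k + 1` of `x`; if the other end of that arc is the end `l` of `y`, the
next corner of the same face is `(y, l)`. -/
def CornerStep {C E : Type} (pd : C → Fin 4 → E) (d e : C × Fin 4) : Prop :=
  pd d.1 (d.2 + 1) = pd e.1 e.2 ∧ (d.1, d.2 + 1) ≠ e

/-- Two arcs are consecutive on the knot if they occupy opposite ends of a crossing. -/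
def ArcStep {C E : Type} (pd : C → Fin 4 → E) (a b : E) : Prop :=
  ∃ x k, pd x k = a ∧ pd x (k + 2) = b

/-- An alternating knot diagram in the plane, given by a planar diagram code: `pd x k` is the arc at
the `k`-th end of the crossing `x` (counterclockwise), where the ends `0, 2` belong to the
underpassing strand and the ends `1, 3` to the overpassing strand. -/
structure AlternatingKnotDiagram where
  Crossing : Type
  Arc : Type
  /-- the faces of the diagram -/
  Region : Type
  [fintypeCrossing : Fintype Crossing]
  [fintypeArc : Fintype Arc]
  [fintypeRegion : Fintype Region]
  [decEqCrossing : DecidableEq Crossing]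
  [decEqArc : DecidableEq Arc]
  [decEqRegion : DecidableEq Region]
  pd : Crossing → Fin 4 → Arc
  /-- the face containing the `k`-th corner of a crossing -/
  corner : Crossing → Fin 4 → Region
  /-- the unbounded face -/
  exterior : Region
  /-- alternation: every arc has one underpassing and one overpassing end -/
  under_end : ∀ a, ∃! e : Crossing × Fin 4, (e.2 = 0 ∨ e.2 = 2) ∧ pd e.1 e.2 = a
  over_end : ∀ a, ∃! e : Crossing × Fin 4, (e.2 = 1 ∨ e.2 = 3) ∧ pd e.1 e.2 = a
  /-- there is only one component -/
  knot : ∀ a b, Relation.EqvGen (ArcStep pd) a b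
  corner_surjective : ∀ F, ∃ x k, corner x k = F
  /-- the faces are the closed walks of `CornerStep` -/
  corner_eq_iff : ∀ d e : Crossing × Fin 4,
    corner d.1 d.2 = corner e.1 e.2 ↔ Relation.EqvGen (CornerStep pd) d e
  /-- the diagram lies in the plane (Euler's formula) -/
  planar : Fintype.card Region = Fintype.card Crossing + 2

namespace AlternatingKnotDiagram

attribute [instance] fintypeCrossing fintypeArc fintypeRegion decEqCrossing decEqArc decEqRegion

/-- The mirror image: the same plane projection with over and under exchanged at all crossings. -/
def mirror (D : AlternatingKnotDiagram) : AlternatingKnotDiagram where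
  Crossing := D.Crossing
  Arc := D.Arc
  Region := D.Region
  pd x k := D.pd x (k + 1)
  corner x k := D.corner x (k + 1)
  exterior := D.exterior
  under_end := by
    intro a
    obtain ⟨⟨x, k⟩, ⟨hk, ha⟩, hu⟩ := D.over_end a
    refine ⟨(x, k - 1), ⟨?_, by simpa using ha⟩, ?_⟩
    · revert hk; dsimp only; clear ha hu; revert k; decide
    · rintro ⟨y, l⟩ ⟨hl, hy⟩
      have := hu (y, l + 1) ⟨by revert hl; dsimp only; clear hy; revert l; decide, hy⟩
      simp only [Prod.mk.injEq] at this ⊢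
      exact ⟨this.1, by rw [← this.2]; simp⟩
  over_end := by
    intro a
    obtain ⟨⟨x, k⟩, ⟨hk, ha⟩, hu⟩ := D.under_end a
    refine ⟨(x, k - 1), ⟨?_, by simpa using ha⟩, ?_⟩
    · revert hk; dsimp only; clear ha hu; revert k; decide
    · rintro ⟨y, l⟩ ⟨hl, hy⟩
      have := hu (y, l + 1) ⟨by revert hl; dsimp only; clear hy; revert l; decide, hy⟩
      simp only [Prod.mk.injEq] at this ⊢
      exact ⟨this.1, by rw [← this.2]; simp⟩
  knot := by
    intro a b
    refine (D.knot a b).mono ?_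
    rintro a b ⟨x, k, h, h'⟩
    have e : k - 1 + 2 + 1 = k + 2 := by clear h h'; revert k; decide
    exact ⟨x, k - 1, by simpa using h, by rw [← h', ← e]⟩
  corner_surjective := by
    intro F
    obtain ⟨x, k, h⟩ := D.corner_surjective F
    exact ⟨x, k - 1, by simpa using h⟩
  corner_eq_iff := by
    have key : ∀ (pd pd' : D.Crossing → Fin 4 → D.Arc) (t : Fin 4),
        (∀ x k, pd' x k = pd x (k + t)) → ∀ d e, Relation.EqvGen (CornerStep pd') d e →
          Relation.EqvGen (CornerStep pd) (d.1, d.2 + t) (e.1, e.2 + t) := by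
      intro pd pd' t hpd d e h
      induction h with
      | rel d e h =>
        obtain ⟨h1, h2⟩ := h
        refine .rel _ _ ⟨?_, fun h3 => h2 ?_⟩
        · rw [hpd, hpd] at h1
          rw [← h1]; congr 1; exact add_right_comm _ _ _
        · simp only [Prod.mk.injEq] at h3
          refine Prod.ext h3.1 ?_
          have := h3.2
          rw [add_right_comm] at this
          exact add_right_cancel this
      | refl d => exact .refl _
      | symm d e _ ih => exact .symm _ _ ih
      | trans d e f _ _ ih ih' => exact .trans _ _ _ ih ih'
    intro d e
    rw [D.corner_eq_iff (d.1, d.2 + 1) (e.1, e.2 + 1)]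
    constructor
    · intro h
      have := key (fun x k => D.pd x (k + 1)) D.pd (-1) (by intro x k; simp) _ _ h
      simpa using this
    · exact key _ _ 1 (fun _ _ => rfl) d e
  planar := D.planar

/-! ### The multisum -/

section

variable (D : AlternatingKnotDiagram)

/-- The `A`-coloured faces are those which the overpassing strand sweeps out when it is rotated
counterclockwise; all other faces are coloured `B`.  Along an arc an `A`-face meets a `B`-face. -/
def IsA (F : D.Region) : Prop := ∃ x, D.corner x 1 = F ∨ D.corner x 3 = F

instance : DecidablePred D.IsA := fun F => by unfold IsA; infer_instance

/-- The arc `a` lies on the boundary of the face `F`. -/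
def Bounds (a : D.Arc) (F : D.Region) : Prop :=
  ∃ x k, D.pd x k = a ∧ (D.corner x k = F ∨ D.corner x (k - 1) = F)

instance (a : D.Arc) (F : D.Region) : Decidable (D.Bounds a F) := by
  unfold Bounds; infer_instance

/-- The crossing `x` is a vertex of the face `F`. -/
def Incident (x : D.Crossing) (F : D.Region) : Prop := ∃ k, D.corner x k = F

instance (x : D.Crossing) (F : D.Region) : Decidable (D.Incident x F) := by
  unfold Incident; infer_instance

/-- `e(F)`, the number of edges of a face. -/
def edgeCount (F : D.Region) : ℕ := (Finset.univ.filter fun a => D.Bounds a F).card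

/-- `cv(F, G)`, the number of common vertices. -/
def commonVertices (F G : D.Region) : ℕ :=
  (Finset.univ.filter fun x => D.Incident x F ∧ D.Incident x G).card

/-- `ce(F, G)`, the number of common edges. -/
def commonEdges (F G : D.Region) : ℕ :=
  (Finset.univ.filter fun a => D.Bounds a F ∧ D.Bounds a G).card

/-- `2 L(F)`, where `L(F) = 1` for a `B`-face and `L(F) = e(F) / 2 - 1` for an `A`-face. -/
def twoL (F : D.Region) : ℤ := if D.IsA F then (D.edgeCount F : ℤ) - 2 else 2

/-- The matrix `Q(F, G)`. -/
def Q (F G : D.Region) : ℤ :=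
  if F = G then (if D.IsA F then (D.edgeCount F : ℤ) else 0)
  else if D.IsA F ∧ D.IsA G then 0
  else if ¬ D.IsA F ∧ ¬ D.IsA G then (D.commonVertices F G : ℤ)
  else (D.commonEdges F G : ℤ)

/-- `2 L'(s)`. -/
def twoL' (s : D.Region → ℤ) : ℤ := ∑ F, D.twoL F * s F

/-- `2 Q'(s)`. -/
def twoQ' (s : D.Region → ℤ) : ℤ := ∑ F, ∑ G, D.Q F G * s F * s G

/-- `Q'(s) + L'(s)`; the division by two is exact, see `two_mul_exponent`. -/
def exponent (s : D.Region → ℤ) : ℤ := (D.twoQ' s + D.twoL' s) / 2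

/-- `s(a)`, the sum of the variables of the two faces adjacent to the arc `a`. -/
def edgeValue (s : D.Region → ℤ) (a : D.Arc) : ℤ :=
  ∑ F ∈ Finset.univ.filter (fun F => D.Bounds a F), s F

/-- The number of faces of the colour of the exterior that share an edge with `F`. -/
def neighbours (F : D.Region) : ℕ :=
  (Finset.univ.filter fun G => (D.IsA G ↔ D.IsA D.exterior) ∧ 0 < D.commonEdges F G).card

/-- The same number, not counting the exterior. -/
def innerNeighbours (F : D.Region) : ℕ :=
  (Finset.univ.filter fun G => G ≠ D.exterior ∧ (D.IsA G ↔ D.IsA D.exterior) ∧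
    0 < D.commonEdges F G).card

/-- The faces that are allowed as the choice `F*`: of the colour opposite to the exterior, with the
maximal number of neighbours and, among those, with the maximal number of inner neighbours. -/
def IsBase (F : D.Region) : Prop :=
  ¬ (D.IsA F ↔ D.IsA D.exterior) ∧
    ∀ G, ¬ (D.IsA G ↔ D.IsA D.exterior) →
      D.neighbours G < D.neighbours F ∨
        (D.neighbours G = D.neighbours F ∧ D.innerNeighbours G ≤ D.innerNeighbours F)

/-- The index set `Λ` of the multisum, for a chosen face `F*`. -/
def Lam (Fstar : D.Region) : Set (D.Region → ℤ) :=
  {s | s D.exterior = 0 ∧ s Fstar = 0 ∧ ∀ a, 0 ≤ D.edgeValue s a}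

end

end AlternatingKnotDiagram

/-- `(q)_n = (1 - q) (1 - q²) ⋯ (1 - qⁿ)`. -/
def qPoch (q : ℂ) (n : ℕ) : ℂ := ∏ k ∈ Finset.range n, (1 - q ^ (k + 1))

/-- `(q)_∞`. -/
def qPochInf (q : ℂ) : ℂ := ∏' k : ℕ, (1 - q ^ (k + 1))

/-- The sign `ε_b(n)`. -/
def epsilon (b : ℕ) (n : ℤ) : ℂ :=
  if Odd b then (-1) ^ n else if 0 ≤ n then 1 else -1

/-- `h_b(q) = ∑_{n ∈ ℤ} ε_b(n) q ^ (b n (n + 1) / 2 - n)`. -/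
def hSeries (b : ℕ) (q : ℂ) : ℂ := ∑' n : ℤ, epsilon b n * q ^ ((b : ℤ) * (n * (n + 1) / 2) - n)

namespace AlternatingKnotDiagram

section

variable (D : AlternatingKnotDiagram)

/-- The summand of the multisum. -/
def term (q : ℂ) (s : D.Region → ℤ) : ℂ :=
  (-1) ^ D.twoL' s * q ^ D.exponent s / ∏ a, qPoch q (D.edgeValue s a).toNat

/-- The `q`-multisum `Φ(q)` of the diagram, for a chosen face `F*`. -/
def Phi (Fstar : D.Region) (q : ℂ) : ℂ :=
  qPochInf q ^ Fintype.card D.Crossing * ∑' s : D.Lam Fstar, D.term q s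

/-- For every allowed choice of `F*` and every `|q| < 1` the multisum converges absolutely and
`Φ(q) = f(q)`. -/
def PhiEq (f : ℂ → ℂ) : Prop :=
  ∀ Fstar, D.IsBase Fstar → ∀ q : ℂ, ‖q‖ < 1 →
    Summable (fun s : D.Lam Fstar => D.term q s) ∧ D.Phi Fstar q = f q

theorem Q_symm (F G : D.Region) : D.Q F G = D.Q G F := by
  unfold Q commonVertices commonEdges
  by_cases hFG : F = G
  · subst hFG; rfl
  · simp only [hFG, Ne.symm hFG, if_false, and_comm]

theorem two_mul_exponent (s : D.Region → ℤ) : 2 * D.exponent s = D.twoQ' s + D.twoL' s := by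
  refine Int.mul_ediv_cancel' ?_
  have h1 : ((D.twoQ' s : ℤ) : ZMod 2) = ∑ F, ((D.Q F F * s F * s F : ℤ) : ZMod 2) := by
    unfold twoQ'
    push_cast
    rw [← Finset.sum_product', ← Finset.sum_filter_add_sum_filter_not _
      (fun p : D.Region × D.Region => p.1 = p.2)]
    have h0 : ∑ p ∈ (Finset.univ ×ˢ Finset.univ).filter
        (fun p : D.Region × D.Region => ¬ p.1 = p.2),
        ((D.Q p.1 p.2 : ZMod 2) * (s p.1 : ZMod 2) * (s p.2 : ZMod 2)) = 0 := by
      refine Finset.sum_involution (fun p _ => (p.2, p.1)) ?_ ?_ ?_ ?_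
      · rintro ⟨F, G⟩ _
        dsimp only
        rw [D.Q_symm G F, mul_right_comm]
        exact CharTwo.add_self_eq_zero _
      · rintro ⟨F, G⟩ hp _ h
        simp only [Finset.mem_filter] at hp
        exact hp.2 (Prod.mk.inj h).2
      · rintro ⟨F, G⟩ hp
        simp only [Finset.mem_filter, Finset.mem_product, Finset.mem_univ, true_and] at hp ⊢
        exact fun h => hp h.symm
      · rintro ⟨F, G⟩ _; rfl
    rw [h0, add_zero]
    refine (Finset.sum_bij (fun F _ => (F, F)) ?_ ?_ ?_ ?_).symm
    · intro F _; simp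
    · intro F _ G _ h; exact (Prod.mk.inj h).1
    · rintro ⟨F, G⟩ h
      simp only [Finset.mem_filter] at h
      exact ⟨F, Finset.mem_univ _, by rw [h.2]⟩
    · intro F _; rfl
  have h2 : (((D.twoQ' s + D.twoL' s : ℤ)) : ZMod 2) = 0 := by
    rw [Int.cast_add, h1]
    unfold twoL'
    rw [Int.cast_sum, ← Finset.sum_add_distrib]
    refine Finset.sum_eq_zero fun F _ => ?_
    rw [← Int.cast_add]
    refine (ZMod.intCast_zmod_eq_zero_iff_dvd _ 2).2 (even_iff_two_dvd.1 ?_)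
    unfold Q twoL
    by_cases hF : D.IsA F
    · simp only [hF, if_true]
      have : (D.edgeCount F : ℤ) * s F * s F + ((D.edgeCount F : ℤ) - 2) * s F
          = D.edgeCount F * (s F * (s F + 1)) - 2 * s F := by ring
      rw [this]
      exact ((Int.even_mul_succ_self _).mul_left _).sub (even_two_mul _)
    · simp [hF]
  exact_mod_cast (ZMod.intCast_zmod_eq_zero_iff_dvd _ 2).1 h2

end

/-! ### The diagrams -/

/-- The other end of the arc after a corner, by search through a finite code. -/
def nextCorner {c n : ℕ} (pd : Fin c → Fin 4 → Fin n) (d : Fin c × Fin 4) : Fin c × Fin 4 :=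
  (((List.finRange c).product (List.finRange 4)).find?
    (fun e => decide (pd d.1 (d.2 + 1) = pd e.1 e.2 ∧ (d.1, d.2 + 1) ≠ e))).getD d

/-- Decidable conditions under which a finite code with labelled faces is a knot diagram. -/
def IsPD {c n r : ℕ} [NeZero n] (pd : Fin c → Fin 4 → Fin n) (corner : Fin c → Fin 4 → Fin r) :
    Prop :=
  (∀ a, ∃ e : Fin c × Fin 4, ((e.2 = 0 ∨ e.2 = 2) ∧ pd e.1 e.2 = a) ∧
    ∀ e' : Fin c × Fin 4, ((e'.2 = 0 ∨ e'.2 = 2) ∧ pd e'.1 e'.2 = a) → e' = e) ∧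
  (∀ a, ∃ e : Fin c × Fin 4, ((e.2 = 1 ∨ e.2 = 3) ∧ pd e.1 e.2 = a) ∧
    ∀ e' : Fin c × Fin 4, ((e'.2 = 1 ∨ e'.2 = 3) ∧ pd e'.1 e'.2 = a) → e' = e) ∧
  (∀ a : Fin n, ∃ x k, pd x k = a ∧ pd x (k + 2) = a + 1) ∧
  (∀ d e : Fin c × Fin 4, pd d.1 (d.2 + 1) = pd e.1 e.2 ∧ (d.1, d.2 + 1) ≠ e →
    corner d.1 d.2 = corner e.1 e.2) ∧
  (∀ d : Fin c × Fin 4, pd d.1 (d.2 + 1) = pd (nextCorner pd d).1 (nextCorner pd d).2 ∧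
    (d.1, d.2 + 1) ≠ nextCorner pd d) ∧
  (∀ F : Fin r, ∃ d : Fin c × Fin 4, corner d.1 d.2 = F ∧
    ∀ e : Fin c × Fin 4, corner e.1 e.2 = F → ∃ m : Fin r, (nextCorner pd)^[m] d = e) ∧
  r = c + 2

instance {c n r : ℕ} [NeZero n] (pd : Fin c → Fin 4 → Fin n) (corner : Fin c → Fin 4 → Fin r) :
    Decidable (IsPD pd corner) := by
  unfold IsPD
  repeat' refine @instDecidableAnd _ _ ?_ ?_
  all_goals infer_instance

/-- The diagram of a finite code whose arcs are numbered along the knot. -/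
def ofPD {c n r : ℕ} [NeZero n] (pd : Fin c → Fin 4 → Fin n) (corner : Fin c → Fin 4 → Fin r)
    (exterior : Fin r) (hpd : IsPD pd corner) : AlternatingKnotDiagram where
  Crossing := Fin c
  Arc := Fin n
  Region := Fin r
  pd := pd
  corner := corner
  exterior := exterior
  under_end := hpd.1
  over_end := hpd.2.1
  knot := by
    have h3 := hpd.2.2.1
    have h0 : ∀ (m : ℕ) (a : Fin n), a.val = m → Relation.EqvGen (ArcStep pd) 0 a := by
      intro m
      induction m with
      | zero =>
        intro a ha
        have : a = 0 := Fin.ext (by simpa using ha)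
        rw [this]; exact .refl _
      | succ m ih =>
        intro a ha
        have hm : m < n := by have := a.isLt; omega
        have hb := ih ⟨m, hm⟩ rfl
        obtain ⟨x, k, h, h'⟩ := h3 ⟨m, hm⟩
        refine .trans _ _ _ hb (.rel _ _ ⟨x, k, h, h'.trans ?_⟩)
        have hlt : m + 1 < n := by have := a.isLt; omega
        apply Fin.ext
        rw [ha, Fin.val_add]
        simp only [Fin.val_one']
        rw [Nat.add_mod_mod]
        exact Nat.mod_eq_of_lt hlt
    intro a b
    exact .trans _ _ _ (.symm _ _ (h0 _ a rfl)) (h0 _ b rfl)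
  corner_surjective := fun F => by
    obtain ⟨d, hd, _⟩ := hpd.2.2.2.2.2.1 F
    exact ⟨d.1, d.2, hd⟩
  corner_eq_iff := by
    obtain ⟨_, _, _, h4, h5, h6, _⟩ := hpd
    intro d e
    constructor
    · intro h
      obtain ⟨b, _, hb⟩ := h6 (corner e.1 e.2)
      have reach : ∀ m, Relation.EqvGen (CornerStep pd) b ((nextCorner pd)^[m] b) := by
        intro m
        induction m with
        | zero => exact .refl _
        | succ m ih =>
          rw [Function.iterate_succ_apply']
          exact .trans _ _ _ ih (.rel _ _ (h5 _))
      obtain ⟨m, hm⟩ := hb d h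
      obtain ⟨m', hm'⟩ := hb e rfl
      have r1 := reach m
      have r2 := reach m'
      rw [hm] at r1
      rw [hm'] at r2
      exact .trans _ _ _ (.symm _ _ r1) r2
    · intro h
      induction h with
      | rel d e h => exact h4 d e h
      | refl d => rfl
      | symm d e _ ih => exact ih.symm
      | trans d e f _ _ ih ih' => exact ih.trans ih'
  planar := by simp only [Fintype.card_fin]; exact hpd.2.2.2.2.2.2

end AlternatingKnotDiagram

/-- The standard diagram of the left-handed torus knot `T(2, 2p + 1)`: the crossings lie on a circle,
consecutive crossings `x` and `x + 1` are joined by an outer arc `(x, true)` and an inner arc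
`(x, false)`, which bound the bigon `inr x`; the remaining faces are the exterior `inl true` and the
central face `inl false`. -/
def torusKnot (p : ℕ) : AlternatingKnotDiagram where
  Crossing := ZMod (2 * p + 1)
  Arc := ZMod (2 * p + 1) × Bool
  Region := Bool ⊕ ZMod (2 * p + 1)
  pd x := ![(x - 1, false), (x - 1, true), (x, true), (x, false)]
  corner x := ![.inr (x - 1), .inl true, .inr x, .inl false]
  exterior := .inl true
  under_end := by
    rintro ⟨a, _ | _⟩
    · refine ⟨(a + 1, 0), by simp, ?_⟩
      rintro ⟨x, k⟩ ⟨hk, h⟩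
      dsimp only at hk h
      rcases hk with rfl | rfl
      · simp at h; simp [← h]
      · simp at h
    · refine ⟨(a, 2), by simp, ?_⟩
      rintro ⟨x, k⟩ ⟨hk, h⟩
      dsimp only at hk h
      rcases hk with rfl | rfl
      · simp at h
      · simp at h; simp [← h]
  over_end := by
    rintro ⟨a, _ | _⟩
    · refine ⟨(a, 3), by simp, ?_⟩
      rintro ⟨x, k⟩ ⟨hk, h⟩
      dsimp only at hk h
      rcases hk with rfl | rfl
      · simp at h
      · simp at h; simp [← h]
    · refine ⟨(a + 1, 1), by simp, ?_⟩
      rintro ⟨x, k⟩ ⟨hk, h⟩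
      dsimp only at hk h
      rcases hk with rfl | rfl
      · simp at h; simp [← h]
      · simp at h
  knot := by
    set pd : ZMod (2 * p + 1) → Fin 4 → ZMod (2 * p + 1) × Bool :=
      fun x => ![(x - 1, false), (x - 1, true), (x, true), (x, false)] with hpd
    have step : ∀ x b, ArcStep pd (x, b) (x + 1, !b) := by
      rintro x (_ | _)
      · exact ⟨x + 1, 0, by simp [hpd], by simp [hpd]⟩
      · exact ⟨x + 1, 1, by simp [hpd], by simp [hpd]⟩
    have walk : ∀ (m : ℕ) x b,
        Relation.EqvGen (ArcStep pd) (x, b) (x + m, (Nat.bodd m).xor b) := by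
      intro m x b
      induction m with
      | zero => simpa using Relation.EqvGen.refl _
      | succ m ih =>
        refine .trans _ _ _ ih ?_
        have := step (x + m) ((Nat.bodd m).xor b)
        have e1 : x + (m : ZMod (2 * p + 1)) + 1 = x + ((m + 1 : ℕ) : ZMod (2 * p + 1)) := by
          push_cast; ring
        have e2 : (!((Nat.bodd m).xor b)) = (Nat.bodd (m + 1)).xor b := by
          rw [Nat.bodd_succ]; cases Nat.bodd m <;> cases b <;> rfl
        rw [e1, e2] at this
        exact .rel _ _ this
    have flip : ∀ x b, Relation.EqvGen (ArcStep pd) (x, b) (x, !b) := by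
      intro x b
      have := walk (2 * p + 1) x b
      have e : Nat.bodd (2 * p + 1) = true := by simp [Nat.bodd_succ, Nat.bodd_mul]
      rw [e, ZMod.natCast_self, add_zero] at this
      simpa using this
    have same : ∀ x b b', Relation.EqvGen (ArcStep pd) (x, b) (x, b') := by
      intro x b b'
      by_cases hb : b' = b
      · rw [hb]; exact .refl _
      · have : b' = !b := by cases b <;> cases b' <;> simp_all
        rw [this]; exact flip x b
    rintro ⟨a, b⟩ ⟨a', b'⟩
    have h1 := walk (a' - a).val a b
    rw [ZMod.natCast_zmod_val, add_sub_cancel] at h1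
    exact .trans _ _ _ h1 (same _ _ _)
  corner_surjective := by
    rintro ((_ | _) | x)
    · exact ⟨0, 3, rfl⟩
    · exact ⟨0, 1, rfl⟩
    · exact ⟨x, 2, rfl⟩
  corner_eq_iff := by
    set pd : ZMod (2 * p + 1) → Fin 4 → ZMod (2 * p + 1) × Bool :=
      fun x => ![(x - 1, false), (x - 1, true), (x, true), (x, false)] with hpd
    set corner : ZMod (2 * p + 1) → Fin 4 → Bool ⊕ ZMod (2 * p + 1) :=
      fun x => ![.inr (x - 1), .inl true, .inr x, .inl false] with hcorner
    have inv : ∀ d e, Relation.EqvGen (CornerStep pd) d e → corner d.1 d.2 = corner e.1 e.2 := by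
      intro d e h
      induction h with
      | rel d e h =>
        revert h
        obtain ⟨x, k⟩ := d
        obtain ⟨y, l⟩ := e
        rintro ⟨h1, h2⟩
        fin_cases k <;> fin_cases l <;> simp [hpd] at h1 h2 <;> simp [hcorner, h1] <;> simp_all
      | refl d => rfl
      | symm d e _ ih => exact ih.symm
      | trans d e f _ _ ih ih' => exact ih.trans ih'
    have s1 : ∀ x, CornerStep pd (x, 1) (x + 1, 1) := fun x => ⟨by simp [hpd], by simp⟩
    have s2 : ∀ x, CornerStep pd (x, 2) (x + 1, 0) := fun x => ⟨by simp [hpd], by simp⟩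
    have s3 : ∀ x, CornerStep pd (x + 1, 3) (x, 3) := fun x => ⟨by simp [hpd], by simp⟩
    have w1 : ∀ (m : ℕ) x, Relation.EqvGen (CornerStep pd) (x, 1) (x + m, 1) := by
      intro m x
      induction m with
      | zero => simpa using Relation.EqvGen.refl _
      | succ m ih =>
        have := s1 (x + m)
        rw [add_assoc, ← Nat.cast_succ] at this
        exact .trans _ _ _ ih (.rel _ _ this)
    have w3 : ∀ (m : ℕ) x, Relation.EqvGen (CornerStep pd) (x, 3) (x + m, 3) := by
      intro m x
      induction m with
      | zero => simpa using Relation.EqvGen.refl _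
      | succ m ih =>
        have := s3 (x + m)
        rw [add_assoc, ← Nat.cast_succ] at this
        exact .trans _ _ _ ih (.symm _ _ (.rel _ _ this))
    have v1 : ∀ x y, Relation.EqvGen (CornerStep pd) (x, 1) (y, 1) := by
      intro x y
      have := w1 (y - x).val x
      rwa [ZMod.natCast_zmod_val, add_sub_cancel] at this
    have v3 : ∀ x y, Relation.EqvGen (CornerStep pd) (x, 3) (y, 3) := by
      intro x y
      have := w3 (y - x).val x
      rwa [ZMod.natCast_zmod_val, add_sub_cancel] at this
    have v0 : ∀ x, Relation.EqvGen (CornerStep pd) (x - 1, 2) (x, 0) := by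
      intro x
      have := s2 (x - 1)
      rw [sub_add_cancel] at this
      exact .rel _ _ this
    rintro ⟨x, k⟩ ⟨y, l⟩
    constructor
    · intro h
      fin_cases k <;> fin_cases l <;> simp at h
      · subst h; exact .refl _
      · subst h; exact .symm _ _ (v0 x)
      · exact v1 x y
      · subst h; exact v0 y
      · subst h; exact .refl _
      · exact v3 x y
    · exact inv _ _
  planar := by simp [ZMod.card]; ring

/-- The planar diagram code of `twistDiagram`. -/
def twistPD (m : ℕ) : Fin m ⊕ Bool → Fin 4 → (Fin (m + 1) × Bool) ⊕ Bool
  | .inl x => ![.inl (x.castSucc, false), .inl (x.castSucc, true),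
      .inl (x.succ, true), .inl (x.succ, false)]
  | .inr true => ![.inr false, .inl (Fin.last m, true), .inl (0, true), .inr true]
  | .inr false => ![.inl (Fin.last m, false), .inr false, .inr true, .inl (0, false)]

/-- The faces at the corners of `twistDiagram`. -/
def twistCorner (m : ℕ) : Fin m ⊕ Bool → Fin 4 → Fin 3 ⊕ Fin (m + 1)
  | .inl x => ![.inr x.castSucc, .inl 0, .inr x.succ, .inl 1]
  | .inr true => ![.inr (Fin.last m), .inl 0, .inr 0, .inl 2]
  | .inr false => ![.inr (Fin.last m), .inl 2, .inr 0, .inl 1]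

theorem twist_last_ne {m : ℕ} (x : Fin m) : (Fin.last m = x.castSucc) = False :=
  eq_false (Fin.castSucc_lt_last x).ne'

theorem twist_zero_ne {m : ℕ} (x : Fin m) : (0 = x.succ) = False :=
  eq_false (Fin.succ_ne_zero x).symm

theorem twist_corner_of_step (m : ℕ) (d e : (Fin m ⊕ Bool) × Fin 4)
    (h : CornerStep (twistPD m) d e) : twistCorner m d.1 d.2 = twistCorner m e.1 e.2 := by
  revert h
  obtain ⟨x | _ | _, k⟩ := d <;> obtain ⟨y | _ | _, l⟩ := e <;> rintro ⟨h1, h2⟩ <;>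
    fin_cases k <;> fin_cases l <;> simp [twistPD] at h1 h2 <;> simp [twistCorner] <;>
      simp_all [twist_last_ne, twist_zero_ne]

theorem twist_step_of_corner (m : ℕ) (d e : (Fin m ⊕ Bool) × Fin 4)
    (h : twistCorner m d.1 d.2 = twistCorner m e.1 e.2) :
    Relation.EqvGen (CornerStep (twistPD m)) d e := by
  let nx : Bool → Fin (m + 1) → Fin m ⊕ Bool := fun b i =>
    Fin.lastCases (motive := fun _ => Fin m ⊕ Bool) (.inr b) (fun x => .inl x) i
  have nl : ∀ b, nx b (Fin.last m) = .inr b := fun b => Fin.lastCases_last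
  have nc : ∀ b (x : Fin m), nx b x.castSucc = .inl x := fun b x => Fin.lastCases_castSucc x
  have p1 : ∀ i, twistPD m (nx true i) 1 = .inl (i, true) := by
    intro i; induction i using Fin.lastCases <;> simp [nl, nc, twistPD]
  have p0 : ∀ i, twistPD m (nx false i) 0 = .inl (i, false) := by
    intro i; induction i using Fin.lastCases <;> simp [nl, nc, twistPD]
  have q0 : Relation.EqvGen (CornerStep (twistPD m)) (.inr false, 0) (.inr true, 0) :=
    .rel _ _ ⟨by simp [twistPD], by simp⟩
  have n0 : ∀ i, Relation.EqvGen (CornerStep (twistPD m)) (nx false i, 0) (nx true i, 0) := by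
    intro i
    induction i using Fin.lastCases with
    | last => rw [nl, nl]; exact q0
    | cast x => rw [nc, nc]; exact .refl _
  have ext : ∀ i, Relation.EqvGen (CornerStep (twistPD m)) (nx true i, 1) (.inr true, 1) := by
    intro i
    induction i using Fin.induction with
    | zero => exact .symm _ _ (.rel _ _ ⟨by rw [p1]; simp [twistPD], by simp⟩)
    | succ x ih =>
      rw [nc] at ih
      exact .trans _ _ _ (.symm _ _ (.rel _ _ ⟨by rw [p1]; simp [twistPD], by simp⟩)) ih
  have cen : ∀ i, Relation.EqvGen (CornerStep (twistPD m)) (nx false i, 3) (.inr false, 3) := by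
    intro i
    induction i using Fin.induction with
    | zero => exact .rel _ _ ⟨(p0 0).trans (by simp [twistPD]), by simp⟩
    | succ x ih =>
      rw [nc] at ih
      exact .trans _ _ _ (.rel _ _ ⟨(p0 x.succ).trans (by simp [twistPD]), by simp⟩) ih
  have two : Relation.EqvGen (CornerStep (twistPD m)) (.inr false, 2) (nx true 0, 0) :=
    .trans _ _ _ (.rel _ _ ⟨by rw [p0]; simp [twistPD], by simp⟩) (n0 0)
  let rep : Fin 3 ⊕ Fin (m + 1) → (Fin m ⊕ Bool) × Fin 4
    | .inl 0 => (.inr true, 1)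
    | .inl 1 => (.inr false, 3)
    | .inl 2 => (.inr true, 3)
    | .inr i => (nx true i, 0)
  have key : ∀ d, Relation.EqvGen (CornerStep (twistPD m)) d (rep (twistCorner m d.1 d.2)) := by
    rintro ⟨x | _ | _, k⟩ <;> fin_cases k
    · show Relation.EqvGen _ _ (nx true x.castSucc, 0)
      rw [nc]; exact .refl _
    · have := ext x.castSucc
      rwa [nc] at this
    · exact .trans _ _ _ (.rel _ _ ⟨by rw [p0]; simp [twistPD], by simp⟩) (n0 x.succ)
    · have := cen x.castSucc
      rwa [nc] at this
    · show Relation.EqvGen _ _ (nx true (Fin.last m), 0)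
      rw [nl]; exact q0
    · show Relation.EqvGen _ _ (Sum.inr true, 3)
      exact .symm _ _ (.rel _ _ ⟨by simp [twistPD], by simp⟩)
    · exact two
    · exact .refl _
    · show Relation.EqvGen _ _ (nx true (Fin.last m), 0)
      rw [nl]; exact .refl _
    · exact .refl _
    · exact .trans _ _ _ (.rel _ _ ⟨by simp [twistPD], by simp⟩) two
    · exact .refl _
  have h1 := key d
  rw [h] at h1
  exact .trans _ _ _ h1 (.symm _ _ (key e))

set_option linter.unusedSimpArgs false in
/-- A clasp of two crossings closing a chain of `m` crossings.  The diagram arises from a circular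
chain of `m + 1` crossings, as in `torusKnot`, by replacing one crossing by two crossings which lie
on the same radius: `inl 0, …, inl (m - 1)` is the chain, `inr true` and `inr false` are the outer and
the inner crossing of the clasp.  The arcs `inl (i, true)` and `inl (i, false)` are the outer and the
inner arcs between neighbouring crossings of the circle; the two arcs `inr _` join the crossings of
the clasp and bound the bigon `inl 2`.  The faces `inl 0` and `inl 1` are the exterior and the
central face, and `inr i` lies between the arcs `inl (i, true)` and `inl (i, false)`. -/
def twistDiagram (m : ℕ) : AlternatingKnotDiagram where
  Crossing := Fin m ⊕ Bool
  Arc := (Fin (m + 1) × Bool) ⊕ Bool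
  Region := Fin 3 ⊕ Fin (m + 1)
  pd := twistPD m
  corner := twistCorner m
  exterior := .inl 0
  under_end := by
    rintro (⟨i, _ | _⟩ | _ | _)
    · induction i using Fin.lastCases with
      | last =>
        refine ⟨(.inr false, 0), by simp [twistPD], ?_⟩
        rintro ⟨x | _ | _, k⟩ ⟨hk, h⟩ <;> rcases hk with hk | hk <;> simp only at hk <;>
          subst hk <;>
          simp_all [twistPD, twist_last_ne, twist_zero_ne]
      | cast x =>
        refine ⟨(.inl x, 0), by simp [twistPD], ?_⟩
        rintro ⟨x | _ | _, k⟩ ⟨hk, h⟩ <;> rcases hk with hk | hk <;> simp only at hk <;>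
          subst hk <;>
          simp_all [twistPD, twist_last_ne, twist_zero_ne]
    · induction i using Fin.cases with
      | zero =>
        refine ⟨(.inr true, 2), by simp [twistPD], ?_⟩
        rintro ⟨x | _ | _, k⟩ ⟨hk, h⟩ <;> rcases hk with hk | hk <;> simp only at hk <;>
          subst hk <;>
          simp_all [twistPD, twist_last_ne, twist_zero_ne]
      | succ x =>
        refine ⟨(.inl x, 2), by simp [twistPD], ?_⟩
        rintro ⟨x | _ | _, k⟩ ⟨hk, h⟩ <;> rcases hk with hk | hk <;> simp only at hk <;>
          subst hk <;>
          simp_all [twistPD, twist_last_ne, twist_zero_ne]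
    · refine ⟨(.inr true, 0), by simp [twistPD], ?_⟩
      rintro ⟨x | _ | _, k⟩ ⟨hk, h⟩ <;> rcases hk with hk | hk <;> simp only at hk <;>
        subst hk <;>
          simp_all [twistPD, twist_last_ne, twist_zero_ne]
    · refine ⟨(.inr false, 2), by simp [twistPD], ?_⟩
      rintro ⟨x | _ | _, k⟩ ⟨hk, h⟩ <;> rcases hk with hk | hk <;> simp only at hk <;>
        subst hk <;>
          simp_all [twistPD, twist_last_ne, twist_zero_ne]
  over_end := by
    rintro (⟨i, _ | _⟩ | _ | _)
    · induction i using Fin.cases with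
      | zero =>
        refine ⟨(.inr false, 3), by simp [twistPD], ?_⟩
        rintro ⟨x | _ | _, k⟩ ⟨hk, h⟩ <;> rcases hk with hk | hk <;> simp only at hk <;>
          subst hk <;>
          simp_all [twistPD, twist_last_ne, twist_zero_ne]
      | succ x =>
        refine ⟨(.inl x, 3), by simp [twistPD], ?_⟩
        rintro ⟨x | _ | _, k⟩ ⟨hk, h⟩ <;> rcases hk with hk | hk <;> simp only at hk <;>
          subst hk <;>
          simp_all [twistPD, twist_last_ne, twist_zero_ne]
    · induction i using Fin.lastCases with
      | last =>
        refine ⟨(.inr true, 1), by simp [twistPD], ?_⟩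
        rintro ⟨x | _ | _, k⟩ ⟨hk, h⟩ <;> rcases hk with hk | hk <;> simp only at hk <;>
          subst hk <;>
          simp_all [twistPD, twist_last_ne, twist_zero_ne]
      | cast x =>
        refine ⟨(.inl x, 1), by simp [twistPD], ?_⟩
        rintro ⟨x | _ | _, k⟩ ⟨hk, h⟩ <;> rcases hk with hk | hk <;> simp only at hk <;>
          subst hk <;>
          simp_all [twistPD, twist_last_ne, twist_zero_ne]
    · refine ⟨(.inr false, 1), by simp [twistPD], ?_⟩
      rintro ⟨x | _ | _, k⟩ ⟨hk, h⟩ <;> rcases hk with hk | hk <;> simp only at hk <;>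
        subst hk <;>
          simp_all [twistPD, twist_last_ne, twist_zero_ne]
    · refine ⟨(.inr true, 3), by simp [twistPD], ?_⟩
      rintro ⟨x | _ | _, k⟩ ⟨hk, h⟩ <;> rcases hk with hk | hk <;> simp only at hk <;>
        subst hk <;>
          simp_all [twistPD, twist_last_ne, twist_zero_ne]
  knot := by
    have h0 : ∀ i b, Relation.EqvGen (ArcStep (twistPD m)) (.inl (i, b)) (.inr false) := by
      intro i
      induction i using Fin.induction with
      | zero =>
        rintro (_ | _)
        · exact .rel _ _ ⟨.inr false, 3, rfl, rfl⟩
        · exact .rel _ _ ⟨.inr true, 2, rfl, rfl⟩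
      | succ x ih =>
        rintro (_ | _)
        · exact .trans _ _ _ (.rel _ _ ⟨.inl x, 3, rfl, rfl⟩) (ih true)
        · exact .trans _ _ _ (.rel _ _ ⟨.inl x, 2, rfl, rfl⟩) (ih false)
    have h1 : ∀ a, Relation.EqvGen (ArcStep (twistPD m)) a (.inr false) := by
      rintro (⟨i, b⟩ | _ | _)
      · exact h0 i b
      · exact .refl _
      · exact .trans _ _ _ (.rel _ _ ⟨.inr true, 3, rfl, rfl⟩) (h0 (Fin.last m) true)
    intro a b
    exact .trans _ _ _ (h1 a) (.symm _ _ (h1 b))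
  corner_surjective := by
    rintro (i | i)
    · fin_cases i
      · exact ⟨.inr true, 1, rfl⟩
      · exact ⟨.inr false, 3, rfl⟩
      · exact ⟨.inr true, 3, rfl⟩
    · induction i using Fin.lastCases with
      | last => exact ⟨.inr true, 0, rfl⟩
      | cast x => exact ⟨.inl x, 0, rfl⟩
  corner_eq_iff := by
    intro d e
    refine ⟨twist_step_of_corner m d e, fun h => ?_⟩
    induction h with
    | rel d e h => exact twist_corner_of_step m d e h
    | refl d => rfl
    | symm d e _ ih => exact ih.symm
    | trans d e f _ _ ih ih' => exact ih.trans ih'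
  planar := by simp; ring

/-- The twist knot `K_p`, `p ≠ 0`: a clasp and a twist region which has `2p - 1` crossings for
`p > 0` and `2|p|` crossings for `p < 0`. -/
def twistKnot (p : ℤ) : AlternatingKnotDiagram :=
  if 0 < p then twistDiagram (2 * p.natAbs - 1) else twistDiagram (2 * p.natAbs)

/-! The knots `3_1, 5_1, 7_1` are the torus knots `T(2, 3), T(2, 5), T(2, 7)`, and
`4_1, 5_2, 6_1, 7_2, 8_1` are twist knots.  The remaining knots are given by planar diagram codes; the
second table lists the faces at the corners, the `A`-faces first, and face `0` is the exterior. -/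

def knot_3_1 : AlternatingKnotDiagram := torusKnot 1

def knot_4_1 : AlternatingKnotDiagram := twistKnot (-1)

def knot_5_1 : AlternatingKnotDiagram := torusKnot 2

def knot_5_2 : AlternatingKnotDiagram := twistKnot 2

def knot_6_1 : AlternatingKnotDiagram := twistKnot (-2)

def knot_7_1 : AlternatingKnotDiagram := torusKnot 3

def knot_7_2 : AlternatingKnotDiagram := twistKnot 3

def knot_8_1 : AlternatingKnotDiagram := twistKnot (-3)

def knot_6_2 : AlternatingKnotDiagram :=
  AlternatingKnotDiagram.ofPD (c := 6) (n := 12) (r := 8)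
    ![![0, 3, 1, 4], ![2, 8, 3, 7], ![4, 9, 5, 10],
      ![6, 11, 7, 0], ![8, 2, 9, 1], ![10, 5, 11, 6]]
    ![![3, 1, 4, 2], ![5, 1, 3, 0], ![4, 0, 6, 2],
      ![7, 0, 3, 2], ![5, 0, 4, 1], ![6, 0, 7, 2]]
    0 (by decide +kernel)

def knot_6_3 : AlternatingKnotDiagram :=
  AlternatingKnotDiagram.ofPD (c := 6) (n := 12) (r := 8)
    ![![0, 4, 1, 3], ![2, 8, 3, 7], ![4, 9, 5, 10],
      ![6, 2, 7, 1], ![8, 11, 9, 0], ![10, 5, 11, 6]]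
    ![![4, 0, 5, 1], ![6, 1, 5, 2], ![4, 3, 7, 0],
      ![6, 2, 5, 0], ![6, 3, 4, 1], ![7, 3, 6, 0]]
    0 (by decide +kernel)

def knot_7_3 : AlternatingKnotDiagram :=
  AlternatingKnotDiagram.ofPD (c := 7) (n := 14) (r := 9)
    ![![0, 5, 1, 6], ![2, 9, 3, 10], ![4, 11, 5, 12], ![6, 13, 7, 0],
      ![8, 1, 9, 2], ![10, 3, 11, 4], ![12, 7, 13, 8]]
    ![![4, 0, 5, 1], ![6, 0, 7, 2], ![8, 0, 4, 2], ![5, 3, 4, 1],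
      ![5, 0, 6, 2], ![7, 0, 8, 2], ![4, 3, 5, 2]]
    0 (by decide +kernel)

def knot_7_4 : AlternatingKnotDiagram :=
  AlternatingKnotDiagram.ofPD (c := 7) (n := 14) (r := 9)
    ![![0, 6, 1, 5], ![2, 10, 3, 9], ![4, 12, 5, 11], ![6, 0, 7, 13],
      ![8, 4, 9, 3], ![10, 2, 11, 1], ![12, 8, 13, 7]]
    ![![3, 0, 4, 1], ![5, 0, 6, 2], ![7, 1, 4, 2], ![3, 1, 8, 0],
      ![7, 2, 6, 0], ![5, 2, 4, 0], ![7, 0, 8, 1]]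
    0 (by decide +kernel)

def knot_7_5 : AlternatingKnotDiagram :=
  AlternatingKnotDiagram.ofPD (c := 7) (n := 14) (r := 9)
    ![![0, 7, 1, 8], ![2, 11, 3, 12], ![4, 13, 5, 0], ![6, 9, 7, 10],
      ![8, 1, 9, 2], ![10, 5, 11, 6], ![12, 3, 13, 4]]
    ![![4, 1, 5, 0], ![6, 2, 7, 0], ![8, 2, 4, 0], ![6, 1, 4, 3],
      ![5, 1, 6, 0], ![4, 2, 6, 3], ![7, 2, 8, 0]]
    0 (by decide +kernel)

def knot_7_6 : AlternatingKnotDiagram :=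
  AlternatingKnotDiagram.ofPD (c := 7) (n := 14) (r := 9)
    ![![0, 3, 1, 4], ![2, 11, 3, 12], ![4, 10, 5, 9], ![6, 13, 7, 0],
      ![8, 6, 9, 5], ![10, 1, 11, 2], ![12, 7, 13, 8]]
    ![![4, 1, 5, 2], ![6, 1, 4, 0], ![5, 0, 7, 2], ![8, 3, 4, 2],
      ![8, 2, 7, 0], ![5, 1, 6, 0], ![4, 3, 8, 0]]
    0 (by decide +kernel)

def knot_7_7 : AlternatingKnotDiagram :=
  AlternatingKnotDiagram.ofPD (c := 7) (n := 14) (r := 9)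
    ![![0, 3, 1, 4], ![2, 10, 3, 9], ![4, 7, 5, 8], ![6, 12, 7, 11],
      ![8, 13, 9, 0], ![10, 2, 11, 1], ![12, 6, 13, 5]]
    ![![4, 1, 5, 2], ![6, 1, 4, 0], ![5, 3, 7, 2], ![8, 3, 5, 0],
      ![7, 0, 4, 2], ![6, 0, 5, 1], ![8, 0, 7, 3]]
    0 (by decide +kernel)

def knot_8_2 : AlternatingKnotDiagram :=
  AlternatingKnotDiagram.ofPD (c := 8) (n := 16) (r := 10)
    ![![0, 3, 1, 4], ![2, 10, 3, 9], ![4, 11, 5, 12], ![6, 13, 7, 14],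
      ![8, 15, 9, 0], ![10, 2, 11, 1], ![12, 5, 13, 6], ![14, 7, 15, 8]]
    ![![3, 1, 4, 2], ![5, 1, 3, 0], ![4, 0, 6, 2], ![7, 0, 8, 2],
      ![9, 0, 3, 2], ![5, 0, 4, 1], ![6, 0, 7, 2], ![8, 0, 9, 2]]
    0 (by decide +kernel)

def knot_8_3 : AlternatingKnotDiagram :=
  AlternatingKnotDiagram.ofPD (c := 8) (n := 16) (r := 10)
    ![![0, 6, 1, 5], ![2, 11, 3, 12], ![4, 9, 5, 10], ![6, 0, 7, 15],
      ![8, 14, 9, 13], ![10, 3, 11, 4], ![12, 1, 13, 2], ![14, 8, 15, 7]]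
    ![![5, 0, 6, 1], ![7, 2, 6, 3], ![7, 1, 6, 4], ![5, 1, 8, 0],
      ![9, 1, 7, 0], ![6, 2, 7, 4], ![6, 0, 7, 3], ![9, 0, 8, 1]]
    0 (by decide +kernel)

def knot_8_4 : AlternatingKnotDiagram :=
  AlternatingKnotDiagram.ofPD (c := 8) (n := 16) (r := 10)
    ![![0, 5, 1, 6], ![2, 12, 3, 11], ![4, 10, 5, 9], ![6, 15, 7, 0],
      ![8, 13, 9, 14], ![10, 2, 11, 1], ![12, 4, 13, 3], ![14, 7, 15, 8]]
    ![![7, 0, 8, 1], ![9, 2, 8, 3], ![9, 0, 7, 4], ![8, 5, 7, 1],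
      ![8, 4, 7, 6], ![9, 3, 8, 0], ![9, 4, 8, 2], ![7, 5, 8, 6]]
    0 (by decide +kernel)

def knot_8_5 : AlternatingKnotDiagram :=
  AlternatingKnotDiagram.ofPD (c := 8) (n := 16) (r := 10)
    ![![0, 5, 1, 6], ![2, 10, 3, 9], ![4, 15, 5, 0], ![6, 11, 7, 12],
      ![8, 13, 9, 14], ![10, 2, 11, 1], ![12, 7, 13, 8], ![14, 3, 15, 4]]
    ![![3, 1, 4, 0], ![5, 1, 6, 2], ![7, 1, 3, 0], ![4, 2, 8, 0],
      ![9, 2, 6, 0], ![5, 2, 4, 1], ![8, 2, 9, 0], ![6, 1, 7, 0]]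
    0 (by decide +kernel)

end

noncomputable section

open Filter Topology Finset

/-! ### Elementary `q`-series -/

section QSeries

variable {q : ℂ}

/-! Take the `B`-faces as vertices, the crossings as edges and the `A`-faces as faces of a plane
graph (a Tait graph of the diagram). The arcs are the corners of this graph, and the summand of the
multisum becomes a product of local contributions of corners, edges, vertices and faces
(`weight_faceSystem`). The two variables that are set to zero belong to one face `f₀` and one vertex
`v₀`: these are the exterior and `F*`, in an order that depends on the colour of the exterior.

Each graph needed here grows from a single edge `v₀ w₀` inside `f₀` by attaching cells. A bigon
doubles an edge; a polygon of rank `r` is cut off from `f₀` by a path of `r` new vertices that runs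
from a vertex `w` to `v₀`. The main point is that the sum over the variables of a cell does not
depend on the variables of the rest: it is `(q)_∞ ^ (-(r + 1)) h_{r + 2}`, where `r = 0` and `h_2 =
1` for a bigon (`Cell.exists_hasSum`). The initial edge contributes `1 / (q)_∞` by Euler's identity.
Summing the cells off one by one (`hasSum_weight_cellSystem`) therefore gives a product of series
`h_b` times `(q)_∞` to minus the number of edges. That number is `c`, so the prefactor of the
multisum cancels (`summable_and_Phi_eq`).

A polygon is evaluated in `hasSum_polygonWeight`. Let `a` be its face variable and `y` the variable
of `w`. Euler's identities and the finite `q`-binomial theorem sum the path variables and leave a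
series in `v_r(a + j) q ^ (y j) / (q)_j`, where `v_r` is `chainSeq q r` (`tsum_pathWeight`). In the
sum over `a` and `j`, the `q`-binomial theorem at `z = 1` annihilates everything with `a + j > 0`.
So `y` disappears and `v_r(0)` remains.

The value `v_r(0)` comes from a Bailey-type argument. The `v_r` are iterates of a triangular
operator with the diagonal entries `μ_N = (-1)^N q ^ (N (N + 1) / 2)`. Its left eigenvectors
`leftEigen` are known explicitly, and by a `q`-Vandermonde sum they pair with `v_r` to `μ_N ^ (r +
1)`. The unit Bailey pair (`sum_unit_pair`) expresses evaluation at `0` through these eigenvectors,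
and the resulting series over `N` is `h_{r + 2}` with its terms `n = N` and `n = -N - 1` combined.

What remains is combinatorial. For the tabulated codes, assemblies are written down and checked by
computation. The torus knots give a cycle, and their mirror images a bundle of parallel edges. The
twist knots give a cycle with one doubled edge, and their mirror images parallel edges together with
a triangle. -/

theorem qPoch_succ (q : ℂ) (n : ℕ) : qPoch q (n + 1) = qPoch q n * (1 - q ^ (n + 1)) := by
  simp [qPoch, Finset.prod_range_succ]

@[simp] theorem qPoch_zero (q : ℂ) : qPoch q 0 = 1 := by simp [qPoch]

theorem one_sub_pow_ne_zero (hq : ‖q‖ < 1) (n : ℕ) : 1 - q ^ (n + 1) ≠ 0 := by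
  intro h
  have h1 : ‖q ^ (n + 1)‖ < 1 := by
    rw [norm_pow]; exact pow_lt_one₀ (norm_nonneg _) hq (by omega)
  rw [← sub_eq_zero.1 h] at h1
  simp at h1

theorem qPoch_ne_zero (hq : ‖q‖ < 1) (n : ℕ) : qPoch q n ≠ 0 :=
  Finset.prod_ne_zero_iff.2 fun k _ => one_sub_pow_ne_zero hq k

theorem summable_norm_pow_succ (hq : ‖q‖ < 1) : Summable fun k : ℕ => ‖q ^ (k + 1)‖ := by
  simp only [norm_pow]
  exact (summable_nat_add_iff 1).2 (summable_geometric_of_lt_one (norm_nonneg _) hq)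

theorem tendsto_qPoch (hq : ‖q‖ < 1) : Tendsto (qPoch q) atTop (𝓝 (qPochInf q)) := by
  have h : Multipliable fun k : ℕ => (1 - q ^ (k + 1)) := by
    simpa [sub_eq_add_neg] using
      multipliable_one_add_of_summable (f := fun k : ℕ => -q ^ (k + 1))
        (by simpa using summable_norm_pow_succ hq)
  exact h.hasProd.tendsto_prod_nat

theorem qPochInf_ne_zero (hq : ‖q‖ < 1) : qPochInf q ≠ 0 := by
  have := tprod_one_add_ne_zero_of_summable (f := fun k : ℕ => -q ^ (k + 1))
    (by intro k; simpa [sub_eq_add_neg] using one_sub_pow_ne_zero hq k)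
    (by simpa using summable_norm_pow_succ hq)
  simpa [sub_eq_add_neg, qPochInf] using this

/-- Both `(q)_n` and its inverse converge, since the limit `(q)_∞` is nonzero. All the absolute
convergence estimates rest on this constant. -/
theorem exists_qPoch_bound (hq : ‖q‖ < 1) :
    ∃ C : ℝ, 1 ≤ C ∧ (∀ n, ‖qPoch q n‖ ≤ C) ∧ ∀ n, ‖(qPoch q n)⁻¹‖ ≤ C := by
  obtain ⟨C₁, h₁⟩ := (Metric.isBounded_range_of_tendsto _ (tendsto_qPoch hq)).exists_norm_le
  obtain ⟨C₂, h₂⟩ := (Metric.isBounded_range_of_tendsto _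
    ((tendsto_qPoch hq).inv₀ (qPochInf_ne_zero hq))).exists_norm_le
  refine ⟨max 1 (max C₁ C₂), le_max_left _ _, fun n => ?_, fun n => ?_⟩
  · exact (h₁ _ ⟨n, rfl⟩).trans ((le_max_left _ _).trans (le_max_right _ _))
  · exact (h₂ _ ⟨n, rfl⟩).trans ((le_max_right _ _).trans (le_max_right _ _))

theorem qPoch_inv_succ (hq : ‖q‖ < 1) (n : ℕ) :
    (1 - q ^ (n + 1)) * (qPoch q (n + 1))⁻¹ = (qPoch q n)⁻¹ := by
  rw [qPoch_succ, mul_inv, mul_comm, mul_assoc, inv_mul_cancel₀ (one_sub_pow_ne_zero hq n), mul_one]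

/-- `(-1)ᵐ q ^ (m (m - 1) / 2)`. -/
def qNu (q : ℂ) (m : ℕ) : ℂ := ∏ k ∈ Finset.range m, (-q ^ k)

/-- `(-1)ᵐ q ^ (m (m + 1) / 2)`. -/
def qMu (q : ℂ) (m : ℕ) : ℂ := ∏ k ∈ Finset.range m, (-q ^ (k + 1))

@[simp] theorem qNu_zero (q : ℂ) : qNu q 0 = 1 := by simp [qNu]
@[simp] theorem qMu_zero (q : ℂ) : qMu q 0 = 1 := by simp [qMu]

theorem qNu_succ (q : ℂ) (m : ℕ) : qNu q (m + 1) = qNu q m * -q ^ m := by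
  simp [qNu, Finset.prod_range_succ]

theorem qMu_succ (q : ℂ) (m : ℕ) : qMu q (m + 1) = qMu q m * -q ^ (m + 1) := by
  simp [qMu, Finset.prod_range_succ]

theorem qMu_eq (q : ℂ) (m : ℕ) : qMu q m = qNu q m * q ^ m := by
  induction m with
  | zero => simp
  | succ m ih => rw [qMu_succ, qNu_succ, ih]; ring

theorem qMu_add (q : ℂ) (m n : ℕ) : qMu q (m + n) = qMu q m * (qMu q n * q ^ (m * n)) := by
  induction n with
  | zero => simp
  | succ n ih => rw [← add_assoc, qMu_succ, ih, qMu_succ]; ring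

theorem norm_qNu_le (hq : ‖q‖ < 1) (m : ℕ) : ‖qNu q m‖ ≤ 1 := by
  rw [qNu, norm_prod]
  refine Finset.prod_le_one (fun _ _ => norm_nonneg _) fun k _ => ?_
  rw [norm_neg, norm_pow]
  exact pow_le_one₀ (norm_nonneg _) hq.le

theorem norm_qMu_le (hq : ‖q‖ < 1) (m : ℕ) : ‖qMu q m‖ ≤ ‖q‖ ^ m := by
  rw [qMu_eq, norm_mul, norm_pow]
  exact mul_le_of_le_one_left (by positivity) (norm_qNu_le hq m)

theorem norm_qMu_le_one (hq : ‖q‖ < 1) (m : ℕ) : ‖qMu q m‖ ≤ 1 :=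
  (norm_qMu_le hq m).trans (pow_le_one₀ (norm_nonneg _) hq.le)

/-- The `q`-Pascal rule in summed form: in `1 - q ^ (i + l) = (1 - q ^ l) + q ^ l (1 - q ^ i)` each
summand lowers one of the two denominators. It drives the inductions on the total degree. -/
theorem sum_antidiagonal_pascal (hq : ‖q‖ < 1) (g : ℕ → ℂ) (j : ℕ) :
    (1 - q ^ (j + 1)) * ∑ p ∈ antidiagonal (j + 1), g p.1 * (qPoch q p.1)⁻¹ * (qPoch q p.2)⁻¹ =
      ∑ p ∈ antidiagonal j,
        (g p.1 + q ^ p.2 * g (p.1 + 1)) * (qPoch q p.1)⁻¹ * (qPoch q p.2)⁻¹ := by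
  have h1 : ∀ p ∈ antidiagonal (j + 1), (1 - q ^ (j + 1)) *
      (g p.1 * (qPoch q p.1)⁻¹ * (qPoch q p.2)⁻¹) =
      g p.1 * (qPoch q p.1)⁻¹ * ((1 - q ^ p.2) * (qPoch q p.2)⁻¹) +
      q ^ p.2 * g p.1 * ((1 - q ^ p.1) * (qPoch q p.1)⁻¹) * (qPoch q p.2)⁻¹ := by
    intro p hp
    rw [← mem_antidiagonal.1 hp, pow_add]; ring
  rw [Finset.mul_sum, Finset.sum_congr rfl h1, Finset.sum_add_distrib,
    Finset.Nat.sum_antidiagonal_succ', Finset.Nat.sum_antidiagonal_succ]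
  simp only [pow_zero, sub_self, zero_mul, mul_zero, zero_add, qPoch_inv_succ hq]
  rw [← Finset.sum_add_distrib]
  exact Finset.sum_congr rfl fun p _ => by ring

/-- The finite `q`-binomial theorem. -/
theorem sum_qNu_mul_pow (hq : ‖q‖ < 1) (z : ℂ) (j : ℕ) :
    ∑ p ∈ antidiagonal j, qNu q p.1 * z ^ p.1 * (qPoch q p.1)⁻¹ * (qPoch q p.2)⁻¹ =
      (∏ l ∈ Finset.range j, (1 - z * q ^ l)) * (qPoch q j)⁻¹ := by
  induction j with
  | zero => simp
  | succ j ih =>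
    have h := sum_antidiagonal_pascal hq (fun i => qNu q i * z ^ i) j
    have h1 : ∀ p ∈ antidiagonal j, (qNu q p.1 * z ^ p.1 + q ^ p.2 * (qNu q (p.1 + 1) *
        z ^ (p.1 + 1))) * (qPoch q p.1)⁻¹ * (qPoch q p.2)⁻¹ =
        (1 - z * q ^ j) * (qNu q p.1 * z ^ p.1 * (qPoch q p.1)⁻¹ * (qPoch q p.2)⁻¹) := by
      intro p hp
      rw [← mem_antidiagonal.1 hp, qNu_succ]; ring
    rw [Finset.sum_congr rfl h1, ← Finset.mul_sum, ih] at h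
    refine mul_left_cancel₀ (one_sub_pow_ne_zero hq j) (h.trans ?_)
    rw [Finset.prod_range_succ, ← qPoch_inv_succ hq j]; ring

/-- At `z = 1` the product in the `q`-binomial theorem has a vanishing factor `l = 0`. This
orthogonality later removes the dependence of a polygon sum on its surroundings. -/
theorem sum_qNu_eq_zero (hq : ‖q‖ < 1) (j : ℕ) :
    ∑ p ∈ antidiagonal (j + 1), qNu q p.1 * (qPoch q p.1)⁻¹ * (qPoch q p.2)⁻¹ = 0 := by
  have := sum_qNu_mul_pow hq 1 (j + 1)
  rw [Finset.prod_eq_zero (Finset.mem_range.2 (Nat.succ_pos j)) (by simp), zero_mul] at this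
  simpa using this

theorem qPoch_add_eq (q : ℂ) (n j : ℕ) :
    qPoch q (n + j) = qPoch q n * ∏ l ∈ Finset.range j, (1 - q ^ (n + 1) * q ^ l) := by
  induction j with
  | zero => simp
  | succ j ih => rw [← add_assoc, qPoch_succ, ih, Finset.prod_range_succ]; ring

/-- The `q`-binomial theorem at `z = q ^ (n + 1)`, where the product is `(q)_{n + j} / (q)_n`. -/
theorem sum_qMu_mul_pow (hq : ‖q‖ < 1) (n j : ℕ) :
    qPoch q n * ∑ p ∈ antidiagonal j,
      qMu q p.1 * q ^ (n * p.1) * (qPoch q p.1)⁻¹ * (qPoch q p.2)⁻¹ =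
      qPoch q (n + j) * (qPoch q j)⁻¹ := by
  rw [qPoch_add_eq, mul_assoc, ← sum_qNu_mul_pow hq]
  congr 1
  refine Finset.sum_congr rfl fun p _ => ?_
  rw [qMu_eq]; ring

/-- A form of the `q`-Chu–Vandermonde summation. -/
theorem sum_qMu_vandermonde (hq : ‖q‖ < 1) (d M : ℕ) : ∀ A : ℕ,
    ∑ p ∈ antidiagonal M, qMu q p.1 * q ^ (p.1 * d) * qPoch q (A + p.1) *
      (qPoch q (A + d + 1 + p.1))⁻¹ * (qPoch q p.1)⁻¹ * (qPoch q p.2)⁻¹ =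
      qPoch q A * (qPoch q (A + d + 1 + M))⁻¹ * (qPoch q M)⁻¹ *
        (qPoch q (d + M) * (qPoch q d)⁻¹) := by
  induction M with
  | zero => intro A; simp [mul_inv_cancel₀ (qPoch_ne_zero hq d)]
  | succ M ih =>
    intro A
    have h := sum_antidiagonal_pascal hq (fun i => qMu q i * q ^ (i * d) * qPoch q (A + i) *
      (qPoch q (A + d + 1 + i))⁻¹) M
    -- Raising `p.1` by one turns the summand for `A` into `-q ^ (M + d + 1)` times the summand for
    -- `A + 1`, up to the factor `q ^ p.2`, which is included there. Hence the induction has to run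
    -- over all `A` at once.
    have h1 : ∀ p ∈ antidiagonal M, (qMu q p.1 * q ^ (p.1 * d) * qPoch q (A + p.1) *
        (qPoch q (A + d + 1 + p.1))⁻¹ + q ^ p.2 * (qMu q (p.1 + 1) * q ^ ((p.1 + 1) * d) *
        qPoch q (A + (p.1 + 1)) * (qPoch q (A + d + 1 + (p.1 + 1)))⁻¹)) * (qPoch q p.1)⁻¹ *
        (qPoch q p.2)⁻¹ = qMu q p.1 * q ^ (p.1 * d) * qPoch q (A + p.1) *
      (qPoch q (A + d + 1 + p.1))⁻¹ * (qPoch q p.1)⁻¹ * (qPoch q p.2)⁻¹ - q ^ (M + d + 1) *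
      (qMu q p.1 * q ^ (p.1 * d) * qPoch q (A + 1 + p.1) *
      (qPoch q (A + 1 + d + 1 + p.1))⁻¹ * (qPoch q p.1)⁻¹ * (qPoch q p.2)⁻¹) := by
      intro p hp
      rw [← mem_antidiagonal.1 hp, qMu_succ, show A + (p.1 + 1) = A + 1 + p.1 by ring,
        show A + d + 1 + (p.1 + 1) = A + 1 + d + 1 + p.1 by ring]; ring
    rw [Finset.sum_congr rfl h1, Finset.sum_sub_distrib, ← Finset.mul_sum, ih A, ih (A + 1)] at h
    refine mul_left_cancel₀ (one_sub_pow_ne_zero hq M) (h.trans ?_)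
    have e1 := qPoch_inv_succ hq M
    have e2 := qPoch_inv_succ hq (A + d + 1 + M)
    rw [show A + 1 + d + 1 + M = A + d + 1 + M + 1 by ring,
      show A + d + 1 + (M + 1) = A + d + 1 + M + 1 by ring, show d + (M + 1) = d + M + 1 by ring,
      qPoch_succ q A, qPoch_succ q (d + M), ← e1, ← e2]
    ring

end QSeries

/-! ### Infinite sums: Euler's identities, the limit of the Vandermonde sum, chain sequences. -/

section Summation

variable {q : ℂ}

theorem summable_of_norm_le_geometric (hq : ‖q‖ < 1) {f : ℕ → ℂ} (C : ℝ)
    (h : ∀ n, ‖f n‖ ≤ C * ‖q‖ ^ n) : Summable f :=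
  .of_norm_bounded ((summable_geometric_of_lt_one (norm_nonneg _) hq).mul_left C) h

theorem summable_geometric_prod (hq : ‖q‖ < 1) :
    Summable fun p : ℕ × ℕ => ‖q‖ ^ p.1 * ‖q‖ ^ p.2 :=
  (summable_geometric_of_lt_one (norm_nonneg _) hq).mul_of_nonneg
    (summable_geometric_of_lt_one (norm_nonneg _) hq) (fun _ => by positivity)
    (fun _ => by positivity)

theorem summable_prod_of_norm_le_geometric (hq : ‖q‖ < 1) {f : ℕ × ℕ → ℂ} (C : ℝ)
    (h : ∀ p, ‖f p‖ ≤ C * (‖q‖ ^ p.1 * ‖q‖ ^ p.2)) : Summable f :=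
  .of_norm_bounded ((summable_geometric_prod hq).mul_left C) h

theorem tsum_prod_eq_tsum_antidiagonal {f : ℕ × ℕ → ℂ} (hf : Summable f) :
    ∑' p, f p = ∑' n, ∑ p ∈ antidiagonal n, f p := by
  have h := (Finset.HasAntidiagonal.sigmaAntidiagonalEquivProd (A := ℕ)).tsum_eq f
  have hs := (Finset.HasAntidiagonal.sigmaAntidiagonalEquivProd (A := ℕ)).summable_iff.2 hf
  rw [← h]
  refine (hs.tsum_sigma' fun n => (hasSum_fintype _).summable).trans (tsum_congr fun n => ?_)
  rw [tsum_fintype]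
  exact Finset.sum_coe_sort (antidiagonal n) f

theorem tsum_tsum_eq_tsum_antidiagonal {f : ℕ → ℕ → ℂ}
    (hf : Summable fun p : ℕ × ℕ => f p.1 p.2) :
    ∑' i, ∑' j, f i j = ∑' n, ∑ p ∈ antidiagonal n, f p.1 p.2 := by
  rw [← tsum_prod_eq_tsum_antidiagonal hf]
  exact (hf.tsum_prod).symm

/-- The device behind both Euler identities: a functional equation makes a normalised sum
independent of `N`, and letting `N` tend to infinity evaluates it. -/
theorem eq_of_tendsto_of_eq_succ {u : ℕ → ℂ} {l : ℂ} (h : ∀ n, u n = u (n + 1))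
    (hl : Tendsto u atTop (𝓝 l)) (n : ℕ) : u n = l := by
  have h0 : ∀ m, u m = u 0 := fun m => by
    induction m with
    | zero => rfl
    | succ m ih => rw [← h, ih]
  have : Tendsto u atTop (𝓝 (u n)) := by
    rw [show u = fun _ => u n from funext fun m => by rw [h0 m, h0 n]]
    exact tendsto_const_nhds
  exact tendsto_nhds_unique this hl

theorem tendsto_tsum_pow_mul (hq : ‖q‖ < 1) {f : ℕ → ℂ} {C : ℝ} (h : ∀ n, ‖f n‖ ≤ C) (k : ℕ) :
    Tendsto (fun N : ℕ => ∑' n, q ^ ((N + k + 1) * n) * f n) atTop (𝓝 (f 0)) := by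
  have hC : 0 ≤ C := (norm_nonneg _).trans (h 0)
  have hlim : ∑' n : ℕ, (if n = 0 then f 0 else 0) = f 0 := tsum_ite_eq 0 _
  rw [← hlim]
  refine tendsto_tsum_of_dominated_convergence (bound := fun n => ‖q‖ ^ n * C)
    ((summable_geometric_of_lt_one (norm_nonneg _) hq).mul_right C) (fun n => ?_)
    (Eventually.of_forall fun N n => ?_)
  · rcases Nat.eq_zero_or_pos n with rfl | hn
    · simp
    · rw [if_neg hn.ne', ← zero_mul (f n)]
      refine Tendsto.mul_const _ ?_
      have h1 : ‖q ^ n‖ < 1 := by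
        rw [norm_pow]; exact pow_lt_one₀ (norm_nonneg _) hq hn.ne'
      have h2 := (tendsto_pow_atTop_nhds_zero_of_norm_lt_one h1).comp (tendsto_add_atTop_nat (k + 1))
      refine h2.congr fun N => ?_
      simp only [Function.comp]
      rw [← pow_mul]; congr 1; ring
  · rw [norm_mul, norm_pow]
    refine mul_le_mul (pow_le_pow_of_le_one (norm_nonneg _) hq.le ?_) (h n) (norm_nonneg _)
      (by positivity)
    nlinarith [Nat.zero_le (N * n), Nat.zero_le (k * n)]

theorem summable_euler (hq : ‖q‖ < 1) (N : ℕ) :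
    Summable fun b : ℕ => q ^ ((N + 1) * b) * (qPoch q b)⁻¹ := by
  obtain ⟨C, hC, -, h⟩ := exists_qPoch_bound hq
  refine summable_of_norm_le_geometric hq C fun n => ?_
  rw [norm_mul, norm_pow, mul_comm]
  refine mul_le_mul (h n) (pow_le_pow_of_le_one (norm_nonneg _) hq.le ?_) (by positivity)
    (by positivity)
  nlinarith [Nat.zero_le (N * n)]

/-- Euler's first identity at `z = q ^ (N + 1)`. -/
theorem tsum_euler (hq : ‖q‖ < 1) (N : ℕ) :
    ∑' b : ℕ, q ^ ((N + 1) * b) * (qPoch q b)⁻¹ = qPoch q N * (qPochInf q)⁻¹ := by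
  obtain ⟨C, hC, -, h⟩ := exists_qPoch_bound hq
  set e : ℕ → ℂ := fun N => ∑' b : ℕ, q ^ ((N + 1) * b) * (qPoch q b)⁻¹ with he
  -- The difference of the sums at `N` and `N + 1` contains the factor `1 - q ^ b`, which lowers
  -- `(q)_b`; shifting `b` then gives back the sum at `N`.
  have hrec : ∀ N, e (N + 1) = (1 - q ^ (N + 1)) * e N := by
    intro N
    have h1 : e N - e (N + 1) = q ^ (N + 1) * e N := by
      rw [he]; dsimp only
      rw [← (summable_euler hq N).tsum_sub (summable_euler hq (N + 1)), ← tsum_mul_left,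
        Summable.tsum_eq_zero_add ((summable_euler hq N).sub (summable_euler hq (N + 1)))]
      simp only [mul_zero, pow_zero, sub_self, zero_add]
      refine tsum_congr fun b => ?_
      rw [← qPoch_inv_succ hq b]; ring
    linear_combination -h1
  have hinv : ∀ n, e n * (qPoch q n)⁻¹ = e (n + 1) * (qPoch q (n + 1))⁻¹ := by
    intro n
    rw [hrec, ← qPoch_inv_succ hq n]; ring
  have hl : Tendsto (fun n => e n * (qPoch q n)⁻¹) atTop (𝓝 (1 * (qPochInf q)⁻¹)) := by
    refine Tendsto.mul ?_ ((tendsto_qPoch hq).inv₀ (qPochInf_ne_zero hq))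
    simpa using tendsto_tsum_pow_mul hq h 0
  have := eq_of_tendsto_of_eq_succ hinv hl N
  rw [one_mul] at this
  change e N = _
  rw [← this, mul_comm (e N), mul_inv_cancel_left₀ (qPoch_ne_zero hq N)]

theorem norm_pow_le_one (hq : ‖q‖ < 1) (n : ℕ) : ‖q ^ n‖ ≤ 1 := by
  rw [norm_pow]; exact pow_le_one₀ (norm_nonneg _) hq.le

theorem summable_euler' (hq : ‖q‖ < 1) (N : ℕ) :
    Summable fun b : ℕ => qMu q b * q ^ (N * b) * (qPoch q b)⁻¹ := by
  obtain ⟨C, hC, -, h⟩ := exists_qPoch_bound hq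
  refine summable_of_norm_le_geometric hq C fun n => ?_
  rw [norm_mul, norm_mul, mul_comm]
  refine mul_le_mul (h n) ?_ (by positivity) (by positivity)
  exact (mul_le_of_le_one_right (norm_nonneg _) (norm_pow_le_one hq _)).trans (norm_qMu_le hq n)

/-- Euler's second identity at `z = q ^ (N + 1)`. -/
theorem tsum_euler' (hq : ‖q‖ < 1) (N : ℕ) :
    qPoch q N * ∑' j : ℕ, qMu q j * q ^ (N * j) * (qPoch q j)⁻¹ = qPochInf q := by
  obtain ⟨C, hC, -, h⟩ := exists_qPoch_bound hq
  set e : ℕ → ℂ := fun N => ∑' j : ℕ, qMu q j * q ^ (N * j) * (qPoch q j)⁻¹ with he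
  have hrec : ∀ N, e N = (1 - q ^ (N + 1)) * e (N + 1) := by
    intro N
    have h1 : e N - e (N + 1) = -q ^ (N + 1) * e (N + 1) := by
      rw [he]; dsimp only
      rw [← (summable_euler' hq N).tsum_sub (summable_euler' hq (N + 1)), ← tsum_mul_left,
        Summable.tsum_eq_zero_add ((summable_euler' hq N).sub (summable_euler' hq (N + 1)))]
      simp only [mul_zero, pow_zero, sub_self, zero_add]
      refine tsum_congr fun b => ?_
      rw [← qPoch_inv_succ hq b, qMu_succ]; ring
    linear_combination h1
  have hinv : ∀ n, qPoch q n * e n = qPoch q (n + 1) * e (n + 1) := by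
    intro n
    rw [hrec, qPoch_succ]; ring
  have hl : Tendsto (fun n => qPoch q n * e n) atTop (𝓝 (qPochInf q * 1)) := by
    refine Tendsto.mul (tendsto_qPoch hq) ?_
    have h2 : ∀ n, ‖qNu q n * (qPoch q n)⁻¹‖ ≤ C := fun n => by
      rw [norm_mul]
      exact (mul_le_of_le_one_left (norm_nonneg _) (norm_qNu_le hq n)).trans (h n)
    have := tendsto_tsum_pow_mul hq h2 0
    simp only [qNu_zero, qPoch_zero, inv_one, mul_one] at this
    refine this.congr fun N => tsum_congr fun n => ?_
    rw [qMu_eq]; ring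
  have := eq_of_tendsto_of_eq_succ hinv hl N
  rwa [mul_one] at this

/-- The limit `M → ∞` of the finite sum multiplied by `(q)_M`. The finite sums are extended by zero
to all `p`, so that dominated convergence applies. -/
theorem tsum_qMu_vandermonde (hq : ‖q‖ < 1) (A d : ℕ) :
    ∑' p : ℕ, qMu q p * q ^ (p * d) * qPoch q (A + p) * (qPoch q (A + d + 1 + p))⁻¹ *
      (qPoch q p)⁻¹ = qPoch q A * (qPoch q d)⁻¹ := by
  obtain ⟨C, hC, h', h⟩ := exists_qPoch_bound hq
  have hC0 : 0 ≤ C := zero_le_one.trans hC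
  set g : ℕ → ℂ := fun p => qMu q p * q ^ (p * d) * qPoch q (A + p) *
    (qPoch q (A + d + 1 + p))⁻¹ * (qPoch q p)⁻¹ with hg
  have hgb : ∀ p, ‖g p‖ ≤ ‖q‖ ^ p * 1 * C * C * C := by
    intro p
    simp only [hg, norm_mul]
    gcongr
    · exact norm_qMu_le hq p
    · exact norm_pow_le_one hq _
    · exact h' _
    · exact h _
    · exact h _
  have hshift : ∀ k : ℕ, Tendsto (fun M => qPoch q (k + M)) atTop (𝓝 (qPochInf q)) := fun k => by
    have := (tendsto_qPoch hq).comp (tendsto_add_atTop_nat k)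
    exact this.congr fun M => by simp [add_comm]
  have key : ∀ M, ∑' p, (if p ≤ M then g p * (qPoch q M * (qPoch q (M - p))⁻¹) else 0) =
      qPoch q A * (qPoch q (A + d + 1 + M))⁻¹ * (qPoch q (d + M) * (qPoch q d)⁻¹) := by
    intro M
    have h1 := sum_qMu_vandermonde hq d M A
    rw [Finset.Nat.sum_antidiagonal_eq_sum_range_succ_mk] at h1
    rw [tsum_eq_sum (s := Finset.range (M + 1))]
    · have h2 := congrArg (fun z => qPoch q M * z) h1
      dsimp only at h2
      rw [Finset.mul_sum] at h2
      have h3 : qPoch q M * (qPoch q A * (qPoch q (A + d + 1 + M))⁻¹ * (qPoch q M)⁻¹ *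
        (qPoch q (d + M) * (qPoch q d)⁻¹)) = qPoch q A * (qPoch q (A + d + 1 + M))⁻¹ *
        (qPoch q (d + M) * (qPoch q d)⁻¹) * (qPoch q M * (qPoch q M)⁻¹) := by ring
      rw [h3, mul_inv_cancel₀ (qPoch_ne_zero hq M), mul_one] at h2
      rw [← h2]
      refine Finset.sum_congr rfl fun p hp => ?_
      rw [if_pos (Nat.lt_succ_iff.1 (Finset.mem_range.1 hp))]
      simp only [hg]; ring
    · intro p hp
      rw [if_neg]
      simpa [Nat.lt_succ_iff] using hp
  have lim1 : Tendsto (fun M => ∑' p, (if p ≤ M then g p * (qPoch q M * (qPoch q (M - p))⁻¹) else 0))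
      atTop (𝓝 (∑' p, g p)) := by
    refine tendsto_tsum_of_dominated_convergence
      (bound := fun p => ‖q‖ ^ p * (1 * C * C * C * (C * C)))
      ((summable_geometric_of_lt_one (norm_nonneg _) hq).mul_right _) (fun p => ?_)
      (Eventually.of_forall fun M p => ?_)
    · have h1 : Tendsto (fun M => g p * (qPoch q M * (qPoch q (M - p))⁻¹)) atTop
          (𝓝 (g p * (qPochInf q * (qPochInf q)⁻¹))) :=
        ((tendsto_qPoch hq).mul (((tendsto_qPoch hq).comp (tendsto_sub_atTop_nat p)).inv₀
          (qPochInf_ne_zero hq))).const_mul _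
      rw [mul_inv_cancel₀ (qPochInf_ne_zero hq), mul_one] at h1
      refine h1.congr' ?_
      filter_upwards [eventually_ge_atTop p] with M hM
      rw [if_pos hM]
    · split_ifs
      · rw [norm_mul (g p), norm_mul (qPoch q M)]
        calc ‖g p‖ * (‖qPoch q M‖ * ‖(qPoch q (M - p))⁻¹‖)
            ≤ (‖q‖ ^ p * 1 * C * C * C) * (C * C) := by
              gcongr
              · exact hgb p
              · exact h' _
              · exact h _
          _ = _ := by ring
      · rw [norm_zero]; positivity
  simp only [key] at lim1
  have lim2 : Tendsto (fun M => qPoch q A * (qPoch q (A + d + 1 + M))⁻¹ *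
      (qPoch q (d + M) * (qPoch q d)⁻¹)) atTop
      (𝓝 (qPoch q A * (qPochInf q)⁻¹ * (qPochInf q * (qPoch q d)⁻¹))) :=
    (((hshift _).inv₀ (qPochInf_ne_zero hq)).const_mul _).mul ((hshift d).mul_const _)
  rw [tendsto_nhds_unique lim1 lim2, mul_assoc, inv_mul_cancel_left₀ (qPochInf_ne_zero hq)]

/-! ### The chain sequences -/

/-- The sequences obtained from `qMu` by iterating `v ↦ qMu m * ∑ᵢ v (m + i) / (q)ᵢ`. -/
def chainSeq (q : ℂ) : ℕ → ℕ → ℂ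
  | 0, m => qMu q m
  | r + 1, m => qMu q m * ∑' i, chainSeq q r (m + i) * (qPoch q i)⁻¹

theorem exists_chainSeq_bound (hq : ‖q‖ < 1) (r : ℕ) :
    ∃ C : ℝ, 0 ≤ C ∧ ∀ m, ‖chainSeq q r m‖ ≤ C * ‖q‖ ^ m := by
  obtain ⟨K, hK, -, h⟩ := exists_qPoch_bound hq
  induction r with
  | zero => exact ⟨1, zero_le_one, fun m => by simpa [chainSeq] using norm_qMu_le hq m⟩
  | succ r ih =>
    obtain ⟨C, hC, hb⟩ := ih
    have hg := summable_geometric_of_lt_one (norm_nonneg q) hq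
    have hbd : ∀ m, ‖∑' i, chainSeq q r (m + i) * (qPoch q i)⁻¹‖ ≤
        C * K * ∑' i : ℕ, ‖q‖ ^ i := by
      intro m
      refine tsum_of_norm_bounded (hg.hasSum.mul_left (C * K)) fun i => ?_
      rw [norm_mul]
      calc ‖chainSeq q r (m + i)‖ * ‖(qPoch q i)⁻¹‖ ≤ (C * ‖q‖ ^ (m + i)) * K := by
            gcongr
            · exact hb _
            · exact h _
        _ ≤ (C * ‖q‖ ^ i) * K := by
            gcongr ?_ * _
            refine mul_le_mul_of_nonneg_left ?_ hC
            exact pow_le_pow_of_le_one (norm_nonneg _) hq.le (Nat.le_add_left _ _)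
        _ = _ := by ring
    refine ⟨C * K * ∑' i : ℕ, ‖q‖ ^ i, by positivity, fun m => ?_⟩
    rw [chainSeq, norm_mul, mul_comm]
    exact mul_le_mul (hbd m) (norm_qMu_le hq m) (norm_nonneg _) (by positivity)

/-- The left eigenvector `l_N` of the iteration, at the index `N + p`. -/
def leftEigen (q : ℂ) (N p : ℕ) : ℂ :=
  qPoch q (N + p) * (qPoch q (2 * N + 1 + p))⁻¹ * (qPoch q p)⁻¹

theorem exists_leftEigen_bound (hq : ‖q‖ < 1) : ∃ C : ℝ, 0 ≤ C ∧ ∀ N p, ‖leftEigen q N p‖ ≤ C := by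
  obtain ⟨K, hK, h', h⟩ := exists_qPoch_bound hq
  have hK0 : 0 ≤ K := zero_le_one.trans hK
  refine ⟨K * K * K, by positivity, fun N p => ?_⟩
  rw [leftEigen, norm_mul, norm_mul]
  gcongr
  · exact h' _
  · exact h _
  · exact h _

/-- The equation of a left eigenvector, with eigenvalue `qMu q N`, for the triangular matrix that
has the entry `qMu q m / (q)_i` at `(m, m + i)`. It is the Vandermonde sum at `A = d = N`. -/
theorem sum_leftEigen (hq : ‖q‖ < 1) (N M : ℕ) :
    ∑ p ∈ antidiagonal M, leftEigen q N p.1 * qMu q (N + p.1) * (qPoch q p.2)⁻¹ =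
      qMu q N * leftEigen q N M := by
  have h := sum_qMu_vandermonde hq N M N
  have e : qPoch q N * (qPoch q (N + N + 1 + M))⁻¹ * (qPoch q M)⁻¹ *
      (qPoch q (N + M) * (qPoch q N)⁻¹) = leftEigen q N M * (qPoch q N * (qPoch q N)⁻¹) := by
    rw [leftEigen, show 2 * N = N + N by ring]; ring
  rw [e, mul_inv_cancel₀ (qPoch_ne_zero hq N), mul_one] at h
  rw [← h, Finset.mul_sum]
  refine Finset.sum_congr rfl fun p _ => ?_
  rw [leftEigen, qMu_add, show 2 * N = N + N by ring]; ring

/-- Each step of the iteration can be moved onto the eigenvector, where it multiplies by the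
eigenvalue. The initial pairing, with `qMu` itself, is the infinite Vandermonde sum at `A = d = N`.
-/
theorem tsum_leftEigen_chainSeq (hq : ‖q‖ < 1) (r N : ℕ) :
    ∑' p, leftEigen q N p * chainSeq q r (N + p) = qMu q N ^ (r + 1) := by
  induction r with
  | zero =>
    have h := tsum_qMu_vandermonde hq N N
    rw [mul_inv_cancel₀ (qPoch_ne_zero hq N)] at h
    rw [zero_add, pow_one, ← mul_one (qMu q N), ← h, ← tsum_mul_left]
    refine tsum_congr fun p => ?_
    rw [leftEigen, chainSeq, qMu_add, show 2 * N = N + N by ring]; ring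
  | succ r ih =>
    obtain ⟨C, hC, hb⟩ := exists_chainSeq_bound hq r
    obtain ⟨K, hK, -, h⟩ := exists_qPoch_bound hq
    obtain ⟨E, hE, hl⟩ := exists_leftEigen_bound hq
    have hK0 : 0 ≤ K := zero_le_one.trans hK
    have hs : Summable fun x : ℕ × ℕ => leftEigen q N x.1 * qMu q (N + x.1) * (qPoch q x.2)⁻¹ *
        chainSeq q r (N + (x.1 + x.2)) := by
      refine summable_prod_of_norm_le_geometric hq (E * 1 * K * C) fun x => ?_
      rw [norm_mul, norm_mul, norm_mul]
      calc _ ≤ E * 1 * K * (C * ‖q‖ ^ (N + (x.1 + x.2))) := by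
            gcongr
            · exact hl _ _
            · exact norm_qMu_le_one hq _
            · exact h _
            · exact hb _
        _ ≤ E * 1 * K * (C * ‖q‖ ^ (x.1 + x.2)) := by
            refine mul_le_mul_of_nonneg_left (mul_le_mul_of_nonneg_left ?_ hC) (by positivity)
            exact pow_le_pow_of_le_one (norm_nonneg _) hq.le (Nat.le_add_left _ _)
        _ = _ := by rw [pow_add]; ring
    have h1 : ∀ p, leftEigen q N p * chainSeq q (r + 1) (N + p) =
        ∑' i, leftEigen q N p * qMu q (N + p) * (qPoch q i)⁻¹ * chainSeq q r (N + (p + i)) := by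
      intro p
      rw [chainSeq, ← mul_assoc, ← tsum_mul_left]
      refine tsum_congr fun i => ?_
      rw [add_assoc]; ring
    rw [tsum_congr h1, tsum_tsum_eq_tsum_antidiagonal (f := fun p i => leftEigen q N p *
      qMu q (N + p) * (qPoch q i)⁻¹ * chainSeq q r (N + (p + i))) hs, pow_succ', ← ih,
      ← tsum_mul_left]
    refine tsum_congr fun n => ?_
    rw [← mul_assoc, ← sum_leftEigen hq, Finset.sum_mul]
    refine Finset.sum_congr rfl fun p hp => ?_
    rw [mem_antidiagonal.1 hp]

end Summation

/-! ### The unit Bailey pair, the series `h_b` and the sums over a polygon. -/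

section Polygon

variable {q : ℂ}

theorem qNu_succ_eq_neg_qMu (q : ℂ) (n : ℕ) : qNu q (n + 1) = -qMu q n := by
  rw [qNu, Finset.prod_range_succ', qMu]; simp

/-- With `m = n + 1 + t`, the partial sums over `N ≤ n` have a product form after multiplication by
`1 - q ^ m`. Keeping `m` fixed while `n` grows means that `t` decreases, so `t` is generalised. -/
theorem sum_range_unit_pair (hq : ‖q‖ < 1) (n : ℕ) : ∀ t : ℕ,
    (1 - q ^ (n + 1 + t)) * ∑ N ∈ Finset.range (n + 1), qNu q N * (1 - q ^ (2 * N + 1)) *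
      ((qPoch q (n + 1 + t - N))⁻¹ * (qPoch q (n + 1 + t + N + 1))⁻¹) =
      qMu q n * (1 - q ^ (n + 1)) * ((qPoch q t)⁻¹ * (qPoch q (n + 1 + t + n + 1))⁻¹) := by
  induction n with
  | zero =>
    intro t
    have h := qPoch_inv_succ hq t
    simp only [zero_add, Finset.range_one, Finset.sum_singleton, qNu_zero, qMu_zero, mul_zero,
      add_zero, Nat.sub_zero]
    rw [add_comm 1 t, ← h]; ring
  | succ n ih =>
    intro t
    have h := ih (t + 1)
    rw [Finset.sum_range_succ, mul_add, show n + 1 + 1 + t = n + 1 + (t + 1) by ring, h,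
      show n + 1 + (t + 1) - (n + 1) = t + 1 by omega, ← qPoch_inv_succ hq t,
      show n + 1 + (t + 1) + (n + 1) + 1 = n + 1 + (t + 1) + n + 1 + 1 by ring,
      ← qPoch_inv_succ hq (n + 1 + (t + 1) + n + 1), qNu_succ_eq_neg_qMu, qMu_succ]
    ring

/-- The unit Bailey pair. -/
theorem sum_unit_pair (hq : ‖q‖ < 1) (m : ℕ) :
    ∑ p ∈ antidiagonal m, qNu q p.1 * (1 - q ^ (2 * p.1 + 1)) * leftEigen q p.1 p.2 =
      if m = 0 then 1 else 0 := by
  rcases Nat.eq_zero_or_pos m with rfl | hm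
  · have h := qPoch_inv_succ hq 0
    simpa [leftEigen] using h
  · obtain ⟨n, rfl⟩ := Nat.exists_eq_succ_of_ne_zero hm.ne'
    rw [if_neg hm.ne', Nat.succ_eq_add_one, Finset.Nat.sum_antidiagonal_eq_sum_range_succ_mk]
    have h1 : ∀ N ∈ Finset.range (n + 1 + 1), qNu q N * (1 - q ^ (2 * N + 1)) *
        leftEigen q N (n + 1 - N) = qPoch q (n + 1) * (qNu q N * (1 - q ^ (2 * N + 1)) *
      ((qPoch q (n + 1 + 0 - N))⁻¹ * (qPoch q (n + 1 + 0 + N + 1))⁻¹)) := by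
      intro N hN
      have hN' := Nat.lt_succ_iff.1 (Finset.mem_range.1 hN)
      rw [leftEigen, show N + (n + 1 - N) = n + 1 by omega,
        show 2 * N + 1 + (n + 1 - N) = n + 1 + 0 + N + 1 by omega, add_zero]
      ring
    rw [Finset.sum_congr rfl h1, ← Finset.mul_sum]
    -- The terms `N ≤ n` are summed in closed form at `t = 0`; after multiplication by `1 - q ^ (n +
    -- 1)` this cancels the remaining term `N = n + 1`.
    refine mul_eq_zero_of_right _ (mul_left_cancel₀ (one_sub_pow_ne_zero hq n) ?_)
    have h2 := sum_range_unit_pair hq n 0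
    rw [Finset.sum_range_succ, mul_add, h2, mul_zero, qNu_succ_eq_neg_qMu, add_zero, Nat.sub_self,
      show n + 1 + (n + 1) + 1 = n + 1 + n + 1 + 1 by ring,
      ← qPoch_inv_succ hq (n + 1 + n + 1)]
    ring

theorem summable_qNu_mul (hq : ‖q‖ < 1) (r : ℕ) : Summable fun N => qNu q N * qMu q N ^ (r + 1) := by
  refine summable_of_norm_le_geometric hq 1 fun N => ?_
  rw [norm_mul, norm_pow, pow_succ]
  refine mul_le_mul (norm_qNu_le hq N) ?_ (by positivity) zero_le_one
  exact (mul_le_of_le_one_left (norm_nonneg _) (pow_le_one₀ (norm_nonneg _)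
    (norm_qMu_le_one hq N))).trans (norm_qMu_le hq N)

/-- The unit pair writes evaluation at `0` as a combination of the functionals `leftEigen q N`,
whose values on the chain sequence are powers of the eigenvalues. The bounds make the double sum
absolutely convergent, so it can be regrouped along antidiagonals. -/
theorem chainSeq_zero_eq_tsum (hq : ‖q‖ < 1) (r : ℕ) :
    chainSeq q r 0 = ∑' N, qNu q N * (1 - q ^ (2 * N + 1)) * qMu q N ^ (r + 1) := by
  obtain ⟨C, hC, hb⟩ := exists_chainSeq_bound hq r
  obtain ⟨E, hE, hl⟩ := exists_leftEigen_bound hq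
  have hs : Summable fun x : ℕ × ℕ => qNu q x.1 * (1 - q ^ (2 * x.1 + 1)) *
      (leftEigen q x.1 x.2 * chainSeq q r (x.1 + x.2)) := by
    refine summable_prod_of_norm_le_geometric hq (1 * 2 * (E * C)) fun x => ?_
    rw [norm_mul, norm_mul, norm_mul]
    calc _ ≤ 1 * 2 * (E * (C * ‖q‖ ^ (x.1 + x.2))) := by
          gcongr
          · exact norm_qNu_le hq _
          · refine (norm_sub_le _ _).trans ?_
            rw [norm_one]
            linarith [norm_pow_le_one hq (2 * x.1 + 1)]
          · exact hl _ _
          · exact hb _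
      _ = _ := by rw [pow_add]; ring
  have h1 : ∀ N, qNu q N * (1 - q ^ (2 * N + 1)) * qMu q N ^ (r + 1) =
      ∑' p, qNu q N * (1 - q ^ (2 * N + 1)) * (leftEigen q N p * chainSeq q r (N + p)) := by
    intro N
    rw [tsum_mul_left, tsum_leftEigen_chainSeq hq]
  rw [tsum_congr h1, tsum_tsum_eq_tsum_antidiagonal (f := fun N p => qNu q N *
    (1 - q ^ (2 * N + 1)) * (leftEigen q N p * chainSeq q r (N + p))) hs]
  have h2 : ∀ m, ∑ p ∈ antidiagonal m, qNu q p.1 * (1 - q ^ (2 * p.1 + 1)) *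
      (leftEigen q p.1 p.2 * chainSeq q r (p.1 + p.2)) =
      if m = 0 then chainSeq q r 0 else 0 := by
    intro m
    have h3 : ∀ p ∈ antidiagonal m, qNu q p.1 * (1 - q ^ (2 * p.1 + 1)) *
      (leftEigen q p.1 p.2 * chainSeq q r (p.1 + p.2)) = qNu q p.1 * (1 - q ^ (2 * p.1 + 1)) *
      leftEigen q p.1 p.2 * chainSeq q r m := by
      intro p hp
      rw [mem_antidiagonal.1 hp]; ring
    rw [Finset.sum_congr rfl h3, ← Finset.sum_mul, sum_unit_pair hq]
    split_ifs with h
    · rw [h, one_mul]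
    · rw [zero_mul]
  rw [tsum_congr h2, tsum_ite_eq 0 fun _ => chainSeq q r 0]

theorem qMu_eq_pow (q : ℂ) (m : ℕ) : qMu q m = (-1) ^ m * q ^ (m * (m + 1) / 2) := by
  induction m with
  | zero => simp
  | succ m ih =>
    rw [qMu_succ, ih, show (m + 1) * (m + 1 + 1) / 2 = m * (m + 1) / 2 + (m + 1) by
      rw [show (m + 1) * (m + 1 + 1) = m * (m + 1) + (m + 1) * 2 by ring,
        Nat.add_mul_div_right _ _ two_pos]]
    ring

theorem qNu_eq_pow (q : ℂ) (m : ℕ) : qNu q m = (-1) ^ m * q ^ (m * (m + 1) / 2 - m) := by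
  cases m with
  | zero => simp
  | succ m =>
    rw [qNu_succ_eq_neg_qMu, qMu_eq_pow, show (m + 1) * (m + 1 + 1) / 2 = m * (m + 1) / 2 + (m + 1) by
      rw [show (m + 1) * (m + 1 + 1) = m * (m + 1) + (m + 1) * 2 by ring,
        Nat.add_mul_div_right _ _ two_pos], Nat.add_sub_cancel]
    ring

theorem epsilon_natCast (b n : ℕ) : epsilon b n = ((-1) ^ n) ^ b := by
  unfold epsilon
  split_ifs with h h'
  · rw [zpow_natCast, ← pow_mul, mul_comm, pow_mul, h.neg_one_pow]
  · rw [← pow_mul, (Nat.not_odd_iff_even.1 h).mul_left n |>.neg_one_pow]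
  · omega

theorem epsilon_neg (b n : ℕ) : epsilon b (-((n : ℤ) + 1)) = -((-1) ^ n) ^ b := by
  unfold epsilon
  split_ifs with h h'
  · rw [← pow_mul, mul_comm, pow_mul, h.neg_one_pow, zpow_neg,
      show (n : ℤ) + 1 = ((n + 1 : ℕ) : ℤ) by push_cast; rfl, zpow_natCast, pow_succ, mul_inv]
    rw [← inv_pow]; norm_num
  · omega
  · rw [← pow_mul, (Nat.not_odd_iff_even.1 h).mul_left n |>.neg_one_pow]

theorem le_triangle (n : ℕ) : n ≤ n * (n + 1) / 2 := by
  rw [Nat.le_div_iff_mul_le two_pos]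
  rcases Nat.eq_zero_or_pos n with rfl | h
  · simp
  · exact Nat.mul_le_mul_left n (by omega)

/-- The terms `n = N` and `n = -N - 1` have opposite signs for either parity of `b`, and their
exponents differ by `2 N + 1`. -/
theorem hSeries_eq_tsum (hq : ‖q‖ < 1) (r : ℕ) :
    hSeries (r + 2) q = ∑' N, qNu q N * (1 - q ^ (2 * N + 1)) * qMu q N ^ (r + 1) := by
  have hs1 := summable_qNu_mul hq r
  have hs2 : Summable fun N => q ^ (2 * N + 1) * (qNu q N * qMu q N ^ (r + 1)) := by
    refine .of_norm_bounded hs1.norm fun N => ?_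
    rw [norm_mul]
    exact mul_le_of_le_one_left (norm_nonneg _) (norm_pow_le_one hq _)
  have e1 : ∀ n : ℕ, epsilon (r + 2) n *
      q ^ (((r + 2 : ℕ) : ℤ) * ((n : ℤ) * ((n : ℤ) + 1) / 2) - n) =
      qNu q n * qMu q n ^ (r + 1) := by
    intro n
    have hn := le_triangle n
    have : ((r + 2 : ℕ) : ℤ) * ((n : ℤ) * ((n : ℤ) + 1) / 2) - n =
        (((n * (n + 1) / 2 - n) + (n * (n + 1) / 2) * (r + 1) : ℕ) : ℤ) := by
      push_cast [Nat.cast_sub hn]; ring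
    rw [this, zpow_natCast, epsilon_natCast, qNu_eq_pow, qMu_eq_pow, pow_add q, pow_mul q]
    ring
  have e2 : ∀ n : ℕ, epsilon (r + 2) (-((n : ℤ) + 1)) *
      q ^ (((r + 2 : ℕ) : ℤ) * (-((n : ℤ) + 1) * (-((n : ℤ) + 1) + 1) / 2) - -((n : ℤ) + 1)) =
      -(q ^ (2 * n + 1) * (qNu q n * qMu q n ^ (r + 1))) := by
    intro n
    obtain ⟨t, ht⟩ := Nat.exists_eq_add_of_le (le_triangle n)
    have : ((r + 2 : ℕ) : ℤ) * (-((n : ℤ) + 1) * (-((n : ℤ) + 1) + 1) / 2) - -((n : ℤ) + 1) =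
        ((2 * n + 1 + (n * (n + 1) / 2 - n) + (n * (n + 1) / 2) * (r + 1) : ℕ) : ℤ) := by
      rw [show -((n : ℤ) + 1) * (-((n : ℤ) + 1) + 1) = ((n * (n + 1) : ℕ) : ℤ) by push_cast; ring]
      push_cast [Nat.cast_sub (le_triangle n)]; ring
    rw [this, zpow_natCast, epsilon_neg, qNu_eq_pow, qMu_eq_pow, pow_add q, pow_mul q, pow_add q]
    ring
  rw [hSeries, tsum_of_nat_of_neg_add_one (by simpa only [e1] using hs1)
    (by simpa only [e2] using hs2.neg)]
  simp only [e1, e2]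
  rw [← hs1.tsum_add hs2.neg]
  exact tsum_congr fun n => by ring

theorem chainSeq_zero (hq : ‖q‖ < 1) (r : ℕ) : chainSeq q r 0 = hSeries (r + 2) q := by
  rw [chainSeq_zero_eq_tsum hq, hSeries_eq_tsum hq]

/-! ### Sums over the polygon -/

/-- The weight of a path of vertices with the variables `l` in a face with the variable `a`; the
path starts next to a vertex with the variable `y`. -/
def pathWeight (q : ℂ) (a : ℕ) : List ℕ → ℕ → ℂ
  | [], _ => 1
  | b :: l, y => qMu q a * (q ^ ((a + y + 1) * b) * (qPoch q b)⁻¹ * (qPoch q (a + b))⁻¹) *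
      pathWeight q a l b

theorem norm_pathWeight_le (hq : ‖q‖ < 1) {K : ℝ} (hK : 1 ≤ K) (h : ∀ n, ‖(qPoch q n)⁻¹‖ ≤ K)
    (a : ℕ) (l : List ℕ) : ∀ y, ‖pathWeight q a l y‖ ≤ (K * K) ^ l.length * ‖q‖ ^ l.sum := by
  induction l with
  | nil => intro y; simp [pathWeight]
  | cons b l ih =>
    intro y
    rw [pathWeight, norm_mul, norm_mul, norm_mul, norm_mul, norm_pow, List.length_cons,
      List.sum_cons, pow_succ, pow_add]
    have h1 : ‖q‖ ^ ((a + y + 1) * b) ≤ ‖q‖ ^ b :=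
      pow_le_pow_of_le_one (norm_nonneg _) hq.le (by nlinarith [Nat.zero_le ((a + y) * b)])
    calc _ ≤ 1 * (‖q‖ ^ b * K * K) * ((K * K) ^ l.length * ‖q‖ ^ l.sum) := by
          gcongr
          · exact norm_qMu_le_one hq a
          · exact h _
          · exact h _
          · exact ih _
      _ = _ := by ring

theorem summable_pow_sum (hq : ‖q‖ < 1) (r : ℕ) :
    Summable fun b : Fin r → ℕ => ‖q‖ ^ (List.ofFn b).sum := by
  induction r with
  | zero => exact (hasSum_fintype _).summable
  | succ r ih =>
    rw [← (Fin.consEquiv fun _ : Fin (r + 1) => ℕ).summable_iff]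
    have := (summable_geometric_of_lt_one (norm_nonneg q) hq).mul_of_nonneg ih
      (fun _ => by positivity) (fun _ => by positivity)
    refine this.congr fun p => ?_
    simp [Fin.consEquiv, List.ofFn_succ, pow_add]

theorem summable_pathWeight (hq : ‖q‖ < 1) (a r y : ℕ) :
    Summable fun b : Fin r → ℕ => pathWeight q a (List.ofFn b) y := by
  obtain ⟨K, hK, -, h⟩ := exists_qPoch_bound hq
  refine .of_norm_bounded ((summable_pow_sum hq r).mul_left ((K * K) ^ r)) fun b => ?_
  simpa using norm_pathWeight_le hq hK h a (List.ofFn b) y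

theorem tsum_pathWeight_succ (hq : ‖q‖ < 1) (a r y : ℕ) :
    ∑' b : Fin (r + 1) → ℕ, pathWeight q a (List.ofFn b) y =
      ∑' n : ℕ, q ^ ((a + y + 1) * n) * (qPoch q n)⁻¹ * (qPoch q (a + n))⁻¹ *
        (qMu q a * ∑' b : Fin r → ℕ, pathWeight q a (List.ofFn b) n) := by
  have hs := (Fin.consEquiv fun _ : Fin (r + 1) => ℕ).summable_iff.2
    (summable_pathWeight hq a (r + 1) y)
  rw [← (Fin.consEquiv fun _ : Fin (r + 1) => ℕ).tsum_eq]
  refine hs.tsum_prod.trans (tsum_congr fun n => ?_)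
  rw [← tsum_mul_left, ← tsum_mul_left]
  refine tsum_congr fun b => ?_
  simp only [Function.comp, Fin.consEquiv, Equiv.coe_fn_mk, List.ofFn_succ, Fin.cons_zero,
    Fin.cons_succ, pathWeight]
  ring

/-- Induction along the path, splitting off the vertex next to the one with variable `y`. The empty
path is Euler's second identity; a further vertex costs one factor `1 / (q)_∞` and one step of the
chain iteration. -/
theorem tsum_pathWeight (hq : ‖q‖ < 1) (a r : ℕ) : ∀ y : ℕ,
    qMu q a * ∑' b : Fin r → ℕ, pathWeight q a (List.ofFn b) y =
      qPoch q (a + y) * (qPochInf q)⁻¹ ^ (r + 1) *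
        ∑' j : ℕ, chainSeq q r (a + j) * q ^ (y * j) * (qPoch q j)⁻¹ := by
  have hP := qPochInf_ne_zero hq
  obtain ⟨K, hK, hK', h⟩ := exists_qPoch_bound hq
  have hK0 : 0 ≤ K := zero_le_one.trans hK
  induction r with
  | zero =>
    intro y
    have h1 := tsum_euler' hq (a + y)
    rw [tsum_eq_single (fun i => i.elim0) (fun b hb => (hb (Subsingleton.elim _ _)).elim)]
    have h2 : ∀ j : ℕ, chainSeq q 0 (a + j) * q ^ (y * j) * (qPoch q j)⁻¹ =
        qMu q a * (qMu q j * q ^ ((a + y) * j) * (qPoch q j)⁻¹) := by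
      intro j; rw [chainSeq, qMu_add]; ring
    rw [tsum_congr h2, tsum_mul_left, zero_add, pow_one]
    have h3 : ∀ T : ℂ, qPoch q (a + y) * (qPochInf q)⁻¹ * (qMu q a * T) =
      qMu q a * ((qPochInf q)⁻¹ * (qPoch q (a + y) * T)) := fun T => by ring
    rw [h3, h1, inv_mul_cancel₀ hP]
    simp [pathWeight]
  | succ r ih =>
    intro y
    obtain ⟨C, hC, hb⟩ := exists_chainSeq_bound hq r
    rw [tsum_pathWeight_succ hq]
    -- The factor `(q)_{a + n}` from the induction hypothesis cancels the denominator of the arc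
    -- between the face and the split-off vertex, so Euler's identity becomes applicable in `n`.
    have e1 : ∀ n : ℕ, q ^ ((a + y + 1) * n) * (qPoch q n)⁻¹ * (qPoch q (a + n))⁻¹ *
        (qMu q a * ∑' b : Fin r → ℕ, pathWeight q a (List.ofFn b) n) =
        (qPochInf q)⁻¹ ^ (r + 1) * ∑' j : ℕ, chainSeq q r (a + j) * (qPoch q j)⁻¹ *
          (q ^ ((a + y + j + 1) * n) * (qPoch q n)⁻¹) := by
      intro n
      rw [ih n]
      have : ∀ T : ℂ, q ^ ((a + y + 1) * n) * (qPoch q n)⁻¹ * (qPoch q (a + n))⁻¹ *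
          (qPoch q (a + n) * (qPochInf q)⁻¹ ^ (r + 1) * T) = (qPochInf q)⁻¹ ^ (r + 1) *
          (q ^ ((a + y + 1) * n) * (qPoch q n)⁻¹ * T) *
          (qPoch q (a + n) * (qPoch q (a + n))⁻¹) := fun T => by ring
      rw [this, mul_inv_cancel₀ (qPoch_ne_zero hq _), mul_one, ← tsum_mul_left]
      congr 1
      exact tsum_congr fun j => by ring
    have hs : Summable (Function.uncurry fun j n : ℕ => chainSeq q r (a + j) * (qPoch q j)⁻¹ *
          (q ^ ((a + y + j + 1) * n) * (qPoch q n)⁻¹)) := by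
      refine summable_prod_of_norm_le_geometric hq (C * K * K) fun p => ?_
      have h1 : ‖chainSeq q r (a + p.1)‖ ≤ C * ‖q‖ ^ p.1 :=
        (hb _).trans (mul_le_mul_of_nonneg_left
          (pow_le_pow_of_le_one (norm_nonneg _) hq.le (by omega)) hC)
      have h2 : ‖q‖ ^ ((a + y + p.1 + 1) * p.2) ≤ ‖q‖ ^ p.2 :=
        pow_le_pow_of_le_one (norm_nonneg _) hq.le
          (by nlinarith [Nat.zero_le ((a + y + p.1) * p.2)])
      have h3 := h p.1
      have h4 := h p.2
      rw [Function.uncurry, norm_mul, norm_mul, norm_mul, norm_pow]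
      calc _ ≤ (C * ‖q‖ ^ p.1) * K * (‖q‖ ^ p.2 * K) :=
            mul_le_mul (mul_le_mul h1 h3 (by positivity) (by positivity))
              (mul_le_mul h2 h4 (by positivity) (by positivity)) (by positivity) (by positivity)
        _ = _ := by ring
    rw [tsum_congr e1, tsum_mul_left, Summable.tsum_comm hs]
    -- Euler's identity produces `(q)_{a + y + j} / (q)_∞`. Expanding `(q)_{a + y + j} / (q)_j` by
    -- the `q`-binomial theorem splits `j` as `i + l`; the sum over `l` is the next chain iterate.
    have e2 : ∀ j : ℕ, ∑' n : ℕ, chainSeq q r (a + j) * (qPoch q j)⁻¹ *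
          (q ^ ((a + y + j + 1) * n) * (qPoch q n)⁻¹) =
        (qPochInf q)⁻¹ * (qPoch q (a + y) * ∑ p ∈ antidiagonal j,
          qMu q p.1 * q ^ ((a + y) * p.1) * (qPoch q p.1)⁻¹ * (qPoch q p.2)⁻¹ *
            chainSeq q r (a + (p.1 + p.2))) := by
      intro j
      rw [tsum_mul_left, tsum_euler hq]
      have h5 : ∀ p ∈ antidiagonal j, qMu q p.1 * q ^ ((a + y) * p.1) * (qPoch q p.1)⁻¹ *
          (qPoch q p.2)⁻¹ * chainSeq q r (a + (p.1 + p.2)) = qMu q p.1 * q ^ ((a + y) * p.1) *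
          (qPoch q p.1)⁻¹ * (qPoch q p.2)⁻¹ * chainSeq q r (a + j) := by
        intro p hp; rw [mem_antidiagonal.1 hp]
      rw [Finset.sum_congr rfl h5, ← Finset.sum_mul, ← mul_assoc (qPoch q (a + y)),
        sum_qMu_mul_pow hq]
      ring
    have hs2 : Summable fun p : ℕ × ℕ => qMu q p.1 * q ^ ((a + y) * p.1) * (qPoch q p.1)⁻¹ *
        (qPoch q p.2)⁻¹ * chainSeq q r (a + (p.1 + p.2)) := by
      refine summable_prod_of_norm_le_geometric hq (1 * 1 * K * K * C) fun p => ?_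
      rw [norm_mul, norm_mul, norm_mul, norm_mul]
      calc _ ≤ 1 * 1 * K * K * (C * ‖q‖ ^ (p.1 + p.2)) := by
            gcongr
            · exact norm_qMu_le_one hq _
            · exact norm_pow_le_one hq _
            · exact h _
            · exact h _
            · refine (hb _).trans (mul_le_mul_of_nonneg_left ?_ hC)
              exact pow_le_pow_of_le_one (norm_nonneg _) hq.le (by omega)
        _ = _ := by rw [pow_add]; ring
    rw [tsum_congr e2, tsum_mul_left, tsum_mul_left, ← tsum_tsum_eq_tsum_antidiagonal
      (f := fun i l => qMu q i * q ^ ((a + y) * i) * (qPoch q i)⁻¹ *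
        (qPoch q l)⁻¹ * chainSeq q r (a + (i + l))) hs2]
    have e3 : ∀ i : ℕ, chainSeq q (r + 1) (a + i) * q ^ (y * i) * (qPoch q i)⁻¹ =
        qMu q a * ∑' l, qMu q i * q ^ ((a + y) * i) * (qPoch q i)⁻¹ *
        (qPoch q l)⁻¹ * chainSeq q r (a + (i + l)) := by
      intro i
      rw [chainSeq, qMu_add]
      have : ∀ T : ℂ, qMu q a * (qMu q i * q ^ (a * i)) * T * q ^ (y * i) * (qPoch q i)⁻¹ =
          qMu q a * (qMu q i * q ^ ((a + y) * i) * (qPoch q i)⁻¹ * T) := fun T => by ring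
      rw [this, ← tsum_mul_left]
      congr 1
      refine tsum_congr fun l => ?_
      rw [add_assoc]; ring
    rw [tsum_congr e3, tsum_mul_left]
    ring

/-- The weight of a polygon with a vertex of variable `0`, a vertex of variable `y` and a path of
further vertices, in a face with the variable `a`. -/
def polygonWeight (q : ℂ) (y a : ℕ) (l : List ℕ) : ℂ :=
  qNu q a * q ^ (a * y) * (qPoch q a)⁻¹ * (qPoch q (a + y))⁻¹ * (qMu q a * pathWeight q a l y)

/-- The constant is uniform in `y`, the variable of the part to which the polygon is attached;
absolute convergence of the whole multisum needs this. -/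
theorem exists_polygonWeight_bound (hq : ‖q‖ < 1) (r : ℕ) :
    ∃ C : ℝ, ∀ y a (b : Fin r → ℕ),
      ‖polygonWeight q y a (List.ofFn b)‖ ≤ C * (‖q‖ ^ a * ‖q‖ ^ (List.ofFn b).sum) := by
  obtain ⟨K, hK, -, h⟩ := exists_qPoch_bound hq
  refine ⟨K * K * (K * K) ^ r, fun y a b => ?_⟩
  rw [polygonWeight, norm_mul, norm_mul, norm_mul, norm_mul, norm_mul]
  calc _ ≤ 1 * 1 * K * K * (‖q‖ ^ a * ((K * K) ^ r * ‖q‖ ^ (List.ofFn b).sum)) := by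
        gcongr
        · exact norm_qNu_le hq _
        · exact norm_pow_le_one hq _
        · exact h _
        · exact h _
        · exact norm_qMu_le hq _
        · simpa using norm_pathWeight_le hq hK h a (List.ofFn b) y
    _ = _ := by ring

theorem summable_pow_mul_pow_sum (hq : ‖q‖ < 1) (r : ℕ) :
    Summable fun p : ℕ × (Fin r → ℕ) => ‖q‖ ^ p.1 * ‖q‖ ^ (List.ofFn p.2).sum :=
  Summable.mul_of_nonneg (f := fun n : ℕ => ‖q‖ ^ n)
    (g := fun b : Fin r → ℕ => ‖q‖ ^ (List.ofFn b).sum)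
    (summable_geometric_of_lt_one (norm_nonneg q) hq) (summable_pow_sum hq r)
    (fun _ => pow_nonneg (norm_nonneg _) _) (fun _ => pow_nonneg (norm_nonneg _) _)

theorem hasSum_polygonWeight (hq : ‖q‖ < 1) (r y : ℕ) :
    HasSum (fun p : ℕ × (Fin r → ℕ) => polygonWeight q y p.1 (List.ofFn p.2))
      ((qPochInf q)⁻¹ ^ (r + 1) * hSeries (r + 2) q) := by
  obtain ⟨B, hB⟩ := exists_polygonWeight_bound hq r
  obtain ⟨K, hK, hK', h⟩ := exists_qPoch_bound hq
  have hK0 : 0 ≤ K := zero_le_one.trans hK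
  obtain ⟨C, hC, hb⟩ := exists_chainSeq_bound hq r
  have hs : Summable (fun p : ℕ × (Fin r → ℕ) => polygonWeight q y p.1 (List.ofFn p.2)) :=
    .of_norm_bounded ((summable_pow_mul_pow_sum hq r).mul_left B) fun p => hB y p.1 p.2
  suffices ∑' p : ℕ × (Fin r → ℕ), polygonWeight q y p.1 (List.ofFn p.2) =
      (qPochInf q)⁻¹ ^ (r + 1) * hSeries (r + 2) q by
    rw [← this]; exact hs.hasSum
  rw [hs.tsum_prod]
  have e1 : ∀ a : ℕ, ∑' b : Fin r → ℕ, polygonWeight q y a (List.ofFn b) =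
      (qPochInf q)⁻¹ ^ (r + 1) * ∑' j, qNu q a * (qPoch q a)⁻¹ * (qPoch q j)⁻¹ *
        (q ^ (y * (a + j)) * chainSeq q r (a + j)) := by
    intro a
    unfold polygonWeight
    rw [tsum_mul_left, tsum_mul_left, tsum_pathWeight hq]
    have : ∀ T : ℂ, qNu q a * q ^ (a * y) * (qPoch q a)⁻¹ * (qPoch q (a + y))⁻¹ *
        (qPoch q (a + y) * (qPochInf q)⁻¹ ^ (r + 1) * T) = (qPochInf q)⁻¹ ^ (r + 1) *
        (qNu q a * q ^ (a * y) * (qPoch q a)⁻¹ * T) * (qPoch q (a + y) * (qPoch q (a + y))⁻¹) :=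
      fun T => by ring
    rw [this, mul_inv_cancel₀ (qPoch_ne_zero hq _), mul_one, ← tsum_mul_left]
    congr 1
    exact tsum_congr fun j => by ring
  have hs2 : Summable fun p : ℕ × ℕ => qNu q p.1 * (qPoch q p.1)⁻¹ * (qPoch q p.2)⁻¹ *
        (q ^ (y * (p.1 + p.2)) * chainSeq q r (p.1 + p.2)) := by
    refine summable_prod_of_norm_le_geometric hq (1 * K * K * (1 * C)) fun p => ?_
    rw [norm_mul, norm_mul, norm_mul, norm_mul]
    calc _ ≤ 1 * K * K * (1 * (C * ‖q‖ ^ (p.1 + p.2))) := by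
          gcongr
          · exact norm_qNu_le hq _
          · exact h _
          · exact h _
          · exact norm_pow_le_one hq _
          · exact hb _
      _ = _ := by rw [pow_add]; ring
  rw [tsum_congr e1, tsum_mul_left, tsum_tsum_eq_tsum_antidiagonal (f := fun a j => qNu q a *
    (qPoch q a)⁻¹ * (qPoch q j)⁻¹ * (q ^ (y * (a + j)) * chainSeq q r (a + j))) hs2,
    ← chainSeq_zero hq]
  congr 1
  -- Both `y` and the chain sequence enter only through `a + j = m`, so the `q`-binomial sum at `z =
  -- 1` kills every `m > 0`, and with it the dependence on `y`.
  have e2 : ∀ m : ℕ, ∑ p ∈ antidiagonal m, qNu q p.1 * (qPoch q p.1)⁻¹ * (qPoch q p.2)⁻¹ *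
        (q ^ (y * (p.1 + p.2)) * chainSeq q r (p.1 + p.2)) =
      if m = 0 then chainSeq q r 0 else 0 := by
    intro m
    cases m with
    | zero => simp
    | succ m =>
      have h3 : ∀ p ∈ antidiagonal (m + 1), qNu q p.1 * (qPoch q p.1)⁻¹ * (qPoch q p.2)⁻¹ *
        (q ^ (y * (p.1 + p.2)) * chainSeq q r (p.1 + p.2)) = qNu q p.1 * (qPoch q p.1)⁻¹ *
        (qPoch q p.2)⁻¹ * (q ^ (y * (m + 1)) * chainSeq q r (m + 1)) := by
        intro p hp; rw [mem_antidiagonal.1 hp]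
      rw [Finset.sum_congr rfl h3, ← Finset.sum_mul, sum_qNu_eq_zero hq, zero_mul,
        if_neg (Nat.succ_ne_zero m)]
  rw [tsum_congr e2, tsum_ite_eq 0 fun _ => chainSeq q r 0]

theorem hSeries_two (hq : ‖q‖ < 1) : hSeries 2 q = 1 := by
  rw [← chainSeq_zero hq 0, chainSeq, qMu_zero]

end Polygon

/-! ### Face systems -/

/-- `1 / (q)_n`, which vanishes for negative `n`. -/
def qPochInv (q : ℂ) (n : ℤ) : ℂ := if 0 ≤ n then (qPoch q n.toNat)⁻¹ else 0

theorem qPochInv_natCast (q : ℂ) (n : ℕ) : qPochInv q n = (qPoch q n)⁻¹ := by simp [qPochInv]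

theorem qPochInv_of_neg (q : ℂ) {n : ℤ} (h : n < 0) : qPochInv q n = 0 := if_neg (not_le.2 h)

/-- The combinatorial data of a multisum: the pairs of an `A`-face and a `B`-face that are separated
by an arc, the pairs of `B`-faces that meet at a crossing, the `B`-faces, and the `A`-faces. -/
abbrev FaceSystem (ι : Type) := Multiset (ι × ι) × Multiset (Sym2 ι) × Multiset ι × Multiset ι

namespace FaceSystem

variable {ι : Type}

/-- Twice the exponent of `q`. -/
def twoExponent (S : FaceSystem ι) (s : ι → ℤ) : ℤ :=
  (S.1.map fun p => s p.1 * (s p.1 + 1) + 2 * (s p.1 * s p.2)).sum +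
    2 * (S.2.1.map fun e => (e.map s).mul).sum + 2 * (S.2.2.1.map s).sum - 2 * (S.2.2.2.map s).sum

/-- The summand of the multisum. -/
def weight (q : ℂ) (S : FaceSystem ι) (s : ι → ℤ) : ℂ :=
  (-1) ^ (S.1.map fun p => s p.1).sum * q ^ (S.twoExponent s / 2) *
    (S.1.map fun p => qPochInv q (s p.1 + s p.2)).prod

/-- All arcs have nonnegative values. -/
def Admissible (S : FaceSystem ι) (s : ι → ℤ) : Prop := ∀ p ∈ S.1, 0 ≤ s p.1 + s p.2

theorem admissible_add {S T : FaceSystem ι} {s : ι → ℤ} :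
    (S + T).Admissible s ↔ S.Admissible s ∧ T.Admissible s := by
  simp only [Admissible, Prod.fst_add, Multiset.mem_add, or_imp, forall_and]

theorem twoExponent_add (S T : FaceSystem ι) (s : ι → ℤ) :
    (S + T).twoExponent s = S.twoExponent s + T.twoExponent s := by
  simp only [twoExponent, Prod.fst_add, Prod.snd_add, Multiset.map_add, Multiset.sum_add]
  ring

theorem even_twoExponent (S : FaceSystem ι) (s : ι → ℤ) : 2 ∣ S.twoExponent s := by
  have h : 2 ∣ (S.1.map fun p => s p.1 * (s p.1 + 1) + 2 * (s p.1 * s p.2)).sum := by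
    refine Multiset.dvd_sum fun x hx => ?_
    obtain ⟨p, -, rfl⟩ := Multiset.mem_map.1 hx
    exact dvd_add (Int.even_mul_succ_self _).two_dvd (dvd_mul_right _ _)
  unfold twoExponent
  exact dvd_sub (dvd_add (dvd_add h (dvd_mul_right _ _)) (dvd_mul_right _ _)) (dvd_mul_right _ _)

theorem weight_eq_zero {q : ℂ} {S : FaceSystem ι} {s : ι → ℤ} (h : ¬ S.Admissible s) :
    S.weight q s = 0 := by
  simp only [Admissible, not_forall, not_le] at h
  obtain ⟨p, hp, hn⟩ := h
  refine mul_eq_zero_of_right _ (Multiset.prod_eq_zero (Multiset.mem_map.2 ⟨p, hp, ?_⟩))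
  exact qPochInv_of_neg q hn

/-- At `q = 0` integer powers are not additive for exponents of mixed sign. Nonnegative exponents on
the admissible assignments repair this; on all other assignments both sides vanish. -/
theorem weight_add {q : ℂ} {S T : FaceSystem ι} {s : ι → ℤ}
    (hS : S.Admissible s → T.Admissible s → 0 ≤ S.twoExponent s)
    (hT : S.Admissible s → T.Admissible s → 0 ≤ T.twoExponent s) :
    (S + T).weight q s = S.weight q s * T.weight q s := by
  by_cases h1 : S.Admissible s
  · by_cases h2 : T.Admissible s
    · obtain ⟨m, hm⟩ := Int.eq_ofNat_of_zero_le (Int.ediv_nonneg (hS h1 h2) two_pos.le)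
      obtain ⟨n, hn⟩ := Int.eq_ofNat_of_zero_le (Int.ediv_nonneg (hT h1 h2) two_pos.le)
      unfold weight
      rw [twoExponent_add, Int.add_ediv_of_dvd_left (S.even_twoExponent s), hm, hn, ← Nat.cast_add]
      simp only [zpow_natCast, Prod.fst_add, Multiset.map_add, Multiset.sum_add, Multiset.prod_add]
      rw [zpow_add₀ (by norm_num), pow_add]
      ring
    · rw [weight_eq_zero h2, mul_zero, weight_eq_zero fun h => h2 (admissible_add.1 h).2]
  · rw [weight_eq_zero h1, zero_mul, weight_eq_zero fun h => h1 (admissible_add.1 h).1]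

theorem weight_congr (q : ℂ) {S : FaceSystem ι} {s s' : ι → ℤ}
    (h1 : ∀ p ∈ S.1, s p.1 = s' p.1 ∧ s p.2 = s' p.2) (h2 : ∀ e ∈ S.2.1, ∀ i ∈ e, s i = s' i)
    (h3 : ∀ i ∈ S.2.2.1, s i = s' i) (h4 : ∀ i ∈ S.2.2.2, s i = s' i) :
    S.weight q s = S.weight q s' := by
  have e1 : (S.1.map fun p => s p.1) = S.1.map fun p => s' p.1 :=
    Multiset.map_congr rfl fun p hp => (h1 p hp).1
  have e2 : (S.1.map fun p => qPochInv q (s p.1 + s p.2)) =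
      S.1.map fun p => qPochInv q (s' p.1 + s' p.2) :=
    Multiset.map_congr rfl fun p hp => by rw [(h1 p hp).1, (h1 p hp).2]
  have e3 : (S.1.map fun p => s p.1 * (s p.1 + 1) + 2 * (s p.1 * s p.2)) =
      S.1.map fun p => s' p.1 * (s' p.1 + 1) + 2 * (s' p.1 * s' p.2) :=
    Multiset.map_congr rfl fun p hp => by rw [(h1 p hp).1, (h1 p hp).2]
  have e4 : (S.2.1.map fun e => (e.map s).mul) = S.2.1.map fun e => (e.map s').mul :=
    Multiset.map_congr rfl fun e he => by rw [Sym2.map_congr (h2 e he)]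
  unfold weight twoExponent
  rw [e1, e2, e3, e4, Multiset.map_congr rfl h3, Multiset.map_congr rfl h4]

end FaceSystem

open FaceSystem

/-! ### Cells -/

/-- The pieces from which a plane graph is assembled: a bigon in the face `f` doubles an edge `u v`;
a polygon in the face `f` adds the path `xs` of new vertices from `w` to the base vertex. -/
inductive Cell (ι : Type)
  | bigon (f u v : ι)
  | polygon (f w : ι) (xs : List ι)

namespace Cell

variable {ι : Type}

/-- The number of vertices which a cell adds. -/
def rank : Cell ι → ℕ
  | bigon _ _ _ => 0
  | polygon _ _ xs => xs.length

/-- The faces whose variables a cell adds. -/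
def vars : Cell ι → List ι
  | bigon f _ _ => [f]
  | polygon f _ xs => f :: xs

/-- The vertices which a cell adds. -/
def verts : Cell ι → List ι
  | bigon _ _ _ => []
  | polygon _ _ xs => xs

/-- The part of the face system that belongs to a path in the face `f`, from `w` to `v₀`. -/
def pathSystem (f₀ v₀ f : ι) : List ι → ι → FaceSystem ι
  | [], w => (0, {s(w, v₀)}, 0, 0)
  | x :: xs, w => ({(f, x), (f₀, x)}, {s(w, x)}, {x}, 0) + pathSystem f₀ v₀ f xs x

/-- The part of the face system that belongs to a cell. -/
def system (f₀ v₀ : ι) : Cell ι → FaceSystem ι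
  | bigon f u v => ({(f, u), (f, v)}, {s(u, v)}, 0, {f})
  | polygon f w xs => ({(f, v₀), (f, w)}, 0, 0, {f}) + pathSystem f₀ v₀ f xs w

variable {f₀ v₀ f : ι} {q : ℂ} {s : ι → ℤ}

theorem mem_pathSystem {x : ι} {xs : List ι} : ∀ {w : ι}, x ∈ xs →
    (f₀, x) ∈ (pathSystem f₀ v₀ f xs w).1 := by
  induction xs with
  | nil => simp
  | cons z xs ih =>
    intro w hx
    rcases List.mem_cons.1 hx with rfl | hx
    · simp [pathSystem]
    · exact Multiset.mem_add.2 (Or.inr (ih hx))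

theorem mem_system_of_mem_verts {x : ι} {c : Cell ι} (hx : x ∈ c.verts) :
    (f₀, x) ∈ (c.system f₀ v₀).1 := by
  cases c with
  | bigon f u v => simp [verts] at hx
  | polygon f w xs => exact Multiset.mem_add.2 (Or.inr (mem_pathSystem hx))

theorem twoExponent_pathSystem_nonneg (hf₀ : s f₀ = 0) (hv₀ : s v₀ = 0) (ha : 0 ≤ s f)
    {xs : List ι} : ∀ {w : ι}, 0 ≤ s w → (∀ x ∈ xs, 0 ≤ s x) →
    0 ≤ (pathSystem f₀ v₀ f xs w).twoExponent s := by
  induction xs with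
  | nil => intro w _ _; simp [pathSystem, twoExponent, hv₀]
  | cons x xs ih =>
    intro w hw h
    rw [pathSystem, twoExponent_add]
    have hx := h x List.mem_cons_self
    refine add_nonneg ?_ (ih hx fun z hz => h z (List.mem_cons_of_mem _ hz))
    simp [twoExponent, hf₀]
    positivity

theorem admissible_pathSystem (hf₀ : s f₀ = 0) {xs : List ι} {w : ι}
    (h : (pathSystem f₀ v₀ f xs w).Admissible s) : ∀ x ∈ xs, 0 ≤ s x := fun x hx => by
  have := h _ (mem_pathSystem (w := w) hx)
  simpa [hf₀] using this

theorem weight_pathSystem (hf₀ : s f₀ = 0) (hv₀ : s v₀ = 0) {a : ℕ} (ha : s f = a)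
    {xs : List ι} : ∀ {w : ι} {y : ℕ} {l : List ℕ}, s w = y → xs.map s = l.map (Nat.cast) →
    (pathSystem f₀ v₀ f xs w).weight q s = pathWeight q a l y := by
  induction xs with
  | nil =>
    intro w y l _ hl
    obtain rfl : l = [] := by simpa using hl.symm
    simp [pathSystem, weight, twoExponent, hv₀, pathWeight]
  | cons x xs ih =>
    intro w y l hw hl
    obtain _ | ⟨b, l⟩ := l
    · simp at hl
    simp only [List.map_cons, List.cons.injEq] at hl
    have hle : 0 ≤ s f := by rw [ha]; positivity
    have hlx : ∀ z ∈ xs, 0 ≤ s z := fun z hz => by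
      obtain ⟨n, -, hn⟩ := List.mem_map.1 (hl.2 ▸ List.mem_map_of_mem (f := s) hz)
      rw [← hn]; positivity
    rw [pathSystem, weight_add, ih hl.1 hl.2, pathWeight]
    · congr 1
      have e : twoExponent (ι := ι) ({(f, x), (f₀, x)}, {s(w, x)}, {x}, 0) s / 2 =
          ((a * (a + 1) / 2 + (a + y + 1) * b : ℕ) : ℤ) := by
        have h2 : 2 ∣ a * (a + 1) := (Nat.even_mul_succ_self a).two_dvd
        refine Int.ediv_eq_of_eq_mul_right two_ne_zero ?_
        have h3 : (2 : ℤ) * ((a * (a + 1) / 2 : ℕ) : ℤ) = a * (a + 1) := by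
          exact_mod_cast Nat.mul_div_cancel' h2
        push_cast at h3 ⊢
        simp [twoExponent, hf₀, ha, hw, hl.1]
        linear_combination -h3
      unfold weight
      rw [e, zpow_natCast, pow_add, qMu_eq_pow]
      simp only [Multiset.insert_eq_cons, Multiset.map_cons, Multiset.map_singleton,
        Multiset.sum_cons, Multiset.sum_singleton, Multiset.prod_cons, Multiset.prod_singleton,
        hf₀, ha, hl.1, add_zero, zero_add, zpow_natCast, qPochInv_natCast, ← Nat.cast_add]
      ring
    · intro _ _
      simp [twoExponent, hf₀, ha, hw, hl.1]
      positivity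
    · intro _ _
      exact twoExponent_pathSystem_nonneg hf₀ hv₀ hle (by rw [hl.1]; positivity) hlx

theorem weight_polygon (hf₀ : s f₀ = 0) (hv₀ : s v₀ = 0) {a y : ℕ} {w : ι} {xs : List ι}
    {l : List ℕ} (ha : s f = a) (hw : s w = y) (hl : xs.map s = l.map (Nat.cast)) :
    ((polygon f w xs).system f₀ v₀).weight q s = polygonWeight q y a l := by
  have hle : 0 ≤ s f := by rw [ha]; positivity
  have hlx : ∀ z ∈ xs, 0 ≤ s z := fun z hz => by
    obtain ⟨n, -, hn⟩ := List.mem_map.1 (hl ▸ List.mem_map_of_mem (f := s) hz)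
    rw [← hn]; positivity
  have e0 : twoExponent (ι := ι) ({(f, v₀), (f, w)}, 0, 0, {f}) s =
      2 * ((a * a + a * y : ℕ) : ℤ) := by
    simp [twoExponent, hv₀, ha, hw]; ring
  rw [system, weight_add, weight_pathSystem hf₀ hv₀ ha hw hl, polygonWeight, ← mul_assoc]
  · congr 1
    unfold weight
    rw [e0, Int.mul_ediv_cancel_left _ two_ne_zero, zpow_natCast, pow_add, qMu_eq_pow, qNu_eq_pow]
    -- A square is the sum of two consecutive triangular numbers: these are the exponents of `qNu`
    -- and `qMu`, whose signs match those of the arcs at `v₀` and `w`.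
    have h1 : q ^ (a * a) = q ^ (a * (a + 1) / 2 - a) * q ^ (a * (a + 1) / 2) := by
      rw [← pow_add]
      congr 1
      have h2 := Nat.mul_div_cancel' (Nat.even_mul_succ_self a).two_dvd
      have h3 := le_triangle a
      have h4 : a * (a + 1) = a * a + a := by ring
      omega
    have h2 : ((-1 : ℂ) ^ a) * (-1) ^ a = 1 := by rw [← mul_pow]; simp
    simp only [Multiset.insert_eq_cons, Multiset.map_cons, Multiset.map_singleton,
      Multiset.sum_cons, Multiset.sum_singleton, Multiset.prod_cons, Multiset.prod_singleton,
      hv₀, ha, hw, add_zero, zpow_natCast, qPochInv_natCast, ← Nat.cast_add]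
    rw [h1, pow_add]
    ring
  · intro _ _; rw [e0]; positivity
  · intro _ _
    exact twoExponent_pathSystem_nonneg hf₀ hv₀ hle (by rw [hw]; positivity) hlx

/-- The exponent of a bigon is `(s f + s u) (s f + s v) = n (n + d)`. In the shifted variable `n` it
is thus a polygon without further vertices, with `y = d`. -/
theorem weight_bigon (u v : ι) {n d : ℕ} (hu : s f + s u = n) (hv : s f + s v = n + d) :
    ((bigon f u v).system f₀ v₀).weight q s = polygonWeight q d n [] := by
  have e0 : ((bigon f u v).system f₀ v₀).twoExponent s = 2 * ((n * n + n * d : ℕ) : ℤ) := by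
    simp [system, twoExponent]
    linear_combination (2 * (s f + s v)) * hu + 2 * (n : ℤ) * hv
  unfold weight
  rw [e0, Int.mul_ediv_cancel_left _ two_ne_zero, zpow_natCast, polygonWeight, pathWeight, mul_one,
    pow_add, qMu_eq_pow, qNu_eq_pow]
  have h1 : q ^ (n * n) = q ^ (n * (n + 1) / 2 - n) * q ^ (n * (n + 1) / 2) := by
    rw [← pow_add]
    congr 1
    have h2 := Nat.mul_div_cancel' (Nat.even_mul_succ_self n).two_dvd
    have h3 := le_triangle n
    have h4 : n * (n + 1) = n * n + n := by ring
    omega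
  have h2 : ((-1 : ℂ) ^ n) * (-1) ^ n = 1 := by rw [← mul_pow]; simp
  have h3 : (-1 : ℂ) ^ (s f + s f) = 1 := Even.neg_one_zpow ⟨s f, rfl⟩
  simp only [system, Multiset.insert_eq_cons, Multiset.map_cons, Multiset.map_singleton,
    Multiset.sum_cons, Multiset.sum_singleton, Multiset.prod_cons, Multiset.prod_singleton, hu, hv,
    h3, qPochInv_natCast, ← Nat.cast_add]
  rw [h1]
  linear_combination (-(q ^ (n * (n + 1) / 2 - n) * q ^ (n * (n + 1) / 2) * q ^ (n * d) *
    (qPoch q n)⁻¹ * (qPoch q (n + d))⁻¹)) * h2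

end Cell

/-! ### Summation over the variables of a cell -/

/-- Fubini for constant fibre sums; the uniform bound on the norms in the fibres gives absolute
convergence. Nothing is asked where `f` vanishes, because a polygon is summed only over admissible
assignments of the rest. -/
theorem hasSum_mul_of_fiberwise {α β : Type*} {f : α → ℂ} {g : α → β → ℂ} {A B : ℂ} {K : ℝ}
    (hf : HasSum f A) (hg : ∀ a, f a ≠ 0 → HasSum (g a) B ∧ ∑' b, ‖g a b‖ ≤ K) :
    HasSum (fun p : α × β => f p.1 * g p.1 p.2) (A * B) := by
  have hb : ∀ a, HasSum (fun b => f a * g a b) (f a * B) := fun a => by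
    by_cases ha : f a = 0
    · simp [ha]
    · exact (hg a ha).1.mul_left (f a)
  have hs : Summable fun p : α × β => f p.1 * g p.1 p.2 := by
    refine Summable.of_norm ((summable_prod_of_nonneg fun _ => norm_nonneg _).2
      ⟨fun a => (hb a).summable.norm, ?_⟩)
    refine Summable.of_nonneg_of_le (fun a => tsum_nonneg fun b => norm_nonneg _) (fun a => ?_)
      (hf.summable.norm.mul_right K)
    by_cases ha : f a = 0
    · simp [ha]
    · simp only [norm_mul]
      rw [tsum_mul_left]
      exact mul_le_mul_of_nonneg_left (hg a ha).2 (norm_nonneg _)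
  have h1 := hs.hasSum.prod_fiberwise hb
  rw [(hf.mul_right B).unique h1]
  exact hs.hasSum

theorem exists_hasSum_of_polygonWeight {q : ℂ} (hq : ‖q‖ < 1) (r : ℕ) :
    ∃ K : ℝ, ∀ {β : Type} (F : β → ℂ) (y : ℕ) (φ : ℕ × (Fin r → ℕ) → β), Function.Injective φ →
      (∀ x ∉ Set.range φ, F x = 0) → (∀ p, F (φ p) = polygonWeight q y p.1 (List.ofFn p.2)) →
      HasSum F ((qPochInf q)⁻¹ ^ (r + 1) * hSeries (r + 2) q) ∧ ∑' x, ‖F x‖ ≤ K := by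
  obtain ⟨B, hB⟩ := exists_polygonWeight_bound hq r
  refine ⟨B * ∑' p : ℕ × (Fin r → ℕ), ‖q‖ ^ p.1 * ‖q‖ ^ (List.ofFn p.2).sum,
    fun F y φ hφ h0 h => ⟨?_, ?_⟩⟩
  · rw [← hφ.hasSum_iff h0, show F ∘ φ = _ from funext h]
    exact hasSum_polygonWeight hq r y
  · have h1 : ∑' x, ‖F x‖ = ∑' p : ℕ × (Fin r → ℕ), ‖polygonWeight q y p.1 (List.ofFn p.2)‖ := by
      simp only [← h]
      exact (hφ.tsum_eq (f := fun x => ‖F x‖) fun x hx => by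
        by_contra hx'
        exact hx (by simp [h0 x hx'])).symm
    rw [h1, ← tsum_mul_left]
    exact Summable.tsum_le_tsum (fun p => hB y p.1 p.2) (hasSum_polygonWeight hq r y).summable.norm
      ((summable_pow_mul_pow_sum hq r).mul_left B)

namespace Cell

variable {ι : Type} {f₀ v₀ : ι} {q : ℂ}

/-- The vertices at which a cell is attached. -/
def refs : Cell ι → List ι
  | bigon _ u v => [u, v]
  | polygon _ w _ => [w]

/-- The condition under which a cell can be summed. -/
def Attachable (s : ι → ℤ) : Cell ι → Prop
  | bigon _ _ _ => True
  | polygon _ w _ => 0 ≤ s w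

theorem system_bigon_comm (f u v : ι) :
    (bigon f u v).system f₀ v₀ = (bigon f v u).system f₀ v₀ := by
  simp only [system, Multiset.pair_comm (f, u) (f, v), Sym2.eq_swap (a := u)]

/-- With `s u ≤ s v`, admissibility says exactly that `n = s f + s u` is a natural number, and `d =
s v - s u` plays the role of `y`. The signs of `s u` and `s v` do not matter. -/
theorem hasSum_bigon_aux (hq : ‖q‖ < 1) (f : ι) : ∃ K : ℝ, ∀ (u v : ι) (s : ι → ℤ), u ≠ f → v ≠ f →
    s u ≤ s v →
    HasSum (fun t : Fin 1 → ℤ => ((bigon f u v).system f₀ v₀).weight q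
      (Function.extend [f].get t s)) ((qPochInf q)⁻¹ ^ (0 + 1) * hSeries (0 + 2) q) ∧
    ∑' t : Fin 1 → ℤ, ‖((bigon f u v).system f₀ v₀).weight q (Function.extend [f].get t s)‖ ≤ K := by
  obtain ⟨K, hK⟩ := exists_hasSum_of_polygonWeight hq 0
  refine ⟨K, fun u v s hu hv huv => ?_⟩
  have hinj : Function.Injective [f].get := List.nodup_iff_injective_get.1 (List.nodup_singleton f)
  have ext : ∀ (t : Fin 1 → ℤ), Function.extend [f].get t s f = t 0 := fun t => hinj.extend_apply t s 0
  have ext' : ∀ (t : Fin 1 → ℤ) i, i ≠ f → Function.extend [f].get t s i = s i := fun t i hi =>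
    Function.extend_apply' _ _ _ (by
      rintro ⟨a, rfl⟩
      exact hi (List.mem_singleton.1 (List.get_mem _ a)))
  obtain ⟨d, hd⟩ := Int.eq_ofNat_of_zero_le (sub_nonneg.2 huv)
  refine hK (fun t : Fin 1 → ℤ => ((bigon f u v).system f₀ v₀).weight q
      (Function.extend [f].get t s)) d (fun p _ => p.1 - s u) ?_ ?_ ?_
  · rintro ⟨a, b⟩ ⟨a', b'⟩ h
    have h1 := congrFun h 0
    simp only [sub_left_inj, Nat.cast_inj] at h1
    exact Prod.ext h1 (Subsingleton.elim _ _)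
  · intro t ht
    refine weight_eq_zero fun h => ht ?_
    have h1 := h (f, u) (by simp [system])
    simp only [ext, ext' t u hu] at h1
    refine ⟨((t 0 + s u).toNat, fun i => i.elim0), funext fun i => ?_⟩
    rw [Subsingleton.elim i 0]
    simp [h1]
  · rintro ⟨a, b⟩
    rw [List.ofFn_zero]
    refine weight_bigon u v ?_ ?_
    · rw [ext, ext' _ u hu]; simp
    · rw [ext, ext' _ v hv]; linear_combination hd

/-- This is the decoupling of a cell: neither the value of its sum nor the bound `K` depends on the
assignment `s` of the other faces. -/
theorem exists_hasSum (hq : ‖q‖ < 1) (c : Cell ι) (hnd : c.vars.Nodup) (hf₀ : f₀ ∉ c.vars)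
    (hv₀ : v₀ ∉ c.vars) (hr : ∀ i ∈ c.refs, i ∉ c.vars) :
    ∃ K : ℝ, ∀ s : ι → ℤ, s f₀ = 0 → s v₀ = 0 → c.Attachable s →
      HasSum (fun t : Fin c.vars.length → ℤ => (c.system f₀ v₀).weight q
        (Function.extend c.vars.get t s)) ((qPochInf q)⁻¹ ^ (c.rank + 1) * hSeries (c.rank + 2) q) ∧
      ∑' t : Fin c.vars.length → ℤ,
        ‖(c.system f₀ v₀).weight q (Function.extend c.vars.get t s)‖ ≤ K := by
  cases c with
  | bigon f u v =>
    obtain ⟨K, hK⟩ := hasSum_bigon_aux (f₀ := f₀) (v₀ := v₀) hq f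
    have hu : u ≠ f := by simpa [vars] using hr u (by simp [refs])
    have hv : v ≠ f := by simpa [vars] using hr v (by simp [refs])
    refine ⟨K, fun s _ _ _ => ?_⟩
    rcases le_total (s u) (s v) with h | h
    · exact hK u v s hu hv h
    · rw [system_bigon_comm]
      exact hK v u s hv hu h
  | polygon f w xs =>
    obtain ⟨K, hK⟩ := exists_hasSum_of_polygonWeight hq xs.length
    refine ⟨K, fun s h1 h2 hw => ?_⟩
    obtain ⟨y, hy⟩ := Int.eq_ofNat_of_zero_le hw
    have hinj : Function.Injective (f :: xs).get := List.nodup_iff_injective_get.1 hnd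
    have ext' : ∀ (t : Fin (xs.length + 1) → ℤ) i, i ∉ f :: xs →
        Function.extend (f :: xs).get t s i = s i := fun t i hi =>
      Function.extend_apply' _ _ _ (by
        rintro ⟨a, rfl⟩
        exact hi (List.get_mem _ a))
    have extf : ∀ t : Fin (xs.length + 1) → ℤ, Function.extend (f :: xs).get t s f = t 0 :=
      fun t => hinj.extend_apply t s 0
    have extx : ∀ t : Fin (xs.length + 1) → ℤ,
        xs.map (Function.extend (f :: xs).get t s) = List.ofFn fun i => t i.succ := by
      refine fun t => List.ext_getElem (by simp) fun n h3 h4 => ?_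
      rw [List.length_map] at h3
      simpa using hinj.extend_apply t s (Fin.succ ⟨n, h3⟩)
    refine hK (fun t : Fin (xs.length + 1) → ℤ => ((polygon f w xs).system f₀ v₀).weight q
      (Function.extend (f :: xs).get t s)) y
      (fun p => Fin.cons (p.1 : ℤ) fun i => (p.2 i : ℤ)) ?_ ?_ ?_
    · rintro ⟨a, b⟩ ⟨a', b'⟩ h
      have h3 := Fin.cons_injective2 h
      simp only [Nat.cast_inj] at h3
      exact Prod.ext h3.1 (funext fun i => by simpa using congrFun h3.2 i)
    · intro t ht
      refine weight_eq_zero fun h => ht ?_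
      -- The arcs between `f` and `v₀` and between `f₀` and the new vertices each have one variable
      -- equal to zero, so on the support all variables of the cell are natural numbers.
      have h3 := h (f, v₀) (by simp [system])
      simp only [extf, ext' t v₀ hv₀, h2, add_zero] at h3
      have h4 : ∀ i : Fin xs.length, 0 ≤ t i.succ := by
        intro i
        have h5 := h (f₀, xs.get i) (Multiset.mem_add.2 (Or.inr (mem_pathSystem (List.get_mem xs i))))
        dsimp only at h5
        rw [ext' t f₀ hf₀, h1, zero_add] at h5
        rwa [show xs.get i = (f :: xs).get i.succ from rfl, hinj.extend_apply] at h5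
      refine ⟨((t 0).toNat, fun i => (t i.succ).toNat), funext fun i => ?_⟩
      refine Fin.cases ?_ (fun i => ?_) i
      · simp [h3]
      · simp [h4]
    · rintro ⟨a, b⟩
      refine weight_polygon ?_ ?_ ?_ ?_ ?_
      · rw [ext' _ f₀ hf₀, h1]
      · rw [ext' _ v₀ hv₀, h2]
      · rw [extf]; simp
      · rw [ext' _ w (hr w (by simp [refs])), hy]
      · rw [extx, List.map_ofFn]; congr 1

theorem twoExponent_nonneg {s : ι → ℤ} {c : Cell ι} (hf₀ : s f₀ = 0) (hv₀ : s v₀ = 0)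
    (hc : c.Attachable s) (h : (c.system f₀ v₀).Admissible s) :
    0 ≤ (c.system f₀ v₀).twoExponent s := by
  cases c with
  | bigon f u v =>
    have h1 := h (f, u) (by simp [system])
    have h2 := h (f, v) (by simp [system])
    have : ((bigon f u v).system f₀ v₀).twoExponent s = 2 * ((s f + s u) * (s f + s v)) := by
      simp [system, twoExponent]; ring
    rw [this]
    exact mul_nonneg two_pos.le (mul_nonneg h1 h2)
  | polygon f w xs =>
    obtain ⟨h1, h2⟩ := admissible_add.1 h
    have ha := h1 (f, v₀) (by simp)
    simp only [hv₀, add_zero] at ha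
    have hw : 0 ≤ s w := hc
    rw [system, twoExponent_add]
    refine add_nonneg ?_ (twoExponent_pathSystem_nonneg hf₀ hv₀ ha hc (admissible_pathSystem hf₀ h2))
    have : twoExponent (ι := ι) ({(f, v₀), (f, w)}, 0, 0, {f}) s = 2 * (s f * s f + s f * s w) := by
      simp [twoExponent, hv₀]; ring
    rw [this]
    positivity

end Cell

/-! ### Assembling cells -/

section Assembly

variable {ι : Type} (f₀ v₀ w₀ : ι)

/-- The variables of the graph assembled from an edge `v₀ w₀` and a list of cells. -/
def cellVars : List (Cell ι) → List ι
  | [] => [w₀]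
  | c :: L => c.vars ++ cellVars L

/-- The vertices of the assembled graph other than `v₀`. -/
def cellVerts : List (Cell ι) → List ι
  | [] => [w₀]
  | c :: L => c.verts ++ cellVerts L

/-- The face system of the assembled graph. -/
def cellSystem : List (Cell ι) → FaceSystem ι
  | [] => ({(f₀, v₀), (f₀, w₀)}, {s(v₀, w₀)}, {v₀, w₀}, {f₀})
  | c :: L => c.system f₀ v₀ + cellSystem L

/-- Every cell is attached to vertices that are present. -/
def ValidCells : List (Cell ι) → Prop
  | [] => True
  | .bigon _ u v :: L => (u ∈ v₀ :: cellVerts w₀ L ∧ v ∈ v₀ :: cellVerts w₀ L) ∧ ValidCells L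
  | .polygon _ w _ :: L => w ∈ cellVerts w₀ L ∧ ValidCells L

variable {f₀ v₀ w₀} {q : ℂ}

theorem ValidCells.tail {c : Cell ι} {L : List (Cell ι)} (h : ValidCells v₀ w₀ (c :: L)) :
    ValidCells v₀ w₀ L := by
  cases c <;> exact h.2

theorem cellVerts_subset (L : List (Cell ι)) : cellVerts w₀ L ⊆ cellVars w₀ L := by
  induction L with
  | nil => exact List.Subset.refl _
  | cons c L ih =>
    have : c.verts ⊆ c.vars := by cases c <;> simp [Cell.verts, Cell.vars]
    exact List.append_subset.2 ⟨List.Subset.trans this (List.subset_append_left _ _),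
      List.Subset.trans ih (List.subset_append_right _ _)⟩

theorem ValidCells.refs {c : Cell ι} {L : List (Cell ι)} (h : ValidCells v₀ w₀ (c :: L)) :
    ∀ i ∈ c.refs, i ∈ v₀ :: cellVars w₀ L := by
  have h0 : v₀ :: cellVerts w₀ L ⊆ v₀ :: cellVars w₀ L :=
    List.cons_subset_cons _ (cellVerts_subset L)
  cases c with
  | bigon f u v =>
    intro i hi
    simp only [Cell.refs, List.mem_cons, List.not_mem_nil, or_false] at hi
    rcases hi with rfl | rfl
    · exact h0 h.1.1
    · exact h0 h.1.2
  | polygon f w xs =>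
    intro i hi
    obtain rfl := List.mem_singleton.1 hi
    exact h0 (List.mem_cons_of_mem _ h.1)

theorem mem_cellSystem_of_mem_cellVerts {x : ι} {L : List (Cell ι)} (hx : x ∈ cellVerts w₀ L) :
    (f₀, x) ∈ (cellSystem f₀ v₀ w₀ L).1 := by
  induction L with
  | nil => obtain rfl := List.mem_singleton.1 hx; simp [cellSystem]
  | cons c L ih =>
    rcases List.mem_append.1 hx with h | h
    · exact Multiset.mem_add.2 (Or.inl (Cell.mem_system_of_mem_verts h))
    · exact Multiset.mem_add.2 (Or.inr (ih h))

/-- Every vertex other than `v₀` has been added on the boundary of `f₀`. As `s f₀ = 0`, the arc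
between them makes its variable nonnegative. -/
theorem ValidCells.attachable {c : Cell ι} {L : List (Cell ι)} {s : ι → ℤ}
    (h : ValidCells v₀ w₀ (c :: L)) (hf₀ : s f₀ = 0) (hs : (cellSystem f₀ v₀ w₀ L).Admissible s) :
    c.Attachable s := by
  cases c with
  | bigon f u v => trivial
  | polygon f w xs =>
    have := hs _ (mem_cellSystem_of_mem_cellVerts h.1)
    simpa [Cell.Attachable, hf₀] using this

theorem twoExponent_cellSystem_nonneg {s : ι → ℤ} (hf₀ : s f₀ = 0) (hv₀ : s v₀ = 0)
    {L : List (Cell ι)} : ValidCells v₀ w₀ L → (cellSystem f₀ v₀ w₀ L).Admissible s →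
    0 ≤ (cellSystem f₀ v₀ w₀ L).twoExponent s := by
  induction L with
  | nil =>
    intro _ h
    have h1 := h (f₀, w₀) (by simp [cellSystem])
    simp only [hf₀, zero_add] at h1
    simpa [cellSystem, twoExponent, hf₀, hv₀] using h1
  | cons c L ih =>
    intro hv h
    obtain ⟨h1, h2⟩ := admissible_add.1 h
    rw [cellSystem, twoExponent_add]
    exact add_nonneg (Cell.twoExponent_nonneg hf₀ hv₀ (hv.attachable hf₀ h2) h1) (ih hv.tail h2)

theorem weight_cellSystem_cons {s : ι → ℤ} (hf₀ : s f₀ = 0) (hv₀ : s v₀ = 0)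
    {c : Cell ι} {L : List (Cell ι)} (hv : ValidCells v₀ w₀ (c :: L)) :
    (cellSystem f₀ v₀ w₀ (c :: L)).weight q s =
      (cellSystem f₀ v₀ w₀ L).weight q s * (c.system f₀ v₀).weight q s := by
  rw [cellSystem, weight_add, mul_comm]
  · exact fun h1 h2 => Cell.twoExponent_nonneg hf₀ hv₀ (hv.attachable hf₀ h2) h1
  · exact fun _ h2 => twoExponent_cellSystem_nonneg hf₀ hv₀ hv.tail h2

/-- A face system involves only faces from a set. -/
def FaceSystem.On (S : FaceSystem ι) (V : Set ι) : Prop :=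
  (∀ p ∈ S.1, p.1 ∈ V ∧ p.2 ∈ V) ∧ (∀ e ∈ S.2.1, ∀ i ∈ e, i ∈ V) ∧
    (∀ i ∈ S.2.2.1, i ∈ V) ∧ ∀ i ∈ S.2.2.2, i ∈ V

theorem FaceSystem.On.add {S T : FaceSystem ι} {V : Set ι} (hS : S.On V) (hT : T.On V) :
    (S + T).On V := by
  refine ⟨fun p hp => ?_, fun p hp => ?_, fun p hp => ?_, fun p hp => ?_⟩ <;>
    rcases Multiset.mem_add.1 hp with h | h
  exacts [hS.1 p h, hT.1 p h, hS.2.1 p h, hT.2.1 p h, hS.2.2.1 p h, hT.2.2.1 p h, hS.2.2.2 p h,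
    hT.2.2.2 p h]

theorem Cell.pathSystem_on {f : ι} {V : Set ι} (h0 : f₀ ∈ V) (h1 : v₀ ∈ V) (hf : f ∈ V)
    {xs : List ι} : ∀ {w : ι}, w ∈ V → (∀ x ∈ xs, x ∈ V) → (pathSystem f₀ v₀ f xs w).On V := by
  induction xs with
  | nil => intro w hw _; simp [pathSystem, FaceSystem.On, hw, h1]
  | cons x xs ih =>
    intro w hw h
    have hx := h x List.mem_cons_self
    refine FaceSystem.On.add ?_ (ih hx fun z hz => h z (List.mem_cons_of_mem _ hz))
    simp [FaceSystem.On, hw, hx, h0, hf]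

theorem Cell.system_on {c : Cell ι} {V : Set ι} (h0 : f₀ ∈ V) (h1 : v₀ ∈ V)
    (hc : ∀ i ∈ c.vars, i ∈ V) (hr : ∀ i ∈ c.refs, i ∈ V) : (c.system f₀ v₀).On V := by
  cases c with
  | bigon f u v =>
    simp only [vars, refs, List.mem_cons, List.not_mem_nil, or_false, forall_eq_or_imp,
      forall_eq] at hc hr
    simp [system, FaceSystem.On, hc, hr]
  | polygon f w xs =>
    simp only [vars, refs, List.mem_cons, List.not_mem_nil, or_false, forall_eq_or_imp,
      forall_eq] at hc hr
    refine FaceSystem.On.add ?_ (pathSystem_on h0 h1 hc.1 hr hc.2)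
    simp [FaceSystem.On, hc.1, hr, h1]

theorem cellSystem_on {V : Set ι} (h0 : f₀ ∈ V) (h1 : v₀ ∈ V) {L : List (Cell ι)} :
    ValidCells v₀ w₀ L → (∀ i ∈ cellVars w₀ L, i ∈ V) → (cellSystem f₀ v₀ w₀ L).On V := by
  induction L with
  | nil =>
    intro _ h
    have := h w₀ (by simp [cellVars])
    simp [cellSystem, FaceSystem.On, h0, h1, this]
  | cons c L ih =>
    intro hv h
    have hL : ∀ i ∈ cellVars w₀ L, i ∈ V := fun i hi => h i (List.mem_append_right _ hi)
    refine FaceSystem.On.add (Cell.system_on h0 h1 (fun i hi => h i (List.mem_append_left _ hi))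
      fun i hi => ?_) (ih hv.tail hL)
    rcases List.mem_cons.1 (hv.refs i hi) with rfl | hi
    · exact h1
    · exact hL i hi

theorem FaceSystem.On.weight_congr {S : FaceSystem ι} {V : Set ι} (h : S.On V) {s s' : ι → ℤ}
    (hs : ∀ i ∈ V, s i = s' i) : S.weight q s = S.weight q s' :=
  FaceSystem.weight_congr q (fun p hp => ⟨hs _ (h.1 p hp).1, hs _ (h.1 p hp).2⟩)
    (fun e he i hi => hs i (h.2.1 e he i hi)) (fun i hi => hs i (h.2.2.1 i hi))
    fun i hi => hs i (h.2.2.2 i hi)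

/-- The assignments that vanish outside a list of faces. -/
abbrev SupportedOn (V : List ι) : Type := {s : ι → ℤ // ∀ i ∉ V, s i = 0}

/-- Extension of an assignment by the values of further variables. -/
def SupportedOn.extend (U : List ι) {V : List ι} (p : SupportedOn V × (Fin U.length → ℤ)) :
    SupportedOn (U ++ V) :=
  ⟨Function.extend U.get p.2 p.1.1, fun i hi => by
    rw [List.mem_append, not_or] at hi
    rw [Function.extend_apply' _ _ _ (by rintro ⟨a, rfl⟩; exact hi.1 (List.get_mem _ a))]
    exact p.1.2 i hi.2⟩

theorem SupportedOn.extend_bijective {U V : List ι} (hU : U.Nodup) (hUV : U.Disjoint V) :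
    Function.Bijective (SupportedOn.extend U (V := V)) := by
  classical
  have hinj : Function.Injective U.get := List.nodup_iff_injective_get.1 hU
  have ext' : ∀ (t : Fin U.length → ℤ) (s : ι → ℤ) i, i ∉ U → Function.extend U.get t s i = s i :=
    fun t s i hi => Function.extend_apply' _ _ _ (by rintro ⟨a, rfl⟩; exact hi (List.get_mem _ a))
  refine ⟨?_, ?_⟩
  · rintro ⟨s, t⟩ ⟨s', t'⟩ h
    have h1 : Function.extend U.get t s.1 = Function.extend U.get t' s'.1 := congrArg Subtype.val h
    refine Prod.ext (Subtype.ext (funext fun i => ?_)) (funext fun i => ?_)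
    · by_cases hi : i ∈ U
      · rw [s.2 i (hUV hi), s'.2 i (hUV hi)]
      · have := congrFun h1 i
        rwa [ext' _ _ i hi, ext' _ _ i hi] at this
    · have := congrFun h1 (U.get i)
      rwa [hinj.extend_apply, hinj.extend_apply] at this
  · rintro ⟨s, hs⟩
    refine ⟨(⟨fun i => if i ∈ U then 0 else s i, fun i hi => ?_⟩, fun i => s (U.get i)),
      Subtype.ext (funext fun i => ?_)⟩
    · dsimp only
      split_ifs with h
      · rfl
      · exact hs i (by simp [h, hi])
    · by_cases hi : i ∈ U
      · obtain ⟨a, rfl⟩ := List.mem_iff_get.1 hi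
        exact hinj.extend_apply _ _ a
      · exact (ext' _ _ i hi).trans (if_neg hi)

/-- The number of edges of the assembled graph. -/
def cellEdges (L : List (Cell ι)) : ℕ := (L.map fun c => c.rank + 1).sum + 1

/-- A single edge leaves `∑ q ^ n / (q)_n`, which is Euler's identity at `N = 0`. -/
theorem hasSum_weight_nil (hq : ‖q‖ < 1) (h01 : f₀ ≠ w₀) (h11 : v₀ ≠ w₀) :
    HasSum (fun s : SupportedOn [w₀] => (cellSystem f₀ v₀ w₀ []).weight q s.1) (qPochInf q)⁻¹ := by
  classical
  have hz : ∀ (s : SupportedOn [w₀]) i, i ≠ w₀ → s.1 i = 0 := fun s i hi => s.2 i (by simpa using hi)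
  let φ : ℕ → SupportedOn [w₀] := fun n => ⟨fun i => if i = w₀ then n else 0, fun i hi =>
    if_neg (by simpa using hi)⟩
  have hφ : Function.Injective φ := fun m n h => by
    have := congrFun (congrArg Subtype.val h) w₀
    simpa [φ] using this
  rw [← hφ.hasSum_iff]
  · have h1 := (summable_euler hq 0).hasSum
    rw [tsum_euler hq 0, qPoch_zero, one_mul] at h1
    convert h1 using 2 with n
    have e0 : (φ n).1 f₀ = 0 := hz _ _ h01
    have e1 : (φ n).1 v₀ = 0 := hz _ _ h11
    have e2 : (φ n).1 w₀ = n := if_pos rfl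
    simp [cellSystem, weight, twoExponent, e0, e1, e2, qPochInv_natCast]
    left
    simp [qPochInv]
  · intro s hs
    refine weight_eq_zero fun h => hs ?_
    have h1 := h (f₀, w₀) (by simp [cellSystem])
    simp only [hz s f₀ h01, zero_add] at h1
    refine ⟨(s.1 w₀).toNat, Subtype.ext (funext fun i => ?_)⟩
    by_cases hi : i = w₀
    · subst hi; simp [φ, h1]
    · simp [φ, hi, hz s i hi]

/-- The multisum of an assembled graph is a product of the series `h_b`. -/
theorem hasSum_weight_cellSystem (hq : ‖q‖ < 1) (L : List (Cell ι)) :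
    ValidCells v₀ w₀ L → (f₀ :: v₀ :: cellVars w₀ L).Nodup →
    HasSum (fun s : SupportedOn (cellVars w₀ L) => (cellSystem f₀ v₀ w₀ L).weight q s.1)
      ((qPochInf q)⁻¹ ^ cellEdges L * (L.map fun c => hSeries (c.rank + 2) q).prod) := by
  induction L with
  | nil =>
    intro _ hnd
    have h1 : f₀ ≠ w₀ ∧ v₀ ≠ w₀ := by
      simp only [cellVars, List.nodup_cons, List.mem_cons, List.not_mem_nil, or_false, not_or] at hnd
      exact ⟨hnd.1.2, hnd.2.1⟩
    simpa [cellEdges, cellVars] using hasSum_weight_nil hq h1.1 h1.2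
  | cons c L ih =>
    intro hv hnd
    simp only [cellVars, List.nodup_cons, List.mem_cons, List.mem_append, not_or,
      List.nodup_append'] at hnd
    obtain ⟨⟨h0, h1, h2⟩, ⟨h3, h4⟩, h5, h6, h7⟩ := hnd
    have hA := ih hv.tail (by simp [h0, h2, h4, h6])
    have href : ∀ i ∈ c.refs, i ∉ c.vars := fun i hi hi' => by
      rcases List.mem_cons.1 (hv.refs i hi) with rfl | h
      · exact h3 hi'
      · exact h7 hi' h
    obtain ⟨K, hK⟩ := Cell.exists_hasSum (f₀ := f₀) (v₀ := v₀) hq c h5 h1 h3 href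
    -- The outer sum is the induction hypothesis and the inner one is the cell. Where the weight of
    -- the rest is nonzero, the assignment is admissible, so the cell is attachable.
    have hprod := hasSum_mul_of_fiberwise (g := fun (s : SupportedOn (cellVars w₀ L))
      (t : Fin c.vars.length → ℤ) => (c.system f₀ v₀).weight q (Function.extend c.vars.get t s.1))
      (K := K) hA (fun s hs => hK s.1 (s.2 _ h2) (s.2 _ h4)
        (hv.attachable (s.2 _ h2) (by_contra fun h => hs (weight_eq_zero h))))
    have hbij := SupportedOn.extend_bijective h5 h7
    refine (Equiv.ofBijective _ hbij).hasSum_iff.1 ?_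
    convert hprod using 1
    · funext ⟨s, t⟩
      have ext' : ∀ i, i ∉ c.vars → Function.extend c.vars.get t s.1 i = s.1 i := fun i hi =>
        Function.extend_apply' _ _ _ (by rintro ⟨a, rfl⟩; exact hi (List.get_mem _ a))
      change (cellSystem f₀ v₀ w₀ (c :: L)).weight q (Function.extend c.vars.get t s.1) = _
      rw [weight_cellSystem_cons ((ext' _ h1).trans (s.2 _ h2)) ((ext' _ h3).trans (s.2 _ h4)) hv]
      congr 1
      -- The rest of the graph involves none of the variables of the new cell.
      refine FaceSystem.On.weight_congr (V := {i | i = f₀ ∨ i = v₀ ∨ i ∈ cellVars w₀ L})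
        (cellSystem_on (by simp) (by simp) hv.tail (by intro i hi; simp [hi])) fun i hi => ?_
      rcases hi with rfl | rfl | hi
      · exact ext' _ h1
      · exact ext' _ h3
      · exact ext' _ fun h => h7 h hi
    · simp only [cellEdges, List.map_cons, List.sum_cons, List.prod_cons]
      ring

end Assembly

/-! ### The multisum of a diagram in local form -/

namespace AlternatingKnotDiagram

variable (D : AlternatingKnotDiagram)

theorem under_end_unique {x y : D.Crossing} {k l : Fin 4} (hk : k = 0 ∨ k = 2) (hl : l = 0 ∨ l = 2)
    (h : D.pd x k = D.pd y l) : (x, k) = (y, l) :=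
  (D.under_end (D.pd y l)).unique ⟨hk, h⟩ ⟨hl, rfl⟩

theorem over_end_unique {x y : D.Crossing} {k l : Fin 4} (hk : k = 1 ∨ k = 3) (hl : l = 1 ∨ l = 3)
    (h : D.pd x k = D.pd y l) : (x, k) = (y, l) :=
  (D.over_end (D.pd y l)).unique ⟨hk, h⟩ ⟨hl, rfl⟩

/-- By alternation an arc joins an underpassing to an overpassing end, so `k + 1` and `l` have
opposite parity. This yields the checkerboard colouring: odd corners lie in `A`-faces, even corners
in `B`-faces. -/
theorem cornerStep_parity {d e : D.Crossing × Fin 4} (h : CornerStep D.pd d e) :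
    (d.2 = 1 ∨ d.2 = 3) ↔ (e.2 = 1 ∨ e.2 = 3) := by
  obtain ⟨x, k⟩ := d
  obtain ⟨y, l⟩ := e
  obtain ⟨h1, h2⟩ := h
  have key : ¬ ((k + 1 = 0 ∨ k + 1 = 2) ∧ (l = 0 ∨ l = 2)) ∧
      ¬ ((k + 1 = 1 ∨ k + 1 = 3) ∧ (l = 1 ∨ l = 3)) :=
    ⟨fun h => h2 (D.under_end_unique h.1 h.2 h1), fun h => h2 (D.over_end_unique h.1 h.2 h1)⟩
  clear h1 h2
  change (k = 1 ∨ k = 3) ↔ (l = 1 ∨ l = 3)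
  revert k l
  decide

theorem corner_parity {x y : D.Crossing} {k l : Fin 4} (h : D.corner x k = D.corner y l) :
    (k = 1 ∨ k = 3) ↔ (l = 1 ∨ l = 3) := by
  have h1 := (D.corner_eq_iff (x, k) (y, l)).1 h
  have h2 : ∀ d e, Relation.EqvGen (CornerStep D.pd) d e →
      ((d.2 = 1 ∨ d.2 = 3) ↔ (e.2 = 1 ∨ e.2 = 3)) := by
    intro d e h
    induction h with
    | rel d e h => exact D.cornerStep_parity h
    | refl d => exact Iff.rfl
    | symm d e _ ih => exact ih.symm
    | trans d e f _ _ ih ih' => exact ih.trans ih'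
  exact h2 _ _ h1

theorem isA_corner_one (x : D.Crossing) : D.IsA (D.corner x 1) := ⟨x, Or.inl rfl⟩

theorem isA_corner_three (x : D.Crossing) : D.IsA (D.corner x 3) := ⟨x, Or.inr rfl⟩

theorem not_isA_corner_zero (x : D.Crossing) : ¬ D.IsA (D.corner x 0) := by
  rintro ⟨y, h | h⟩
  · exact absurd (D.corner_parity h) (by decide)
  · exact absurd (D.corner_parity h) (by decide)

theorem not_isA_corner_two (x : D.Crossing) : ¬ D.IsA (D.corner x 2) := by
  rintro ⟨y, h | h⟩
  · exact absurd (D.corner_parity h) (by decide)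
  · exact absurd (D.corner_parity h) (by decide)

/-- At its overpassing end the arc has the same two faces beside it, in the opposite order; two
corner steps identify them. So the underpassing end alone determines the faces at an arc. -/
theorem bounds_iff {x : D.Crossing} {k : Fin 4} (hk : k = 0 ∨ k = 2) (F : D.Region) :
    D.Bounds (D.pd x k) F ↔ D.corner x k = F ∨ D.corner x (k - 1) = F := by
  constructor
  · rintro ⟨y, l, h, hF⟩
    by_cases hl : l = 0 ∨ l = 2
    · have := D.under_end_unique hl hk h
      simp only [Prod.mk.injEq] at this
      rw [this.1, this.2] at hF
      exact hF
    · have hne : ∀ z : Fin 4, z = k → (x, z) ≠ (y, l) ∧ (y, l) ≠ (x, z) := by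
        rintro z rfl
        exact ⟨fun e => hl ((Prod.mk.inj e).2 ▸ hk), fun e => hl ((Prod.mk.inj e).2 ▸ hk)⟩
      have h1 : D.corner x (k - 1) = D.corner y l :=
        (D.corner_eq_iff (x, k - 1) (y, l)).2 (.rel _ _ ⟨by simpa using h.symm, by
          simpa using (hne k rfl).1⟩)
      have h2 : D.corner y (l - 1) = D.corner x k :=
        (D.corner_eq_iff (y, l - 1) (x, k)).2 (.rel _ _ ⟨by simpa using h, by
          simpa using (hne k rfl).2⟩)
      rw [h1, ← h2]
      exact hF.symm
  · exact fun h => ⟨x, k, rfl, h⟩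

theorem bounds_zero (x : D.Crossing) (F : D.Region) :
    D.Bounds (D.pd x 0) F ↔ D.corner x 0 = F ∨ D.corner x 3 = F := D.bounds_iff (Or.inl rfl) F

theorem bounds_two (x : D.Crossing) (F : D.Region) :
    D.Bounds (D.pd x 2) F ↔ D.corner x 2 = F ∨ D.corner x 1 = F := D.bounds_iff (Or.inr rfl) F

/-- Arcs are indexed by their underpassing ends, which turns sums and products over arcs into sums
and products over crossings. -/
theorem underArc_bijective :
    Function.Bijective fun p : D.Crossing ⊕ D.Crossing =>
      p.elim (fun x => D.pd x 0) fun x => D.pd x 2 := by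
  constructor
  · rintro (x | x) (y | y) h
    · exact congrArg _ (Prod.mk.inj (D.under_end_unique (Or.inl rfl) (Or.inl rfl) h)).1
    · exact absurd (Prod.mk.inj (D.under_end_unique (Or.inl rfl) (Or.inr rfl) h)).2 (by decide)
    · exact absurd (Prod.mk.inj (D.under_end_unique (Or.inr rfl) (Or.inl rfl) h)).2 (by decide)
    · exact congrArg _ (Prod.mk.inj (D.under_end_unique (Or.inr rfl) (Or.inr rfl) h)).1
  · intro a
    obtain ⟨⟨x, k⟩, ⟨hk, ha⟩, -⟩ := D.under_end a
    dsimp only at hk ha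
    rcases hk with rfl | rfl
    · exact ⟨.inl x, ha⟩
    · exact ⟨.inr x, ha⟩

theorem prod_arc {M : Type*} [CommMonoid M] (h : D.Arc → M) :
    ∏ a, h a = (∏ x, h (D.pd x 0)) * ∏ x, h (D.pd x 2) := by
  rw [← Function.Bijective.prod_comp D.underArc_bijective h, Fintype.prod_sum_type]
  rfl

theorem sum_arc {M : Type*} [AddCommMonoid M] (h : D.Arc → M) :
    ∑ a, h a = (∑ x, h (D.pd x 0)) + ∑ x, h (D.pd x 2) := by
  rw [← Function.Bijective.sum_comp D.underArc_bijective h, Fintype.sum_sum_type]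
  rfl

theorem edgeValue_zero (s : D.Region → ℤ) (x : D.Crossing) :
    D.edgeValue s (D.pd x 0) = s (D.corner x 3) + s (D.corner x 0) := by
  have hne : D.corner x 0 ≠ D.corner x 3 :=
    fun h => D.not_isA_corner_zero x (h ▸ D.isA_corner_three x)
  rw [edgeValue, show (Finset.univ.filter fun F => D.Bounds (D.pd x 0) F) =
    {D.corner x 0, D.corner x 3} by ext F; simp [bounds_zero, eq_comm], Finset.sum_pair hne,
    add_comm]

theorem edgeValue_two (s : D.Region → ℤ) (x : D.Crossing) :
    D.edgeValue s (D.pd x 2) = s (D.corner x 1) + s (D.corner x 2) := by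
  have hne : D.corner x 2 ≠ D.corner x 1 :=
    fun h => D.not_isA_corner_two x (h ▸ D.isA_corner_one x)
  rw [edgeValue, show (Finset.univ.filter fun F => D.Bounds (D.pd x 2) F) =
    {D.corner x 2, D.corner x 1} by ext F; simp [bounds_two, eq_comm], Finset.sum_pair hne,
    add_comm]

/-- The face system of a diagram. -/
def faceSystem : FaceSystem D.Region :=
  ((Finset.univ.val.map fun x => (D.corner x 3, D.corner x 0)) +
      Finset.univ.val.map fun x => (D.corner x 1, D.corner x 2),
    Finset.univ.val.map fun x => s(D.corner x 0, D.corner x 2),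
    (Finset.univ.filter fun F => ¬ D.IsA F).val, (Finset.univ.filter fun F => D.IsA F).val)

theorem edgeCount_eq {F : D.Region} (hF : D.IsA F) :
    (D.edgeCount F : ℤ) = ∑ x, ((if D.corner x 3 = F then 1 else 0) +
      if D.corner x 1 = F then 1 else 0) := by
  rw [edgeCount, Finset.card_filter, sum_arc, Finset.sum_add_distrib]
  push_cast
  congr 1 <;> refine Finset.sum_congr rfl fun x _ => ?_
  · have : D.corner x 0 ≠ F := fun h => D.not_isA_corner_zero x (h ▸ hF)
    simp only [bounds_zero, this, false_or]
  · have : D.corner x 2 ≠ F := fun h => D.not_isA_corner_two x (h ▸ hF)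
    simp only [bounds_two, this, false_or]

theorem commonEdges_eq {F G : D.Region} (hF : D.IsA F) (hG : ¬ D.IsA G) :
    (D.commonEdges F G : ℤ) = ∑ x, ((if D.corner x 3 = F ∧ D.corner x 0 = G then 1 else 0) +
      if D.corner x 1 = F ∧ D.corner x 2 = G then 1 else 0) := by
  rw [commonEdges, Finset.card_filter, sum_arc, Finset.sum_add_distrib]
  push_cast
  congr 1 <;> refine Finset.sum_congr rfl fun x _ => ?_
  · have h1 : D.corner x 0 ≠ F := fun h => D.not_isA_corner_zero x (h ▸ hF)
    have h2 : D.corner x 3 ≠ G := fun h => hG (h ▸ D.isA_corner_three x)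
    simp only [bounds_zero, h1, h2, false_or, or_false]
  · have h1 : D.corner x 2 ≠ F := fun h => D.not_isA_corner_two x (h ▸ hF)
    have h2 : D.corner x 1 ≠ G := fun h => hG (h ▸ D.isA_corner_one x)
    simp only [bounds_two, h1, h2, false_or, or_false]

theorem incident_iff {F : D.Region} (hF : ¬ D.IsA F) (x : D.Crossing) :
    D.Incident x F ↔ D.corner x 0 = F ∨ D.corner x 2 = F := by
  constructor
  · rintro ⟨k, h⟩
    have h1 : k ≠ 1 := by rintro rfl; exact hF (h ▸ D.isA_corner_one x)
    have h3 : k ≠ 3 := by rintro rfl; exact hF (h ▸ D.isA_corner_three x)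
    have : k = 0 ∨ k = 2 := by clear h; revert k; decide
    rcases this with rfl | rfl
    · exact Or.inl h
    · exact Or.inr h
  · rintro (h | h)
    exacts [⟨0, h⟩, ⟨2, h⟩]

theorem commonVertices_eq (hne : ∀ x, D.corner x 0 ≠ D.corner x 2) {F G : D.Region}
    (hF : ¬ D.IsA F) (hG : ¬ D.IsA G) (hFG : F ≠ G) :
    (D.commonVertices F G : ℤ) = ∑ x, ((if D.corner x 0 = F ∧ D.corner x 2 = G then 1 else 0) +
      if D.corner x 2 = F ∧ D.corner x 0 = G then 1 else 0) := by
  rw [commonVertices, Finset.card_filter]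
  push_cast
  refine Finset.sum_congr rfl fun x _ => ?_
  have hx := hne x
  simp only [incident_iff D hF, incident_iff D hG]
  by_cases h1 : D.corner x 0 = F
  · have h2 : D.corner x 0 ≠ G := h1 ▸ hFG
    have h3 : D.corner x 2 ≠ F := fun h => hx (h1.trans h.symm)
    simp [h1, h3, hFG]
  · by_cases h2 : D.corner x 2 = F
    · simp [h1, h2, hFG]
    · simp [h1, h2]

/-- The contribution of a crossing to the matrix `Q`. -/
theorem Q_eq_sum (hne : ∀ x, D.corner x 0 ≠ D.corner x 2) (F G : D.Region) :
    D.Q F G = ∑ x, ((if D.corner x 3 = F ∧ D.corner x 3 = G then 1 else 0) +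
      (if D.corner x 1 = F ∧ D.corner x 1 = G then 1 else 0) +
      ((if D.corner x 0 = F ∧ D.corner x 2 = G then 1 else 0) +
        if D.corner x 2 = F ∧ D.corner x 0 = G then 1 else 0) +
      ((if D.corner x 3 = F ∧ D.corner x 0 = G then 1 else 0) +
        if D.corner x 1 = F ∧ D.corner x 2 = G then 1 else 0) +
      ((if D.corner x 3 = G ∧ D.corner x 0 = F then 1 else 0) +
        if D.corner x 1 = G ∧ D.corner x 2 = F then 1 else 0)) := by
  have nA : ∀ {H : D.Region} (x), D.IsA H → D.corner x 0 ≠ H ∧ D.corner x 2 ≠ H := fun x h =>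
    ⟨fun e => D.not_isA_corner_zero x (e ▸ h), fun e => D.not_isA_corner_two x (e ▸ h)⟩
  have nB : ∀ {H : D.Region} (x), ¬ D.IsA H → D.corner x 1 ≠ H ∧ D.corner x 3 ≠ H := fun x h =>
    ⟨fun e => h (e ▸ D.isA_corner_one x), fun e => h (e ▸ D.isA_corner_three x)⟩
  unfold Q
  by_cases hF : D.IsA F <;> by_cases hG : D.IsA G
  · by_cases hFG : F = G
    · subst hFG
      simp only [if_true, hF, D.edgeCount_eq hF]
      refine Finset.sum_congr rfl fun x _ => ?_
      simp [nA x hF]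
    · simp only [hFG, if_false, hF, hG, and_self, if_true]
      refine (Finset.sum_eq_zero fun x _ => ?_).symm
      have h1 : ∀ H : D.Region, ¬ (H = F ∧ H = G) := fun H h => hFG (h.1.symm.trans h.2)
      simp [nA x hF, nA x hG, h1]
  · have hFG : F ≠ G := fun h => hG (h ▸ hF)
    simp only [hFG, if_false, hF, hG, and_false, not_true, false_and, D.commonEdges_eq hF hG]
    refine Finset.sum_congr rfl fun x _ => ?_
    simp [nA x hF, nB x hG]
  · have hFG : F ≠ G := fun h => hF (h ▸ hG)
    have hc : D.commonEdges F G = D.commonEdges G F := by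
      simp only [commonEdges, and_comm]
    simp only [hFG, if_false, hF, hG, and_false, not_true, false_and, hc, D.commonEdges_eq hG hF]
    refine Finset.sum_congr rfl fun x _ => ?_
    simp [nA x hG, nB x hF]
  · by_cases hFG : F = G
    · subst hFG
      simp only [if_true, hF, if_false]
      refine (Finset.sum_eq_zero fun x _ => ?_).symm
      -- A crossing where a `B`-face meets itself would contribute to the local sum although `Q(F,
      -- F) = 0`. Such loops of the graph are excluded by `hne`.
      have h1 : ¬ (D.corner x 0 = F ∧ D.corner x 2 = F) := fun h => hne x (h.1.trans h.2.symm)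
      have h2 : ¬ (D.corner x 2 = F ∧ D.corner x 0 = F) := fun h => hne x (h.2.trans h.1.symm)
      simp [nB x hF, h1, h2]
    · simp only [hFG, if_false, hF, hG, and_self, not_false_eq_true, if_true,
        D.commonVertices_eq hne hF hG hFG]
      refine Finset.sum_congr rfl fun x _ => ?_
      simp [nB x hF, nB x hG]

theorem sum_sum_ite_mul (s : D.Region → ℤ) (a b : D.Region) :
    ∑ F, ∑ G, (if a = F ∧ b = G then (1 : ℤ) else 0) * s F * s G = s a * s b := by
  have h : ∀ F G, (if a = F ∧ b = G then (1 : ℤ) else 0) * s F * s G =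
      (if a = F then s F else 0) * (if b = G then s G else 0) := by
    intro F G
    by_cases h1 : a = F <;> by_cases h2 : b = G <;> simp [h1, h2]
  simp only [h, ← Finset.mul_sum, ← Finset.sum_mul, Finset.sum_ite_eq, Finset.mem_univ, if_true]

theorem sum_sum_ite_mul_swap (s : D.Region → ℤ) (a b : D.Region) :
    ∑ F, ∑ G, (if a = G ∧ b = F then (1 : ℤ) else 0) * s F * s G = s b * s a := by
  simp only [and_comm (a := a = _), sum_sum_ite_mul]

theorem twoQ'_eq (hne : ∀ x, D.corner x 0 ≠ D.corner x 2) (s : D.Region → ℤ) :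
    D.twoQ' s = ∑ x, (s (D.corner x 3) * s (D.corner x 3) + s (D.corner x 1) * s (D.corner x 1) +
      2 * (s (D.corner x 0) * s (D.corner x 2)) + 2 * (s (D.corner x 3) * s (D.corner x 0)) +
      2 * (s (D.corner x 1) * s (D.corner x 2))) := by
  unfold twoQ'
  simp only [D.Q_eq_sum hne, Finset.sum_mul]
  have h : ∀ F, ∑ G, ∑ x, ((if D.corner x 3 = F ∧ D.corner x 3 = G then (1 : ℤ) else 0) +
      (if D.corner x 1 = F ∧ D.corner x 1 = G then 1 else 0) +
      ((if D.corner x 0 = F ∧ D.corner x 2 = G then 1 else 0) +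
        if D.corner x 2 = F ∧ D.corner x 0 = G then 1 else 0) +
      ((if D.corner x 3 = F ∧ D.corner x 0 = G then 1 else 0) +
        if D.corner x 1 = F ∧ D.corner x 2 = G then 1 else 0) +
      ((if D.corner x 3 = G ∧ D.corner x 0 = F then 1 else 0) +
        if D.corner x 1 = G ∧ D.corner x 2 = F then 1 else 0)) * s F * s G = _ :=
    fun F => Finset.sum_comm
  simp only [h]
  rw [Finset.sum_comm]
  refine Finset.sum_congr rfl fun x _ => ?_
  simp only [add_mul, Finset.sum_add_distrib, sum_sum_ite_mul, sum_sum_ite_mul_swap]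
  ring

theorem twoL'_eq (s : D.Region → ℤ) :
    D.twoL' s = (∑ x, s (D.corner x 3)) + (∑ x, s (D.corner x 1)) +
      2 * ((∑ F ∈ Finset.univ.filter (fun F => ¬ D.IsA F), s F) -
        ∑ F ∈ Finset.univ.filter (fun F => D.IsA F), s F) := by
  have h : ∀ F, D.twoL F = (∑ x, ((if D.corner x 3 = F then 1 else 0) +
      if D.corner x 1 = F then 1 else 0)) + 2 * ((if ¬ D.IsA F then 1 else 0) -
        if D.IsA F then 1 else 0) := by
    intro F
    unfold twoL
    by_cases hF : D.IsA F
    · simp only [hF, if_true, D.edgeCount_eq hF, not_true, if_false]; ring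
    · have h1 : ∀ x, D.corner x 3 ≠ F := fun x e => hF (e ▸ D.isA_corner_three x)
      have h2 : ∀ x, D.corner x 1 ≠ F := fun x e => hF (e ▸ D.isA_corner_one x)
      simp [hF, h1, h2]
  unfold twoL'
  simp only [h, add_mul, Finset.sum_add_distrib, Finset.sum_mul, mul_assoc, sub_mul, ite_mul,
    one_mul, zero_mul, ← Finset.mul_sum, Finset.sum_sub_distrib, Finset.sum_filter]
  congr 2
  · rw [Finset.sum_comm]; simp
  · rw [Finset.sum_comm]; simp

theorem twoExponent_faceSystem (hne : ∀ x, D.corner x 0 ≠ D.corner x 2) (s : D.Region → ℤ) :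
    D.faceSystem.twoExponent s = D.twoQ' s + D.twoL' s := by
  rw [D.twoQ'_eq hne, D.twoL'_eq]
  simp only [faceSystem, twoExponent, Multiset.map_add, Multiset.map_map, Function.comp_def,
    Multiset.sum_add, Sym2.map_mk, Sym2.mul_mk]
  simp only [← Finset.sum_eq_multiset_sum, Finset.sum_add_distrib, mul_add, ← Finset.mul_sum, mul_one]
  ring

theorem weight_faceSystem (hne : ∀ x, D.corner x 0 ≠ D.corner x 2) (q : ℂ) {s : D.Region → ℤ}
    (hs : ∀ a, 0 ≤ D.edgeValue s a) : D.faceSystem.weight q s = D.term q s := by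
  unfold weight term exponent
  rw [D.twoExponent_faceSystem hne, D.twoL'_eq, prod_arc, zpow_add₀ (by norm_num), zpow_mul]
  simp only [faceSystem, Multiset.map_add, Multiset.map_map, Function.comp_def, Multiset.sum_add,
    Multiset.prod_add]
  simp only [← Finset.sum_eq_multiset_sum, ← Finset.prod_eq_multiset_prod]
  have h0 : ∀ x, qPochInv q (s (D.corner x 3) + s (D.corner x 0)) =
      (qPoch q (D.edgeValue s (D.pd x 0)).toNat)⁻¹ := fun x => by
    rw [← edgeValue_zero, qPochInv, if_pos (hs _)]
  have h2 : ∀ x, qPochInv q (s (D.corner x 1) + s (D.corner x 2)) =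
      (qPoch q (D.edgeValue s (D.pd x 2)).toNat)⁻¹ := fun x => by
    rw [← edgeValue_two, qPochInv, if_pos (hs _)]
  simp only [h0, h2, Finset.prod_inv_distrib]
  -- `2 L'` and the sum of the `A`-variables over all arcs differ by an even number, so the signs
  -- agree.
  have h3 : ((-1 : ℂ) ^ (2 : ℤ)) = 1 := by norm_num
  rw [h3, one_zpow, mul_one, div_eq_mul_inv, mul_inv]

theorem admissible_faceSystem (s : D.Region → ℤ) :
    D.faceSystem.Admissible s ↔ ∀ a, 0 ≤ D.edgeValue s a := by
  constructor
  · intro h a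
    obtain ⟨x | x, rfl⟩ := D.underArc_bijective.2 a
    · show 0 ≤ D.edgeValue s (D.pd x 0)
      rw [edgeValue_zero]
      exact h (D.corner x 3, D.corner x 0) (by
        simp only [faceSystem, Multiset.mem_add, Multiset.mem_map]
        exact Or.inl ⟨x, Finset.mem_univ x, rfl⟩)
    · show 0 ≤ D.edgeValue s (D.pd x 2)
      rw [edgeValue_two]
      exact h (D.corner x 1, D.corner x 2) (by
        simp only [faceSystem, Multiset.mem_add, Multiset.mem_map]
        exact Or.inr ⟨x, Finset.mem_univ x, rfl⟩)
  · intro h p hp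
    simp only [faceSystem, Multiset.mem_add, Multiset.mem_map, Finset.mem_val, Finset.mem_univ,
      true_and] at hp
    rcases hp with ⟨x, rfl⟩ | ⟨x, rfl⟩
    · rw [← edgeValue_zero]; exact h _
    · rw [← edgeValue_two]; exact h _

end AlternatingKnotDiagram

/-! ### Faces and crossings of an assembled graph. -/

section

variable {ι : Type} {f₀ v₀ w₀ : ι}

theorem Cell.pathSystem_faces (f : ι) (xs : List ι) : ∀ w : ι,
    (pathSystem f₀ v₀ f xs w).2.2.1 = xs ∧ (pathSystem f₀ v₀ f xs w).2.2.2 = 0 ∧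
      (pathSystem f₀ v₀ f xs w).2.1.card = xs.length + 1 := by
  induction xs with
  | nil => simp [pathSystem]
  | cons x xs ih =>
    intro w
    obtain ⟨h1, h2, h3⟩ := ih x
    simp [pathSystem, h1, h2, h3, ← Multiset.cons_coe, ← Multiset.singleton_add, add_comm]

theorem Cell.system_faces (c : Cell ι) :
    (c.system f₀ v₀).2.2.1 + (c.system f₀ v₀).2.2.2 = c.vars ∧
      (c.system f₀ v₀).2.1.card = c.rank + 1 := by
  cases c with
  | bigon f u v => simp [system, vars, rank]
  | polygon f w xs =>
    obtain ⟨h1, h2, h3⟩ := pathSystem_faces (f₀ := f₀) (v₀ := v₀) f xs w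
    simp [system, vars, rank, h1, h2, h3, ← Multiset.cons_coe, ← Multiset.singleton_add, add_comm]

/-- This recovers, from an equality of face systems alone, that the variables of the cells enumerate
the faces and that the edges are as many as the crossings. -/
theorem cellSystem_faces (L : List (Cell ι)) :
    (cellSystem f₀ v₀ w₀ L).2.2.1 + (cellSystem f₀ v₀ w₀ L).2.2.2 =
      (f₀ :: v₀ :: cellVars w₀ L : List ι) ∧ (cellSystem f₀ v₀ w₀ L).2.1.card = cellEdges L := by
  induction L with
  | nil =>
    simp [cellSystem, cellVars, cellEdges, ← Multiset.cons_coe, ← Multiset.singleton_add, add_comm]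
  | cons c L ih =>
    obtain ⟨h1, h2⟩ := ih
    obtain ⟨h3, h4⟩ := c.system_faces (f₀ := f₀) (v₀ := v₀)
    constructor
    · have e : (f₀ :: v₀ :: cellVars w₀ (c :: L) : List ι) = (c.vars : Multiset ι) +
          ((f₀ :: v₀ :: cellVars w₀ L : List ι) : Multiset ι) := by
        simp only [cellVars, ← Multiset.cons_coe, ← Multiset.coe_add, ← Multiset.singleton_add]
        abel
      rw [e, ← h1, ← h3]
      simp only [cellSystem, Prod.snd_add, Prod.fst_add]
      abel
    · simp [cellSystem, cellEdges, h2, h4, add_assoc]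

end

/-! ### From an assembly of a diagram to its multisum. -/

namespace AlternatingKnotDiagram

/-- If the `B`-faces, the crossings and the `A`-faces of a diagram form a graph assembled from cells,
the multisum is a product of the series `h_b`. -/
theorem summable_and_Phi_eq (D : AlternatingKnotDiagram) (hne : ∀ x, D.corner x 0 ≠ D.corner x 2)
    {f₀ v₀ w₀ : D.Region} {L : List (Cell D.Region)} (hv : ValidCells v₀ w₀ L)
    (hD : D.faceSystem = cellSystem f₀ v₀ w₀ L) {Fstar : D.Region}
    (hF : f₀ = D.exterior ∧ v₀ = Fstar ∨ f₀ = Fstar ∧ v₀ = D.exterior) {q : ℂ} (hq : ‖q‖ < 1) :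
    Summable (fun s : D.Lam Fstar => D.term q s) ∧
      D.Phi Fstar q = (L.map fun c => hSeries (c.rank + 2) q).prod := by
  obtain ⟨h1, h2⟩ := cellSystem_faces (f₀ := f₀) (v₀ := v₀) (w₀ := w₀) L
  rw [← hD] at h1 h2
  -- The face system of a diagram lists each region once, by colour. Hence the list of variables is
  -- exhaustive and free of repetitions without a separate assumption.
  have huniv : (Finset.univ.val : Multiset D.Region) = (f₀ :: v₀ :: cellVars w₀ L : List D.Region) := by
    rw [← h1, add_comm]
    exact (Multiset.filter_add_not (fun F => D.IsA F) Finset.univ.val).symm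
  have hnd : (f₀ :: v₀ :: cellVars w₀ L).Nodup := by
    rw [← Multiset.coe_nodup, ← huniv]; exact Finset.univ.nodup
  have hmem : ∀ F, F = f₀ ∨ F = v₀ ∨ F ∈ cellVars w₀ L := fun F => by
    have : F ∈ (Finset.univ.val : Multiset D.Region) := Finset.mem_univ F
    rw [huniv] at this
    simpa using this
  have hcard : Fintype.card D.Crossing = cellEdges L := by
    rw [← h2]; simp [faceSystem]
  have hsum := hasSum_weight_cellSystem hq L hv hnd
  rw [← hD] at hsum
  have hz : ∀ s : D.Region → ℤ, s ∈ D.Lam Fstar ↔ s f₀ = 0 ∧ s v₀ = 0 ∧ ∀ a, 0 ≤ D.edgeValue s a := by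
    intro s
    rcases hF with ⟨rfl, rfl⟩ | ⟨rfl, rfl⟩
    · exact Iff.rfl
    · exact ⟨fun h => ⟨h.2.1, h.1, h.2.2⟩, fun h => ⟨h.2.1, h.1, h.2.2⟩⟩
  let φ : D.Lam Fstar → SupportedOn (cellVars w₀ L) := fun s => ⟨s.1, fun i hi => by
    rcases hmem i with rfl | rfl | h
    · exact ((hz s.1).1 s.2).1
    · exact ((hz s.1).1 s.2).2.1
    · exact (hi h).elim⟩
  have hφ : Function.Injective φ := fun s t h => 
    Subtype.ext (congrArg (fun z : SupportedOn (cellVars w₀ L) => z.1) h)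
  simp only [List.nodup_cons, List.mem_cons, not_or] at hnd
  have hsum' : HasSum (fun s : D.Lam Fstar => D.term q s)
      ((qPochInf q)⁻¹ ^ cellEdges L * (L.map fun c => hSeries (c.rank + 2) q).prod) := by
    rw [← hφ.hasSum_iff] at hsum
    · convert hsum using 2 with s
      exact (D.weight_faceSystem hne q ((hz s.1).1 s.2).2.2).symm
    · intro s hs
      refine weight_eq_zero fun h => hs ?_
      exact ⟨⟨s.1, (hz s.1).2 ⟨s.2 _ hnd.1.2, s.2 _ hnd.2.1, (D.admissible_faceSystem s.1).1 h⟩⟩, rfl⟩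
  refine ⟨hsum'.summable, ?_⟩
  rw [Phi, hsum'.tsum_eq, hcard, ← mul_assoc, ← mul_pow, mul_inv_cancel₀ (qPochInf_ne_zero hq),
    one_pow, one_mul]

end AlternatingKnotDiagram

/-! ### Diagrams with finitely many faces -/

instance decidableValidCells {ι : Type} [DecidableEq ι] (v₀ w₀ : ι) :
    (L : List (Cell ι)) → Decidable (ValidCells v₀ w₀ L)
  | [] => .isTrue trivial
  | .bigon _ u v :: L =>
    have := decidableValidCells v₀ w₀ L
    inferInstanceAs (Decidable ((u ∈ v₀ :: cellVerts w₀ L ∧ v ∈ v₀ :: cellVerts w₀ L) ∧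
      ValidCells v₀ w₀ L))
  | .polygon _ w _ :: L =>
    have := decidableValidCells v₀ w₀ L
    inferInstanceAs (Decidable (w ∈ cellVerts w₀ L ∧ ValidCells v₀ w₀ L))

/-- A way to assemble a graph from an edge `v₀ w₀` in the face `f₀` and a list of cells. -/
structure Assembly (ι : Type) where
  f₀ : ι
  v₀ : ι
  w₀ : ι
  cells : List (Cell ι)

namespace AlternatingKnotDiagram

variable (D : AlternatingKnotDiagram)

instance : DecidablePred D.IsBase := fun F => by unfold IsBase; infer_instance

/-- The graph of the `B`-faces of `D` is assembled as described by `a`, starting at the exterior and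
at the face `F`. -/
def IsAssembly (F : D.Region) (a : Assembly D.Region) : Prop :=
  (a.f₀ = D.exterior ∧ a.v₀ = F ∨ a.f₀ = F ∧ a.v₀ = D.exterior) ∧ ValidCells a.v₀ a.w₀ a.cells ∧
    D.faceSystem = cellSystem a.f₀ a.v₀ a.w₀ a.cells

instance (F : D.Region) (a : Assembly D.Region) : Decidable (D.IsAssembly F a) := by
  unfold IsAssembly; infer_instance

theorem prod_hSeries_filter {q : ℂ} (hq : ‖q‖ < 1) (r : List ℕ) :
    ((r.filter (0 < ·)).map fun n => hSeries (n + 2) q).prod =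
      (r.map fun n => hSeries (n + 2) q).prod := by
  induction r with
  | nil => rfl
  | cons n r ih =>
    rcases Nat.eq_zero_or_pos n with rfl | hn
    · simp [ih, hSeries_two hq]
    · simp [hn, ih]

/-- All base faces of `D` admit an assembly of `D` from the list `as`, with cells of the ranks `r`, not
counting bigons. -/
def HasAssemblies (as : List (Assembly D.Region)) (r : List ℕ) : Prop :=
  (∀ x, D.corner x 0 ≠ D.corner x 2) ∧ ∀ F, D.IsBase F →
    ∃ a ∈ as, D.IsAssembly F a ∧ (a.cells.map Cell.rank).filter (0 < ·) = r

instance (as : List (Assembly D.Region)) (r : List ℕ) : Decidable (D.HasAssemblies as r) := by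
  unfold HasAssemblies; infer_instance

/-- All that concerns a particular diagram, including the search for its base faces, is a finite
check on multisets. Bigons are left out of `r` because `h_2 = 1`. -/
theorem phiEq_of_hasAssemblies {as : List (Assembly D.Region)} {r : List ℕ} {f : ℂ → ℂ}
    (h : decide (D.HasAssemblies as r) = true)
    (hf : ∀ q, (r.map fun n => hSeries (n + 2) q).prod = f q) :
    D.PhiEq f := by
  intro F hF q hq
  obtain ⟨a, -, ⟨h1, h2, h3⟩, rfl⟩ := (of_decide_eq_true h).2 F hF
  rw [← hf, prod_hSeries_filter hq, List.map_map]
  exact D.summable_and_Phi_eq (of_decide_eq_true h).1 h2 h3 h1 hq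

end AlternatingKnotDiagram

/-! ### Explicit assemblies of the tabulated diagrams. -/

/-- The base faces are `3` and `4`, each of which borders all three `A`-faces, and there is one
assembly for each. Cells are listed with the one attached last in front. For the diagrams themselves
the exterior `0` is `f₀`; for the mirror images it is `v₀`. -/
theorem phiEq_6_2 : knot_6_2.PhiEq fun q => hSeries 3 q * hSeries 4 q :=
  knot_6_2.phiEq_of_hasAssemblies (as :=
    ([⟨0, 3, 4, [.polygon 1 4 [5], .polygon 2 4 [6, 7]]⟩,
     ⟨0, 4, 3, [.polygon 1 3 [5], .polygon 2 3 [7, 6]]⟩] : List (Assembly (Fin 8))))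
    (r := [1, 2]) (by decide +kernel) fun q => by simp

theorem phiEq_6_2_mirror : knot_6_2.mirror.PhiEq fun q => hSeries 3 q :=
  knot_6_2.mirror.phiEq_of_hasAssemblies (as :=
    ([⟨3, 0, 1, [.bigon 5 0 1, .bigon 6 0 2, .bigon 7 0 2, .polygon 4 1 [2]]⟩,
     ⟨4, 0, 1, [.bigon 5 0 1, .bigon 6 0 2, .bigon 7 0 2, .polygon 3 1 [2]]⟩] :
     List (Assembly (Fin 8))))
    (r := [1]) (by decide +kernel) fun q => by simp

theorem phiEq_6_3 : knot_6_3.PhiEq fun q => hSeries 3 q ^ 2 :=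
  knot_6_3.phiEq_of_hasAssemblies (as :=
    ([⟨0, 6, 4, [.bigon 2 5 6, .polygon 1 4 [5], .polygon 3 4 [7]]⟩] : List (Assembly (Fin 8))))
    (r := [1, 1]) (by decide +kernel) fun q => by simp [pow_succ]

theorem phiEq_6_3_mirror : knot_6_3.mirror.PhiEq fun q => hSeries 3 q ^ 2 :=
  knot_6_3.mirror.phiEq_of_hasAssemblies (as :=
    ([⟨6, 0, 1, [.bigon 7 0 3, .polygon 4 1 [3], .polygon 5 1 [2]]⟩] : List (Assembly (Fin 8))))
    (r := [1, 1]) (by decide +kernel) fun q => by simp [pow_succ]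

theorem phiEq_7_3 : knot_7_3.PhiEq fun q => hSeries 5 q :=
  knot_7_3.phiEq_of_hasAssemblies (as :=
    ([⟨0, 4, 5, [.bigon 1 4 5, .bigon 3 4 5, .polygon 2 5 [6, 7, 8]]⟩,
     ⟨0, 5, 4, [.bigon 1 4 5, .bigon 3 4 5, .polygon 2 4 [8, 7, 6]]⟩] : List (Assembly (Fin 9))))
    (r := [3]) (by decide +kernel) fun q => by simp

theorem phiEq_7_3_mirror : knot_7_3.mirror.PhiEq fun q => hSeries 4 q :=
  knot_7_3.mirror.phiEq_of_hasAssemblies (as :=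
    ([⟨4, 0, 1, [.bigon 6 0 2, .bigon 7 0 2, .bigon 8 0 2, .polygon 5 1 [3, 2]]⟩,
     ⟨5, 0, 1, [.bigon 6 0 2, .bigon 7 0 2, .bigon 8 0 2, .polygon 4 1 [3, 2]]⟩] :
     List (Assembly (Fin 9))))
    (r := [2]) (by decide +kernel) fun q => by simp

theorem phiEq_7_4 : knot_7_4.PhiEq fun q => hSeries 4 q ^ 2 :=
  knot_7_4.phiEq_of_hasAssemblies (as :=
    ([⟨0, 4, 7, [.polygon 1 7 [8, 3], .polygon 2 7 [6, 5]]⟩,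
     ⟨0, 7, 4, [.polygon 1 4 [3, 8], .polygon 2 4 [5, 6]]⟩] : List (Assembly (Fin 9))))
    (r := [2, 2]) (by decide +kernel) fun q => by simp [pow_succ]

theorem phiEq_7_4_mirror : knot_7_4.mirror.PhiEq fun q => hSeries 3 q :=
  knot_7_4.mirror.phiEq_of_hasAssemblies (as :=
    ([⟨4, 0, 1, [.bigon 3 0 1, .bigon 5 0 2, .bigon 6 0 2, .bigon 8 0 1, .polygon 7 1 [2]]⟩,
     ⟨7, 0, 1, [.bigon 3 0 1, .bigon 5 0 2, .bigon 6 0 2, .bigon 8 0 1, .polygon 4 1 [2]]⟩] :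
     List (Assembly (Fin 9))))
    (r := [1]) (by decide +kernel) fun q => by simp

theorem phiEq_7_5 : knot_7_5.PhiEq fun q => hSeries 3 q * hSeries 4 q :=
  knot_7_5.phiEq_of_hasAssemblies (as :=
    ([⟨0, 4, 8, [.bigon 3 4 6, .polygon 1 6 [5], .polygon 2 8 [7, 6]]⟩,
     ⟨0, 6, 7, [.bigon 3 4 6, .polygon 1 4 [5], .polygon 2 7 [8, 4]]⟩] :
     List (Assembly (Fin 9))))
    (r := [1, 2]) (by decide +kernel) fun q => by simp

theorem phiEq_7_5_mirror : knot_7_5.mirror.PhiEq fun q => hSeries 4 q :=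
  knot_7_5.mirror.phiEq_of_hasAssemblies (as :=
    ([⟨4, 0, 1, [.bigon 5 0 1, .bigon 7 0 2, .bigon 8 0 2, .polygon 6 1 [3, 2]]⟩,
     ⟨6, 0, 1, [.bigon 5 0 1, .bigon 7 0 2, .bigon 8 0 2, .polygon 4 1 [3, 2]]⟩] :
     List (Assembly (Fin 9))))
    (r := [2]) (by decide +kernel) fun q => by simp

theorem phiEq_7_6 : knot_7_6.PhiEq fun q => hSeries 3 q * hSeries 4 q :=
  knot_7_6.phiEq_of_hasAssemblies (as :=
    ([⟨0, 4, 5, [.bigon 3 8 4, .polygon 1 5 [6], .polygon 2 5 [7, 8]]⟩] :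
     List (Assembly (Fin 9))))
    (r := [1, 2]) (by decide +kernel) fun q => by simp

theorem phiEq_7_6_mirror : knot_7_6.mirror.PhiEq fun q => hSeries 3 q ^ 2 :=
  knot_7_6.mirror.phiEq_of_hasAssemblies (as :=
    ([⟨4, 0, 2, [.bigon 6 0 1, .bigon 7 0 2, .polygon 5 2 [1], .polygon 8 2 [3]]⟩] :
     List (Assembly (Fin 9))))
    (r := [1, 1]) (by decide +kernel) fun q => by simp [pow_succ]

theorem phiEq_7_7 : knot_7_7.PhiEq fun q => hSeries 3 q ^ 3 :=
  knot_7_7.phiEq_of_hasAssemblies (as :=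
    ([⟨0, 5, 7, [.polygon 1 4 [6], .polygon 2 7 [4], .polygon 3 7 [8]]⟩] :
     List (Assembly (Fin 9))))
    (r := [1, 1, 1]) (by decide +kernel) fun q => by simp [pow_succ, mul_assoc]

theorem phiEq_7_7_mirror : knot_7_7.mirror.PhiEq fun q => hSeries 3 q ^ 2 :=
  knot_7_7.mirror.phiEq_of_hasAssemblies (as :=
    ([⟨5, 0, 3, [.bigon 6 0 1, .bigon 8 0 3, .polygon 4 2 [1], .polygon 7 3 [2]]⟩] :
     List (Assembly (Fin 9))))
    (r := [1, 1]) (by decide +kernel) fun q => by simp [pow_succ]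

theorem phiEq_8_2 : knot_8_2.PhiEq fun q => hSeries 3 q * hSeries 6 q :=
  knot_8_2.phiEq_of_hasAssemblies (as :=
    ([⟨0, 3, 4, [.polygon 1 4 [5], .polygon 2 4 [6, 7, 8, 9]]⟩,
     ⟨0, 4, 3, [.polygon 1 3 [5], .polygon 2 3 [9, 8, 7, 6]]⟩] : List (Assembly (Fin 10))))
    (r := [1, 4]) (by decide +kernel) fun q => by simp

theorem phiEq_8_2_mirror : knot_8_2.mirror.PhiEq fun q => hSeries 3 q :=
  knot_8_2.mirror.phiEq_of_hasAssemblies (as :=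
    ([⟨3, 0, 1, [.bigon 5 0 1, .bigon 6 0 2, .bigon 7 0 2, .bigon 8 0 2, .bigon 9 0 2,
       .polygon 4 1 [2]]⟩,
     ⟨4, 0, 1, [.bigon 5 0 1, .bigon 6 0 2, .bigon 7 0 2, .bigon 8 0 2, .bigon 9 0 2,
       .polygon 3 1 [2]]⟩] : List (Assembly (Fin 10))))
    (r := [1]) (by decide +kernel) fun q => by simp

theorem phiEq_8_3 : knot_8_3.PhiEq fun q => hSeries 5 q :=
  knot_8_3.phiEq_of_hasAssemblies (as :=
    ([⟨0, 6, 5, [.bigon 2 6 7, .bigon 3 6 7, .bigon 4 6 7, .polygon 1 5 [8, 9, 7]]⟩,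
     ⟨0, 7, 6, [.bigon 2 6 7, .bigon 3 6 7, .bigon 4 6 7, .polygon 1 6 [5, 8, 9]]⟩] :
     List (Assembly (Fin 10))))
    (r := [3]) (by decide +kernel) fun q => by simp

theorem phiEq_8_3_mirror : knot_8_3.mirror.PhiEq fun q => hSeries 5 q :=
  knot_8_3.mirror.phiEq_of_hasAssemblies (as :=
    ([⟨6, 0, 1, [.bigon 5 0 1, .bigon 8 0 1, .bigon 9 0 1, .polygon 7 1 [4, 2, 3]]⟩,
     ⟨7, 0, 1, [.bigon 5 0 1, .bigon 8 0 1, .bigon 9 0 1, .polygon 6 1 [4, 2, 3]]⟩] :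
     List (Assembly (Fin 10))))
    (r := [3]) (by decide +kernel) fun q => by simp

theorem phiEq_8_4 : knot_8_4.PhiEq fun q => hSeries 3 q :=
  knot_8_4.phiEq_of_hasAssemblies (as :=
    ([⟨0, 8, 7, [.bigon 1 8 7, .bigon 2 8 9, .bigon 3 8 9, .bigon 5 8 7, .bigon 6 8 7,
       .polygon 4 7 [9]]⟩] : List (Assembly (Fin 10))))
    (r := [1]) (by decide +kernel) fun q => by simp

theorem phiEq_8_4_mirror : knot_8_4.mirror.PhiEq fun q => hSeries 4 q * hSeries 5 q :=
  knot_8_4.mirror.phiEq_of_hasAssemblies (as :=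
    ([⟨8, 0, 4, [.polygon 7 4 [6, 5, 1], .polygon 9 4 [2, 3]]⟩] : List (Assembly (Fin 10))))
    (r := [3, 2]) (by decide +kernel) fun q => by simp [mul_comm]

theorem phiEq_8_5_mirror : knot_8_5.mirror.PhiEq fun q => hSeries 3 q :=
  knot_8_5.mirror.phiEq_of_hasAssemblies (as :=
    ([⟨4, 0, 1, [.bigon 3 0 1, .bigon 5 1 2, .bigon 7 0 1, .bigon 8 0 2, .bigon 9 0 2,
       .polygon 6 1 [2]]⟩,
     ⟨6, 0, 1, [.bigon 3 0 1, .bigon 5 1 2, .bigon 7 0 1, .bigon 8 0 2, .bigon 9 0 2,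
       .polygon 4 1 [2]]⟩] : List (Assembly (Fin 10))))
    (r := [1]) (by decide +kernel) fun q => by simp

/-! ### Cycles and parallel edges -/

section

variable {ι : Type}

/-- A path whose vertices are indexed by consecutive natural numbers, a form suited to induction;
the cyclic indexing enters only when the path is closed up. -/
theorem Cell.pathSystem_range' (f₀ f : ι) (g : ℕ → ι) (k : ℕ) : ∀ a : ℕ,
    pathSystem f₀ (g (a + k + 1)) f ((List.range' (a + 1) k).map g) (g a) =
      ((List.range' (a + 1) k : Multiset ℕ).map (fun i => (f, g i)) +
          (List.range' (a + 1) k : Multiset ℕ).map (fun i => (f₀, g i)),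
        (List.range' a (k + 1) : Multiset ℕ).map (fun i => s(g i, g (i + 1))),
        (List.range' (a + 1) k : Multiset ℕ).map g, 0) := by
  induction k with
  | zero => intro a; simp [pathSystem]
  | succ k ih =>
    intro a
    have h := ih (a + 1)
    rw [List.range'_succ (s := a + 1), List.map_cons, pathSystem,
      show a + (k + 1) + 1 = a + 1 + k + 1 by ring, h, List.range'_succ (s := a)]
    simp only [← Multiset.cons_coe, Prod.mk_add_mk, ← Multiset.singleton_add, Multiset.map_add,
      Multiset.map_singleton, Multiset.insert_eq_cons, add_zero, Prod.mk.injEq, and_true]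
    abel

theorem map_range_eq_univ_val {N : ℕ} [NeZero N] (j : ZMod N) :
    (Multiset.range N).map (fun i : ℕ => j + i) = (Finset.univ : Finset (ZMod N)).val := by
  have hinj : Set.InjOn (fun i : ℕ => j + (i : ZMod N)) (Finset.range N) := by
    intro a ha b hb h
    simp only [Finset.coe_range, Set.mem_Iio] at ha hb
    have h1 : (a : ZMod N) = b := add_left_cancel h
    rw [ZMod.natCast_eq_natCast_iff', Nat.mod_eq_of_lt ha, Nat.mod_eq_of_lt hb] at h1
    exact h1
  rw [← Finset.eq_univ_of_card ((Finset.range N).image fun i : ℕ => j + (i : ZMod N))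
    (by rw [Finset.card_image_of_injOn hinj, Finset.card_range, ZMod.card]),
    Finset.image_val_of_injOn hinj]
  rfl

/-- A cycle of `B`-faces, whose vertices are indexed by `ZMod N`. -/
theorem cellSystem_cycle {N k : ℕ} [NeZero N] (hN : N = k + 2) (f₀ f : ι) (h : ZMod N → ι)
    (j : ZMod N) :
    cellSystem f₀ (h j) (h (j + 1))
        [.polygon f (h (j + 1)) ((List.range' 2 k).map fun i : ℕ => h (j + i))] =
      ((Finset.univ.val.map fun x => (f, h x)) + Finset.univ.val.map fun x => (f₀, h x),
        Finset.univ.val.map fun x => s(h x, h (x + 1)), Finset.univ.val.map h, {f, f₀}) := by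
  have e0 : h j = h (j + (0 : ℕ)) := by simp
  have e1 : h (j + 1) = h (j + (1 : ℕ)) := by simp
  -- The path closes up to a cycle because `k + 2 = N` vanishes in `ZMod N`.
  have e2 : h j = h (j + (1 + k + 1 : ℕ)) := by
    rw [show 1 + k + 1 = N by omega]; simp
  have hp := Cell.pathSystem_range' f₀ f (fun i : ℕ => h (j + i)) k 1
  rw [← e1, ← e2] at hp
  rw [← map_range_eq_univ_val j]
  have hr : Multiset.range N = 0 ::ₘ 1 ::ₘ (List.range' 2 k : Multiset ℕ) := by
    rw [hN, Multiset.range, List.range_eq_range', List.range'_succ, List.range'_succ]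
    rfl
  have hr' : Multiset.range N = 0 ::ₘ (List.range' 1 (k + 1) : Multiset ℕ) := by
    rw [hN, Multiset.range, List.range_eq_range', List.range'_succ]
    rfl
  have he : ∀ i : ℕ, s(h (j + i), h (j + i + 1)) = s(h (j + i), h (j + (i + 1 : ℕ))) := fun i => by
    rw [Nat.cast_succ, add_assoc]
  simp only [cellSystem, Cell.system, hp, Multiset.map_map, Function.comp_def, he]
  simp only [Prod.mk_add_mk, Prod.mk.injEq]
  refine ⟨?_, ?_, ?_, ?_⟩
  · rw [hr]
    simp only [← Multiset.singleton_add, Multiset.map_add, Multiset.map_singleton,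
      Multiset.insert_eq_cons, Nat.cast_zero, Nat.cast_one, add_zero]
    abel
  · rw [hr']
    simp only [← Multiset.singleton_add, Multiset.map_add, Multiset.map_singleton, Nat.cast_zero,
      add_zero, zero_add, Nat.cast_one]
    abel
  · rw [hr]
    simp only [← Multiset.singleton_add, Multiset.map_add, Multiset.map_singleton,
      Multiset.insert_eq_cons, Nat.cast_zero, Nat.cast_one, add_zero, zero_add]
    abel
  · simp only [Multiset.insert_eq_cons, ← Multiset.singleton_add, add_zero]

theorem cellSystem_bigons (f₀ v₀ w₀ u v : ι) (l : List ι) (L : List (Cell ι)) :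
    cellSystem f₀ v₀ w₀ (l.map (fun f => .bigon f u v) ++ L) =
      ((l : Multiset ι).map (fun f => (f, u)) + (l : Multiset ι).map (fun f => (f, v)),
        (l : Multiset ι).map fun _ => s(u, v), 0, (l : Multiset ι)) + cellSystem f₀ v₀ w₀ L := by
  induction l with
  | nil => exact (zero_add _).symm
  | cons f l ih =>
    rw [List.map_cons, List.cons_append, cellSystem, ih, ← add_assoc, Cell.system]
    simp only [← Multiset.cons_coe, Prod.mk_add_mk, ← Multiset.singleton_add, Multiset.map_add,
      Multiset.map_singleton, Multiset.insert_eq_cons, add_zero]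
    congr 2
    abel

theorem cellVerts_bigons (w₀ u v : ι) (l : List ι) (L : List (Cell ι)) :
    cellVerts w₀ (l.map (fun f => .bigon f u v) ++ L) = cellVerts w₀ L := by
  induction l with
  | nil => rfl
  | cons f l ih => simpa [cellVerts, Cell.verts] using ih

theorem validCells_bigons {v₀ w₀ u v : ι} (l : List ι) {L : List (Cell ι)} (h : ValidCells v₀ w₀ L)
    (hu : u ∈ v₀ :: cellVerts w₀ L) (hv : v ∈ v₀ :: cellVerts w₀ L) :
    ValidCells v₀ w₀ (l.map (fun f => .bigon f u v) ++ L) := by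
  induction l with
  | nil => exact h
  | cons f l ih =>
    rw [← cellVerts_bigons w₀ u v l L] at hu hv
    exact ⟨⟨hu, hv⟩, ih⟩

theorem prod_hSeries_bigons {q : ℂ} (hq : ‖q‖ < 1) (u v : ι) (l : List ι) (L : List (Cell ι)) :
    ((l.map (fun f => Cell.bigon f u v) ++ L).map fun c => hSeries (c.rank + 2) q).prod =
      (L.map fun c => hSeries (c.rank + 2) q).prod := by
  simp [Cell.rank, Function.comp_def, hSeries_two hq]

end

namespace AlternatingKnotDiagram

variable (D : AlternatingKnotDiagram)

theorem mirror_isA (F : D.Region) : D.mirror.IsA F ↔ ¬ D.IsA F := by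
  constructor
  · rintro ⟨x, rfl | rfl⟩
    · exact D.not_isA_corner_two x
    · exact D.not_isA_corner_zero x
  · intro h
    obtain ⟨x, k, rfl⟩ := D.corner_surjective F
    have h1 : k ≠ 1 := by rintro rfl; exact h (D.isA_corner_one x)
    have h3 : k ≠ 3 := by rintro rfl; exact h (D.isA_corner_three x)
    have : k = 0 ∨ k = 2 := by clear h; revert k; decide
    rcases this with rfl | rfl
    · exact ⟨x, Or.inr rfl⟩
    · exact ⟨x, Or.inl rfl⟩

/-- The mirror image exchanges the colours, so its graph is the plane dual: `A`-faces become
vertices and `B`-faces become faces. -/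
theorem faceSystem_mirror : D.mirror.faceSystem =
    ((Finset.univ.val.map fun x => (D.corner x 0, D.corner x 1)) +
        Finset.univ.val.map fun x => (D.corner x 2, D.corner x 3),
      Finset.univ.val.map fun x => s(D.corner x 1, D.corner x 3),
      (Finset.univ.filter fun F => D.IsA F).val, (Finset.univ.filter fun F => ¬ D.IsA F).val) := by
  have key : ∀ {p r : D.Region → Prop} {_ : DecidablePred p} {_ : DecidablePred r},
      (∀ F, p F ↔ r F) → (Finset.univ.filter p).val = (Finset.univ.filter r).val :=
    fun h => congrArg Finset.val (Finset.filter_congr fun F _ => h F)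
  exact Prod.ext rfl (Prod.ext rfl (Prod.ext
    (key fun F => (not_congr (D.mirror_isA F)).trans not_not) (key D.mirror_isA)))

theorem commonEdges_pos {F G : D.Region} (hF : D.IsA F) (hG : ¬ D.IsA G) :
    0 < D.commonEdges F G ↔ ∃ x, D.corner x 3 = F ∧ D.corner x 0 = G ∨
      D.corner x 1 = F ∧ D.corner x 2 = G := by
  rw [← Nat.cast_pos (α := ℤ), D.commonEdges_eq hF hG]
  constructor
  · intro h
    obtain ⟨x, -, hx⟩ := Finset.exists_ne_zero_of_sum_ne_zero h.ne'
    refine ⟨x, ?_⟩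
    by_contra hc
    rw [not_or] at hc
    simp [hc] at hx
  · rintro ⟨x, hx⟩
    refine Finset.sum_pos' (fun y _ => by split_ifs <;> norm_num) ⟨x, Finset.mem_univ x, ?_⟩
    rcases hx with h | h
    · rw [if_pos h]; split_ifs <;> norm_num
    · rw [if_pos h]; split_ifs <;> norm_num

end AlternatingKnotDiagram

/-! ### Torus knots -/

theorem torusKnot_isA (p : ℕ) (F : Bool ⊕ ZMod (2 * p + 1)) :
    (torusKnot p).IsA F ↔ ∃ b, F = .inl b := by
  constructor
  · rintro ⟨x, h | h⟩
    · exact ⟨true, h.symm⟩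
    · exact ⟨false, h.symm⟩
  · rintro ⟨_ | _, rfl⟩
    · exact ⟨(0 : ZMod (2 * p + 1)), Or.inr rfl⟩
    · exact ⟨(0 : ZMod (2 * p + 1)), Or.inl rfl⟩

theorem filter_sum_eq_map_inr {α β : Type} [Fintype α] [Fintype β] {P : α ⊕ β → Prop}
    {_ : DecidablePred P} (h : ∀ F, P F ↔ ¬ ∃ a, F = .inl a) :
    (Finset.univ.filter P).val = Finset.univ.val.map Sum.inr := by
  rw [show Finset.univ.filter P = Finset.univ.map .inr from Finset.ext fun F => by
    cases F <;> simp [h], Finset.map_val]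
  rfl

theorem filter_sum_eq_map_inl {α β : Type} [Fintype α] [Fintype β] {P : α ⊕ β → Prop}
    {_ : DecidablePred P} (h : ∀ F, P F ↔ ∃ a, F = .inl a) :
    (Finset.univ.filter P).val = Finset.univ.val.map Sum.inl := by
  rw [show Finset.univ.filter P = Finset.univ.map .inl from Finset.ext fun F => by
    cases F <;> simp [h], Finset.map_val]
  rfl

theorem map_sub_one {N : ℕ} [NeZero N] {β : Type} (h : ZMod N → β) :
    (Finset.univ.val.map fun x : ZMod N => h (x - 1)) = Finset.univ.val.map h := by
  conv_rhs => rw [← Multiset.map_univ_val_equiv (Equiv.subRight (1 : ZMod N)), Multiset.map_map]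
  rfl

theorem map_sub_one_pair {N : ℕ} [NeZero N] {β : Type} (h : ZMod N → β) :
    (Finset.univ.val.map fun x : ZMod N => s(h (x - 1), h x)) =
      Finset.univ.val.map fun x => s(h x, h (x + 1)) := by
  rw [← map_sub_one fun x : ZMod N => s(h x, h (x + 1))]
  simp

theorem torusKnot_faceSystem (p : ℕ) : (torusKnot p).faceSystem =
    (((Finset.univ : Finset (ZMod (2 * p + 1))).val.map fun x => (Sum.inl false, Sum.inr x)) +
        (Finset.univ : Finset (ZMod (2 * p + 1))).val.map fun x => (Sum.inl true, Sum.inr x),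
      (Finset.univ : Finset (ZMod (2 * p + 1))).val.map fun x => s(Sum.inr x, Sum.inr (x + 1)),
      (Finset.univ : Finset (ZMod (2 * p + 1))).val.map Sum.inr, {Sum.inl false, Sum.inl true}) := by
  refine Prod.ext ?_ (Prod.ext ?_ (Prod.ext ?_ ?_))
  · refine congrArg₂ (· + ·) ?_ rfl
    exact map_sub_one fun x : ZMod (2 * p + 1) => ((Sum.inl false : Bool ⊕ ZMod (2 * p + 1)),
      (Sum.inr x : Bool ⊕ ZMod (2 * p + 1)))
  · exact map_sub_one_pair fun x : ZMod (2 * p + 1) => (Sum.inr x : Bool ⊕ ZMod (2 * p + 1))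
  · exact filter_sum_eq_map_inr fun F => not_congr (torusKnot_isA p F)
  · exact (filter_sum_eq_map_inl (torusKnot_isA p)).trans
      (Multiset.pair_comm (Sum.inl true) (Sum.inl false))

theorem torusKnot_mirror_faceSystem (p : ℕ) : (torusKnot p).mirror.faceSystem =
    (((Finset.univ : Finset (ZMod (2 * p + 1))).val.map fun x => (Sum.inr x, Sum.inl true)) +
        (Finset.univ : Finset (ZMod (2 * p + 1))).val.map fun x => (Sum.inr x, Sum.inl false),
      (Finset.univ : Finset (ZMod (2 * p + 1))).val.map fun _ => s(Sum.inl true, Sum.inl false),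
      {Sum.inl true, Sum.inl false}, (Finset.univ : Finset (ZMod (2 * p + 1))).val.map Sum.inr) := by
  rw [AlternatingKnotDiagram.faceSystem_mirror]
  refine Prod.ext ?_ (Prod.ext rfl (Prod.ext ?_ ?_))
  · refine congrArg₂ (· + ·) ?_ rfl
    exact map_sub_one fun x : ZMod (2 * p + 1) => ((Sum.inr x : Bool ⊕ ZMod (2 * p + 1)),
      (Sum.inl true : Bool ⊕ ZMod (2 * p + 1)))
  · exact filter_sum_eq_map_inl (torusKnot_isA p)
  · exact filter_sum_eq_map_inr fun F => not_congr (torusKnot_isA p F)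

theorem torusKnot_one_ne_zero {p : ℕ} (hp : 0 < p) : (1 : ZMod (2 * p + 1)) ≠ 0 := by
  have : Fact (1 < 2 * p + 1) := ⟨by omega⟩
  exact one_ne_zero

/-- The `B`-faces form a cycle of length `2 p + 1`. Starting from any of its edges it is completed
by one polygon with `2 p - 1` new vertices. -/
theorem phiEq_torusKnot {p : ℕ} (hp : 0 < p) :
    (torusKnot p).PhiEq fun q => hSeries (2 * p + 1) q := by
  rintro (b | j) hF q hq
  · exact absurd (iff_of_true ((torusKnot_isA p _).2 ⟨b, rfl⟩) ((torusKnot_isA p _).2 ⟨true, rfl⟩)) hF.1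
  · have hD := cellSystem_cycle (k := 2 * p - 1) (by omega) (Sum.inl true : Bool ⊕ ZMod (2 * p + 1))
      (Sum.inl false) Sum.inr j
    set xs := (List.range' 2 (2 * p - 1)).map fun i : ℕ =>
      (Sum.inr (j + i) : Bool ⊕ ZMod (2 * p + 1)) with hxs
    have hv : ValidCells (Sum.inr j : Bool ⊕ ZMod (2 * p + 1)) (Sum.inr (j + 1))
        [.polygon (Sum.inl false) (Sum.inr (j + 1)) xs] := ⟨List.mem_singleton_self _, trivial⟩
    have hr : hSeries (xs.length + 2) q * 1 = hSeries (2 * p + 1) q := by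
      rw [hxs, List.length_map, List.length_range', mul_one, show 2 * p - 1 + 2 = 2 * p + 1 by omega]
    have := (torusKnot p).summable_and_Phi_eq
      (fun x h => torusKnot_one_ne_zero hp (sub_eq_self.1 (Sum.inr_injective h))) hv
      ((torusKnot_faceSystem p).trans hD.symm) (Or.inl ⟨rfl, rfl⟩) hq
    exact ⟨this.1, this.2.trans hr⟩

theorem univ_val_eq_erase_toList {α : Type} [Fintype α] [DecidableEq α] (j : α) :
    (Finset.univ : Finset α).val = ((Finset.univ.erase j).toList : Multiset α) + {j} := by
  rw [Finset.coe_toList, Finset.erase_val, add_comm, Multiset.singleton_add,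
    Multiset.cons_erase (Finset.mem_univ_val j)]

/-- The dual of the cycle: two vertices joined by `2 p + 1` parallel edges, that is, an edge with `2
p` bigons attached. All factors are `h_2 = 1`. -/
theorem phiEq_torusKnot_mirror (p : ℕ) : (torusKnot p).mirror.PhiEq fun _ => 1 := by
  rintro (b | j) hF q hq
  · refine absurd (iff_of_false ?_ ?_) hF.1
    · exact fun h => ((torusKnot p).mirror_isA _).1 h ((torusKnot_isA p _).2 ⟨b, rfl⟩)
    · exact fun h => ((torusKnot p).mirror_isA _).1 h ((torusKnot_isA p _).2 ⟨true, rfl⟩)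
  · set l := (Finset.univ.erase j).toList
    have hD := cellSystem_bigons (Sum.inr j) (Sum.inl true) (Sum.inl false)
      (Sum.inl true : Bool ⊕ ZMod (2 * p + 1)) (Sum.inl false) (l.map Sum.inr) []
    have hv := validCells_bigons (v₀ := (Sum.inl true : Bool ⊕ ZMod (2 * p + 1)))
      (w₀ := Sum.inl false) (l.map Sum.inr) (L := []) trivial (List.mem_cons_self)
      (List.mem_cons_of_mem _ (List.mem_singleton_self _))
    have := (torusKnot p).mirror.summable_and_Phi_eq
      (fun x h => absurd (Sum.inl_injective h) (by decide)) hv (Eq.trans ?_ hD.symm) (Or.inr ⟨rfl, rfl⟩) hq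
    · exact ⟨this.1, this.2.trans (prod_hSeries_bigons hq _ _ _ [])⟩
    · rw [torusKnot_mirror_faceSystem, univ_val_eq_erase_toList j, cellSystem, ← Multiset.map_coe]
      simp only [Multiset.map_add, Multiset.map_map, Function.comp_def, Prod.mk_add_mk,
        Multiset.map_singleton, zero_add, Multiset.insert_eq_cons, ← Multiset.singleton_add]
      refine Prod.ext ?_ rfl
      dsimp only
      abel

/-! ### Twist knots -/

theorem twistDiagram_isA (m : ℕ) (F : Fin 3 ⊕ Fin (m + 1)) :
    (twistDiagram m).IsA F ↔ ∃ b, F = .inl b := by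
  constructor
  · rintro ⟨x | _ | _, h | h⟩
    exacts [⟨0, h.symm⟩, ⟨1, h.symm⟩, ⟨2, h.symm⟩, ⟨1, h.symm⟩, ⟨0, h.symm⟩, ⟨2, h.symm⟩]
  · rintro ⟨b, rfl⟩
    fin_cases b
    · exact ⟨.inr true, Or.inl rfl⟩
    · exact ⟨.inr false, Or.inr rfl⟩
    · exact ⟨.inr true, Or.inr rfl⟩

theorem map_univ_crossing {m : ℕ} {β : Type} (g : Fin m ⊕ Bool → β) :
    (Finset.univ : Finset (Fin m ⊕ Bool)).val.map g =
      (Finset.univ : Finset (Fin m)).val.map (fun x => g (.inl x)) +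
        ({g (.inr true)} + {g (.inr false)}) := by
  rw [show (Finset.univ : Finset (Fin m ⊕ Bool)).val = Finset.univ.val.map Sum.inl +
    Finset.univ.val.map Sum.inr from rfl, Multiset.map_add, Multiset.map_map, Multiset.map_map]
  rfl

theorem map_univ_fin_succ {m : ℕ} {β : Type} (g : Fin (m + 1) → β) :
    (Finset.univ : Finset (Fin (m + 1))).val.map g =
      (Finset.univ : Finset (Fin m)).val.map (fun x => g x.succ) + {g 0} := by
  rw [Fin.univ_succ, Finset.cons_val, Finset.map_val, Multiset.map_cons, Multiset.map_map,
    add_comm (Multiset.map _ _), Multiset.singleton_add]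
  rfl

theorem map_univ_fin_castSucc {m : ℕ} {β : Type} (g : Fin (m + 1) → β) :
    (Finset.univ : Finset (Fin (m + 1))).val.map g =
      (Finset.univ : Finset (Fin m)).val.map (fun x => g x.castSucc) + {g (Fin.last m)} := by
  rw [Fin.univ_castSuccEmb, Finset.cons_val, Finset.map_val, Multiset.map_cons, Multiset.map_map,
    add_comm (Multiset.map _ _), Multiset.singleton_add]
  rfl

/-- The clasp doubles one edge of a cycle of `m + 1` vertices. The system of a bigon does not
involve `f₀` and `v₀`, so these are arbitrary here. -/
theorem twistDiagram_faceSystem (m : ℕ) (f₀ v₀ : Fin 3 ⊕ Fin (m + 1)) : (twistDiagram m).faceSystem =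
    Cell.system f₀ v₀ (.bigon (Sum.inl 2) (Sum.inr (Fin.last m)) (Sum.inr 0)) +
    (((Finset.univ : Finset (Fin (m + 1))).val.map fun x => (Sum.inl 1, Sum.inr x)) +
        (Finset.univ : Finset (Fin (m + 1))).val.map fun x => (Sum.inl 0, Sum.inr x),
      (Finset.univ : Finset (Fin (m + 1))).val.map fun x => s(Sum.inr x, Sum.inr (x + 1)),
      (Finset.univ : Finset (Fin (m + 1))).val.map Sum.inr, {Sum.inl 1, Sum.inl 0}) := by
  refine Prod.ext ?_ (Prod.ext ?_ (Prod.ext ?_ ?_))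
  · refine (congrArg₂ (· + ·) (map_univ_crossing _) (map_univ_crossing _)).trans ?_
    simp only [Cell.system]
    rw [map_univ_fin_castSucc fun x : Fin (m + 1) => ((Sum.inl 1 : Fin 3 ⊕ Fin (m + 1)),
        (Sum.inr x : Fin 3 ⊕ Fin (m + 1))),
      map_univ_fin_succ fun x : Fin (m + 1) => ((Sum.inl 0 : Fin 3 ⊕ Fin (m + 1)),
        (Sum.inr x : Fin 3 ⊕ Fin (m + 1)))]
    have key : ∀ M N a b c d : Multiset ((Fin 3 ⊕ Fin (m + 1)) × (Fin 3 ⊕ Fin (m + 1))),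
        M + (a + b) + (N + (c + d)) = a + d + (M + b + (N + c)) := by intros; abel
    exact key _ _ _ _ _ _
  · refine (map_univ_crossing _).trans ?_
    simp only [Cell.system]
    rw [map_univ_fin_castSucc fun x : Fin (m + 1) => s((Sum.inr x : Fin 3 ⊕ Fin (m + 1)),
        (Sum.inr (x + 1) : Fin 3 ⊕ Fin (m + 1)))]
    simp only [Fin.coeSucc_eq_succ, Fin.last_add_one]
    dsimp [twistDiagram, twistCorner]
    simp only [← Multiset.singleton_add]
    abel
  · refine (filter_sum_eq_map_inr fun F => not_congr (twistDiagram_isA m F)).trans ?_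
    exact (zero_add _).symm
  · refine (filter_sum_eq_map_inl (twistDiagram_isA m)).trans ?_
    show (([Sum.inl 0, Sum.inl 1, Sum.inl 2] : List (Fin 3 ⊕ Fin (m + 1))) :
        Multiset (Fin 3 ⊕ Fin (m + 1))) =
      (([Sum.inl 2, Sum.inl 1, Sum.inl 0] : List (Fin 3 ⊕ Fin (m + 1))) :
        Multiset (Fin 3 ⊕ Fin (m + 1)))
    exact Multiset.coe_eq_coe.2 (List.reverse_perm [Sum.inl 2, Sum.inl 1, Sum.inl 0])

theorem twistDiagram_mirror_faceSystem (m : ℕ) : (twistDiagram m).mirror.faceSystem =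
    (((Finset.univ : Finset (Fin (m + 1))).val.map fun x => (Sum.inr x, Sum.inl 0)) +
        ((Finset.univ : Finset (Fin (m + 1))).val.map fun x => (Sum.inr x, Sum.inl 1)) +
        {(Sum.inr 0, Sum.inl 2), (Sum.inr (Fin.last m), Sum.inl 2)},
      ((Finset.univ : Finset (Fin m)).val.map fun _ => s(Sum.inl 0, Sum.inl 1)) +
        {s(Sum.inl 2, Sum.inl 0), s(Sum.inl 1, Sum.inl 2)},
      {Sum.inl 0, Sum.inl 1, Sum.inl 2}, (Finset.univ : Finset (Fin (m + 1))).val.map Sum.inr) := by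
  rw [AlternatingKnotDiagram.faceSystem_mirror]
  refine Prod.ext ?_ (Prod.ext ?_ (Prod.ext ?_ ?_))
  · refine (congrArg₂ (· + ·) (map_univ_crossing _) (map_univ_crossing _)).trans ?_
    rw [map_univ_fin_castSucc fun x : Fin (m + 1) => ((Sum.inr x : Fin 3 ⊕ Fin (m + 1)),
        (Sum.inl 0 : Fin 3 ⊕ Fin (m + 1))),
      map_univ_fin_succ fun x : Fin (m + 1) => ((Sum.inr x : Fin 3 ⊕ Fin (m + 1)),
        (Sum.inl 1 : Fin 3 ⊕ Fin (m + 1)))]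
    have key : ∀ M N a b c d : Multiset ((Fin 3 ⊕ Fin (m + 1)) × (Fin 3 ⊕ Fin (m + 1))),
        M + (a + b) + (N + (c + d)) = M + a + (N + d) + (c + b) := by intros; abel
    exact key _ _ _ _ _ _
  · refine (map_univ_crossing _).trans ?_
    dsimp [twistDiagram, twistCorner]
    rw [Sym2.eq_swap (a := Sum.inl 0) (b := Sum.inl 2), Sym2.eq_swap (a := Sum.inl 2) (b := Sum.inl 1)]
    rfl
  · exact filter_sum_eq_map_inl (twistDiagram_isA m)
  · exact filter_sum_eq_map_inr fun F => not_congr (twistDiagram_isA m F)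

theorem phiEq_twistDiagram {m : ℕ} (hm : 0 < m) :
    (twistDiagram m).PhiEq fun q => hSeries (m + 1) q := by
  rintro (b | j) hF q hq
  · exact absurd (iff_of_true ((twistDiagram_isA m _).2 ⟨b, rfl⟩) ((twistDiagram_isA m _).2 ⟨0, rfl⟩))
      hF.1
  · let ι := Fin 3 ⊕ Fin (m + 1)
    -- `ZMod (m + 1)` is `Fin (m + 1)` by definition, so the statement about cycles applies.
    let h : ZMod (m + 1) → ι := fun i => Sum.inr i
    let j' : ZMod (m + 1) := j
    have hD := cellSystem_cycle (k := m - 1) (by omega) (Sum.inl 0 : ι) (Sum.inl 1) h j'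
    set xs := (List.range' 2 (m - 1)).map fun i : ℕ => h (j' + i) with hxs
    -- The doubled edge may lie anywhere relative to the base vertex. That its ends are already
    -- present is read off from the vertex component of `hD`, which contains all the vertices.
    have hmem : ∀ i, h i ∈ h j' :: cellVerts (h (j' + 1))
        [.polygon (Sum.inl 1) (h (j' + 1)) xs] := by
      intro i
      have h1 : h i ∈ (cellSystem (Sum.inl 0) (h j') (h (j' + 1))
          [.polygon (Sum.inl 1) (h (j' + 1)) xs]).2.2.1 := by
        rw [hD]
        exact Multiset.mem_map_of_mem h (Finset.mem_univ_val i)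
      have h2 := (Cell.pathSystem_faces (f₀ := Sum.inl 0) (v₀ := h j') (Sum.inl 1) xs (h (j' + 1))).1
      simp only [cellSystem, Cell.system, Prod.snd_add, Prod.fst_add, h2] at h1
      simp only [cellVerts, Cell.verts]
      simpa [or_comm, or_left_comm, or_assoc] using h1
    have hv : ValidCells (h j') (h (j' + 1))
        [.bigon (Sum.inl 2) (h (Fin.last m)) (h 0), .polygon (Sum.inl 1) (h (j' + 1)) xs] :=
      ⟨⟨hmem _, hmem _⟩, List.mem_singleton_self _, trivial⟩
    have hr : hSeries (0 + 2) q * (hSeries (xs.length + 2) q * 1) = hSeries (m + 1) q := by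
      rw [hxs, List.length_map, List.length_range', mul_one, show m - 1 + 2 = m + 1 by omega,
        zero_add, hSeries_two hq, one_mul]
    have := (twistDiagram m).summable_and_Phi_eq (fun x h => ?_) hv
      ((twistDiagram_faceSystem m _ _).trans (congrArg₂ (· + ·) rfl hD.symm)) (Or.inl ⟨rfl, rfl⟩) hq
    · exact ⟨this.1, this.2.trans hr⟩
    · have h0 : Fin.last m ≠ 0 := by
        rw [Ne, Fin.ext_iff]; exact hm.ne'
      rcases x with x | _ | _
      · exact x.castSucc_lt_succ.ne (Sum.inr_injective h)
      · exact h0 (Sum.inr_injective h)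
      · exact h0 (Sum.inr_injective h)

theorem twistDiagram_mirror_isA (m : ℕ) (F : Fin 3 ⊕ Fin (m + 1)) :
    (twistDiagram m).mirror.IsA F ↔ ¬ ∃ b, F = .inl b :=
  ((twistDiagram m).mirror_isA F).trans (not_congr (twistDiagram_isA m F))

theorem twistDiagram_mirror_commonEdges_pos (m : ℕ) (i : Fin (m + 1)) (b : Fin 3) :
    0 < (twistDiagram m).mirror.commonEdges (.inr i : Fin 3 ⊕ Fin (m + 1)) (.inl b) ↔
      ∃ x, twistCorner m x 0 = .inr i ∧ twistCorner m x 1 = .inl b ∨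
        twistCorner m x 2 = .inr i ∧ twistCorner m x 3 = .inl b :=
  (twistDiagram m).mirror.commonEdges_pos ((twistDiagram_mirror_isA m _).2 (by simp))
    (fun h => (twistDiagram_mirror_isA m _).1 h ⟨b, rfl⟩)

theorem twistDiagram_mirror_neighbours (m : ℕ) (i : Fin (m + 1)) :
    (twistDiagram m).mirror.neighbours (.inr i : Fin 3 ⊕ Fin (m + 1)) =
      (Finset.univ.filter fun b : Fin 3 => ∃ x, twistCorner m x 0 = .inr i ∧
        twistCorner m x 1 = .inl b ∨ twistCorner m x 2 = .inr i ∧ twistCorner m x 3 = .inl b).card := by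
  have h0 : ¬ (twistDiagram m).mirror.IsA (twistDiagram m).mirror.exterior :=
    fun h => (twistDiagram_mirror_isA m _).1 h ⟨0, rfl⟩
  refine Eq.trans ?_ (Finset.card_map (Function.Embedding.inl : Fin 3 ↪ Fin 3 ⊕ Fin (m + 1)))
  refine congrArg Finset.card (Finset.ext fun G => ?_)
  refine Finset.mem_filter.trans (Iff.trans ?_ Finset.mem_map.symm)
  constructor
  · rintro ⟨-, h1, h2⟩
    have h3 := fun h => h0 (h1.1 h)
    rcases G with b | G
    · exact ⟨b, Finset.mem_filter.2 ⟨Finset.mem_univ b,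
        (twistDiagram_mirror_commonEdges_pos m i b).1 h2⟩, rfl⟩
    · exact absurd ((twistDiagram_mirror_isA m _).2 (by simp)) h3
  · rintro ⟨b, hb, rfl⟩
    refine ⟨Finset.mem_univ _, iff_of_false (fun h => (twistDiagram_mirror_isA m _).1 h ⟨b, rfl⟩) h0,
      (twistDiagram_mirror_commonEdges_pos m i b).2 (Finset.mem_filter.1 hb).2⟩

/-- The base faces of the mirror image of a twist knot are those at the clasp. -/
theorem twistDiagram_mirror_base {m : ℕ} (hm : 0 < m) {F : Fin 3 ⊕ Fin (m + 1)}
    (hF : (twistDiagram m).mirror.IsBase F) : F = .inr 0 ∨ F = .inr (Fin.last m) := by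
  obtain ⟨h1, h2⟩ := hF
  have h0 : ¬ (twistDiagram m).mirror.IsA (twistDiagram m).mirror.exterior :=
    fun h => (twistDiagram_mirror_isA m _).1 h ⟨0, rfl⟩
  rcases F with b | i
  · exact absurd (iff_of_false (fun h => (twistDiagram_mirror_isA m _).1 h ⟨b, rfl⟩) h0) h1
  · by_contra hi
    have hi0 : i ≠ 0 := fun h => hi (Or.inl (congrArg _ h))
    have hil : i ≠ Fin.last m := fun h => hi (Or.inr (congrArg _ h))
    have hle : (twistDiagram m).mirror.neighbours (.inr (0 : Fin (m + 1)) : Fin 3 ⊕ Fin (m + 1)) ≤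
        (twistDiagram m).mirror.neighbours (.inr i : Fin 3 ⊕ Fin (m + 1)) := by
      rcases h2 (.inr (0 : Fin (m + 1)) : Fin 3 ⊕ Fin (m + 1))
        (fun h => h0 (h.1 ((twistDiagram_mirror_isA m _).2 (by simp)))) with h | h
      · exact h.le
      · exact h.1.le
    rw [twistDiagram_mirror_neighbours, twistDiagram_mirror_neighbours] at hle
    -- The face `inr 0` at the clasp borders all three faces `inl b`, whereas a face away from the
    -- clasp misses the bigon `inl 2`. So the maximal number of neighbours forces `F*` to lie at the
    -- clasp.
    have h3 : (Finset.univ.filter fun b : Fin 3 => ∃ x, twistCorner m x 0 = .inr 0 ∧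
        twistCorner m x 1 = .inl b ∨ twistCorner m x 2 = .inr 0 ∧ twistCorner m x 3 = .inl b) =
          Finset.univ := by
      refine Finset.filter_true_of_mem fun b _ => ?_
      fin_cases b
      · exact ⟨.inl ⟨0, hm⟩, Or.inl ⟨rfl, rfl⟩⟩
      · exact ⟨.inr false, Or.inr ⟨rfl, rfl⟩⟩
      · exact ⟨.inr true, Or.inr ⟨rfl, rfl⟩⟩
    have h4 : (Finset.univ.filter fun b : Fin 3 => ∃ x, twistCorner m x 0 = .inr i ∧
        twistCorner m x 1 = .inl b ∨ twistCorner m x 2 = .inr i ∧ twistCorner m x 3 = .inl b) ⊆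
          {0, 1} := by
      intro b hb
      obtain ⟨x | _ | _, ⟨h, h'⟩ | ⟨h, h'⟩⟩ := (Finset.mem_filter.1 hb).2
      · simp [← Sum.inl_injective h']
      · simp [← Sum.inl_injective h']
      · exact absurd (Sum.inr_injective h).symm hil
      · exact absurd (Sum.inr_injective h).symm hi0
      · exact absurd (Sum.inr_injective h).symm hil
      · exact absurd (Sum.inr_injective h).symm hi0
    have h5 := Finset.card_le_card h4
    rw [h3] at hle
    exact absurd (hle.trans h5) (by decide)

/-- Here `inl 0` and `inl 1` are joined by `m` parallel edges and by a path through `inl 2`. With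
`F*` at the clasp as `f₀`, the other face at the clasp is a triangle on the initial edge with the
one new vertex `inl 2`; the other `m - 1` parallel edges are bigons. Only the triangle contributes,
by `h_3`. -/
theorem phiEq_twistDiagram_mirror {m : ℕ} (hm : 0 < m) :
    (twistDiagram m).mirror.PhiEq fun q => hSeries 3 q := by
  have h0 : Fin.last m ≠ 0 := by
    rw [Ne, Fin.ext_iff]; exact hm.ne'
  let ι := Fin 3 ⊕ Fin (m + 1)
  have key : ∀ a b : Fin (m + 1), a ≠ b →
      ({((.inr 0 : ι), (.inl 2 : ι)), (.inr (Fin.last m), .inl 2)} : Multiset (ι × ι)) =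
        {(.inr b, .inl 2), (.inr a, .inl 2)} → ∀ q : ℂ, ‖q‖ < 1 →
      Summable (fun s : (twistDiagram m).mirror.Lam (.inr a : ι) => (twistDiagram m).mirror.term q s) ∧
        (twistDiagram m).mirror.Phi (.inr a : ι) q = hSeries 3 q := by
    intro a b hab hl q hq
    obtain ⟨l, hu⟩ : ∃ l : List (Fin (m + 1)),
        (Finset.univ : Finset (Fin (m + 1))).val = (l : Multiset (Fin (m + 1))) + {b} + {a} := by
      refine ⟨((Finset.univ.erase a).erase b).toList, ?_⟩
      rw [univ_val_eq_erase_toList a, Finset.coe_toList, Finset.coe_toList, Finset.erase_val (s := _)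
        (a := b), add_comm (Multiset.erase _ b), Multiset.singleton_add, Multiset.cons_erase]
      exact Finset.mem_erase.2 ⟨hab.symm, Finset.mem_univ b⟩
    have hcard : m = l.length + 1 := by
      have := congrArg Multiset.card hu
      simpa using this
    have hu' : ((Finset.univ : Finset (Fin m)).val.map fun _ => s((.inl 0 : ι), .inl 1)) =
        ((l : Multiset (Fin (m + 1))).map fun _ => s((.inl 0 : ι), .inl 1)) +
          {s((.inl 0 : ι), .inl 1)} := by
      simp only [Multiset.map_const', Finset.card_val, Finset.card_univ, Fintype.card_fin,
        Multiset.coe_card]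
      exact (congrArg (Multiset.replicate · _) hcard).trans (Multiset.replicate_add _ 1 _)
    have hD := cellSystem_bigons (.inr a) (.inl 0) (.inl 1) (.inl 0 : ι) (.inl 1) (l.map Sum.inr)
      [.polygon (.inr b) (.inl 1) [.inl 2]]
    have hv := validCells_bigons (v₀ := (.inl 0 : ι)) (w₀ := .inl 1) (u := .inl 0) (v := .inl 1)
      (l.map Sum.inr) (L := [.polygon (.inr b) (.inl 1) [.inl 2]])
      ⟨List.mem_singleton_self _, trivial⟩ List.mem_cons_self (by simp [cellVerts])
    have := (twistDiagram m).mirror.summable_and_Phi_eq (fun x h => ?_) hv (Eq.trans ?_ hD.symm)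
      (Or.inr ⟨rfl, rfl⟩) hq
    · refine ⟨this.1, this.2.trans ((prod_hSeries_bigons hq _ _ _ _).trans ?_)⟩
      exact mul_one (hSeries 3 q)
    · rcases x with x | _ | _
      all_goals exact absurd (Sum.inl_injective h) (by decide)
    · rw [twistDiagram_mirror_faceSystem, hl, hu, hu', cellSystem, cellSystem, Cell.system,
        Cell.pathSystem, Cell.pathSystem, ← Multiset.map_coe]
      simp only [Multiset.map_add, Multiset.map_map, Function.comp_def, Prod.mk_add_mk,
        Multiset.map_singleton, zero_add, add_zero, Multiset.insert_eq_cons,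
        ← Multiset.singleton_add]
      refine Prod.ext ?_ (Prod.ext ?_ (Prod.ext ?_ ?_)) <;> dsimp only
      · abel
      · abel
      · exact Multiset.add_comm ({.inl 0, .inl 1} : Multiset ι) {.inl 2}
      · abel
  intro F hF q hq
  rcases twistDiagram_mirror_base hm hF with rfl | rfl
  · exact key 0 (Fin.last m) h0.symm (Multiset.pair_comm _ _) q hq
  · exact key (Fin.last m) 0 h0 rfl q hq

theorem phiEq_twistKnot_of_pos {p : ℤ} (hp : 0 < p) :
    (twistKnot p).PhiEq (fun q => hSeries (2 * p.natAbs) q) ∧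
      (twistKnot p).mirror.PhiEq (fun q => hSeries 3 q) := by
  have hm : 0 < 2 * p.natAbs - 1 := by omega
  have h := phiEq_twistDiagram hm
  rw [show 2 * p.natAbs - 1 + 1 = 2 * p.natAbs by omega] at h
  rw [twistKnot, if_pos hp]
  exact ⟨h, phiEq_twistDiagram_mirror hm⟩

theorem phiEq_twistKnot_of_neg {p : ℤ} (hp : p < 0) :
    (twistKnot p).PhiEq (fun q => hSeries (2 * p.natAbs + 1) q) ∧
      (twistKnot p).mirror.PhiEq (fun q => hSeries 3 q) := by
  have hm : 0 < 2 * p.natAbs := by omega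
  rw [twistKnot, if_neg hp.not_gt]
  exact ⟨phiEq_twistDiagram hm, phiEq_twistDiagram_mirror hm⟩

end

theorem theorem1p1 :
    knot_3_1.PhiEq (fun q => hSeries 3 q) ∧ knot_3_1.mirror.PhiEq (fun _ => 1) ∧
    knot_4_1.PhiEq (fun q => hSeries 3 q) ∧ knot_4_1.mirror.PhiEq (fun q => hSeries 3 q) ∧
    knot_5_1.PhiEq (fun q => hSeries 5 q) ∧ knot_5_1.mirror.PhiEq (fun _ => 1) ∧
    knot_5_2.PhiEq (fun q => hSeries 4 q) ∧ knot_5_2.mirror.PhiEq (fun q => hSeries 3 q) ∧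
    knot_6_1.PhiEq (fun q => hSeries 5 q) ∧ knot_6_1.mirror.PhiEq (fun q => hSeries 3 q) ∧
    knot_6_2.PhiEq (fun q => hSeries 3 q * hSeries 4 q) ∧
    knot_6_2.mirror.PhiEq (fun q => hSeries 3 q) ∧
    knot_6_3.PhiEq (fun q => hSeries 3 q ^ 2) ∧ knot_6_3.mirror.PhiEq (fun q => hSeries 3 q ^ 2) ∧
    knot_7_1.PhiEq (fun q => hSeries 7 q) ∧ knot_7_1.mirror.PhiEq (fun _ => 1) ∧
    knot_7_2.PhiEq (fun q => hSeries 6 q) ∧ knot_7_2.mirror.PhiEq (fun q => hSeries 3 q) ∧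
    knot_7_3.PhiEq (fun q => hSeries 5 q) ∧ knot_7_3.mirror.PhiEq (fun q => hSeries 4 q) ∧
    knot_7_4.PhiEq (fun q => hSeries 4 q ^ 2) ∧ knot_7_4.mirror.PhiEq (fun q => hSeries 3 q) ∧
    knot_7_5.PhiEq (fun q => hSeries 3 q * hSeries 4 q) ∧
    knot_7_5.mirror.PhiEq (fun q => hSeries 4 q) ∧
    knot_7_6.PhiEq (fun q => hSeries 3 q * hSeries 4 q) ∧
    knot_7_6.mirror.PhiEq (fun q => hSeries 3 q ^ 2) ∧
    knot_7_7.PhiEq (fun q => hSeries 3 q ^ 3) ∧ knot_7_7.mirror.PhiEq (fun q => hSeries 3 q ^ 2) ∧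
    knot_8_1.PhiEq (fun q => hSeries 7 q) ∧ knot_8_1.mirror.PhiEq (fun q => hSeries 3 q) ∧
    knot_8_2.PhiEq (fun q => hSeries 3 q * hSeries 6 q) ∧
    knot_8_2.mirror.PhiEq (fun q => hSeries 3 q) ∧
    knot_8_3.PhiEq (fun q => hSeries 5 q) ∧ knot_8_3.mirror.PhiEq (fun q => hSeries 5 q) ∧
    knot_8_4.PhiEq (fun q => hSeries 3 q) ∧
    knot_8_4.mirror.PhiEq (fun q => hSeries 4 q * hSeries 5 q) ∧
    knot_8_5.mirror.PhiEq (fun q => hSeries 3 q) ∧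
    (∀ p : ℤ, 0 < p → (twistKnot p).PhiEq (fun q => hSeries (2 * p.natAbs) q) ∧
      (twistKnot p).mirror.PhiEq (fun q => hSeries 3 q)) ∧
    (∀ p : ℤ, p < 0 → (twistKnot p).PhiEq (fun q => hSeries (2 * p.natAbs + 1) q) ∧
      (twistKnot p).mirror.PhiEq (fun q => hSeries 3 q)) ∧
    (∀ p : ℕ, 0 < p → (torusKnot p).PhiEq (fun q => hSeries (2 * p + 1) q) ∧
      (torusKnot p).mirror.PhiEq (fun _ => 1)) := by
  exact ⟨phiEq_torusKnot (p := 1) (by norm_num), phiEq_torusKnot_mirror 1,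
    (phiEq_twistKnot_of_neg (p := -1) (by norm_num)).1,
    (phiEq_twistKnot_of_neg (p := -1) (by norm_num)).2, phiEq_torusKnot (p := 2) (by norm_num),
    phiEq_torusKnot_mirror 2, (phiEq_twistKnot_of_pos (p := 2) (by norm_num)).1,
    (phiEq_twistKnot_of_pos (p := 2) (by norm_num)).2,
    (phiEq_twistKnot_of_neg (p := -2) (by norm_num)).1,
    (phiEq_twistKnot_of_neg (p := -2) (by norm_num)).2, phiEq_6_2, phiEq_6_2_mirror, phiEq_6_3,
    phiEq_6_3_mirror, phiEq_torusKnot (p := 3) (by norm_num), phiEq_torusKnot_mirror 3,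
    (phiEq_twistKnot_of_pos (p := 3) (by norm_num)).1,
    (phiEq_twistKnot_of_pos (p := 3) (by norm_num)).2, phiEq_7_3, phiEq_7_3_mirror, phiEq_7_4,
    phiEq_7_4_mirror, phiEq_7_5, phiEq_7_5_mirror, phiEq_7_6, phiEq_7_6_mirror, phiEq_7_7,
    phiEq_7_7_mirror, (phiEq_twistKnot_of_neg (p := -3) (by norm_num)).1,
    (phiEq_twistKnot_of_neg (p := -3) (by norm_num)).2, phiEq_8_2, phiEq_8_2_mirror, phiEq_8_3,
    phiEq_8_3_mirror, phiEq_8_4, phiEq_8_4_mirror, phiEq_8_5_mirror,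
    fun _ hp => phiEq_twistKnot_of_pos hp, fun _ hp => phiEq_twistKnot_of_neg hp,
    fun p hp => ⟨phiEq_torusKnot hp, phiEq_torusKnot_mirror p⟩⟩
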